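/- **Conventions.** In a virtual double category, a cell $\phi\colon(P_1,\dots,P_n)\Rightarrow Q$ with left frame $f$ and right frame $g$ has as source a composable string of $n\ge 0$ proarrows and as target one proarrow; write ${}_f\mathbb{D}_g(P_1,\dots,P_n;Q)$ for the set of these cells. Proarrows are written $P\colon x\nrightarrow y$, vertical arrows $f\colon x\to y$, and vertical arrows are composed as functions. A cell $\theta\colon(P_1,\dots,P_n)\Rightarrow Q$ with identity frames is *opcartesian* if composition with $\theta$ (next to identity cells) is a bijection ${}_f\mathbb{D}_g(\vec R,Q,\vec S;T)\to{}_f\mathbb{D}_g(\vec R,\vec P,\vec S;T)$ for all $f,g,T,\vec R,\vec S$; a *unit* of an object $x$ is a proarrow $U_x\colon x\nrightarrow x$ with an opcartesian cell $()\Rightarrow U_x$. A cell $\phi\colon P\Rightarrow Q$ with frames $f,g$ is *cartesian* if composition with it is a bijection ${}_h\mathbb{D}_k(\vec R;P)\to{}_{fh}\mathbb{D}_{gk}(\vec R;Q)$ for all $h,k,\vec R$; then $P$ is a restriction $Q(g,f)$ of $Q$. A *virtual equipment* is a virtual double category in which every object has a unit and every restriction $Q(g,f)$ exists. A *monoid*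 $M$ on an object $c$ is a proarrow $M\colon c\nrightarrow c$ with unit and multiplication cells $()\Rightarrow M$ and $(M,M)\Rightarrow M$ (identity frames) that are associative and unital. A *monoid homomorphism* is a vertical arrow $f$ with a cell $\vec f\colon M\Rightarrow N$, with both frames $f$, that respects units and multiplications. *Bimodules* between monoids are proarrows with compatible, associative and unital left and right actions. A *bimodule homomorphism* $(B_1,\dots,B_n)\Rightarrow C$ over monoid homomorphisms $f,g$ is a cell, with the underlying vertical arrows as frames, that respects the outer actions and equalizes the two actions of each intermediate monoid (for $n=0$: the left and the right action of the monoid on the target of the cell agree). For a virtual equipment $\mathbb{D}$, $\mathbb{M}\mathrm{od}(\mathbb{D})$ is the virtual double category of monoids, monoid homomorphisms, bimodules and bimodule homomorphisms in $\mathbb{D}$. In a virtual equipment, $U_x$ is a monoid (the *trivial monoid* on $x$), every proarrow is a bimodule between trivial monoids, and every vertical arrow induces a homomorphism of trivial monoids. An *embedding* of a monoid $M$ into $x$ is a monoid homomorphism $i=(i,\vec\imath\,)\colon M\to U_x$. An *embedding* of an $(M,N)$-bimodule $B$ into a proarrow $P\colon x\nrightarrow y$, over embeddings $i\colon M\to x$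 and $j\colon N\to y$, is a bimodule homomorphism $\phi\colon B\Rightarrow P$ over $i,j$; it is *cartesian* if $\vec\imath,\vec\jmath,\phi$ are cartesian. A *collapse* of $M$ is an embedding $i\colon M\to x$ such that every embedding $M\to y$ equals $fi$ for a unique $f\colon x\to y$. A *collapse* of $B$ is an embedding $\phi\colon B\Rightarrow P$ over collapses $i,j$ of $M$ and $N$ such that, for all $f\colon x\to x'$, $g\colon y\to y'$, $Q\colon x'\nrightarrow y'$, every embedding $B\Rightarrow Q$ over $fi,gj$ is $\chi\phi$ for a unique $\chi\in{}_f\mathbb{D}_g(P;Q)$. A collapse $i\colon M\to x$ is *normal* if $\vec\imath\colon M\Rightarrow U_x$ is moreover a collapse of $M$ regarded as an $(M,M)$-bimodule. The *kernel* of $f\colon c\to d$ is the monoid $U_d(f,f)$ on $c$ for which the cartesian cell $U_d(f,f)\Rightarrow U_d$ is an embedding over $f$; $f$ is a *regular cover* if this embedding is a normal collapse. A monoid is *effective* if it is the kernel of a vertical arrow, that is, if it has an embedding $i$ with $\vec\imath$ cartesian; a bimodule is *effective* if it has a cartesian embedding into some proarrow. A virtual equipment is *regular* if (1) every effective monoid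 has a normal collapse, and (2) for all regular covers $f\colon c\to d$, $g\colon c'\to d'$ and every proarrow $B\colon d\nrightarrow d'$, the cartesian embedding of $B(g,f)$ (as a bimodule between the kernels of $f$ and $g$) into $B$ is a collapse. It is *exact* if it is regular and every monoid and every bimodule in it is effective. **Proposition.** For every virtual equipment $\mathbb{D}$, the virtual double category $\mathbb{M}\mathrm{od}(\mathbb{D})$ is a virtual equipment, and it is exact. Moreover, every monoid $M$ in $\mathbb{M}\mathrm{od}(\mathbb{D})$ has a collapse $i$ with $\vec\imath$ cartesian, and every bimodule in $\mathbb{M}\mathrm{od}(\mathbb{D})$ has a collapse that is a cartesian embedding. -/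

import Mathlib

open CategoryTheory

universe u v w z

set_option linter.checkUnivs false

/-- Composable strings `a ⇸ ⋯ ⇸ b` of proarrows, possibly empty. -/
inductive ProPath {O : Type u} (P : O → O → Type w) : O → O → Type (max u w)
  | nil (a : O) : ProPath P a a
  | cons {a b c : O} (A : P a b) (p : ProPath P b c) : ProPath P a c

namespace ProPath

variable {O : Type u} {P : O → O → Type w}

/-- The string consisting of one proarrow. -/
abbrev single {a b : O} (A : P a b) : ProPath P a b := cons A (nil b)

/-- The string consisting of two proarrows. -/
abbrev pair {a b c : O} (A : P a b) (B : P b c) : ProPath P a c := cons A (cons B (nil c))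

/-- Concatenation of strings. -/
def append {a b c : O} : ProPath P a b → ProPath P b c → ProPath P a c
  | nil _, q => q
  | cons A p, q => cons A (append p q)

@[simp] theorem nil_append {a b : O} (q : ProPath P a b) : (nil a).append q = q := rfl

@[simp] theorem cons_append {a b c d : O} (A : P a b) (p : ProPath P b c) (q : ProPath P c d) :
    (cons A p).append q = cons A (p.append q) := rfl

@[simp] theorem append_nil {a b : O} : ∀ p : ProPath P a b, p.append (nil b) = p
  | nil _ => rfl
  | cons A p => congrArg (cons A) (append_nil p)

theorem append_assoc {a b c d : O} : ∀ (p : ProPath P a b) (q : ProPath P b c)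
    (r : ProPath P c d), (p.append q).append r = p.append (q.append r)
  | nil _, _, _ => rfl
  | cons A p, q, r => congrArg (cons A) (append_assoc p q r)

/-- The image of a string under a map of objects and proarrows. -/
def map {O' : Type*} {P' : O' → O' → Type*} (F : O → O') (G : ∀ {a b}, P a b → P' (F a) (F b))
    {a b : O} : ProPath P a b → ProPath P' (F a) (F b)
  | nil a => nil (F a)
  | cons A p => cons (G A) (map F G p)

theorem map_append {O' : Type*} {P' : O' → O' → Type*} (F : O → O')
    (G : ∀ {a b}, P a b → P' (F a) (F b)) {a b c : O} : ∀ (p : ProPath P a b) (q : ProPath P b c),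
    (p.append q).map F G = (p.map F G).append (q.map F G)
  | nil _, _ => rfl
  | cons A p, q => congrArg (cons (G A)) (map_append F G p q)

end ProPath

/-- The shape of a virtual double category: a vertical category, proarrows, and 2-cells
`Cell f g p B` with left frame `f`, right frame `g`, source the string `p` and target `B`. -/
structure VDShape where
  Obj : Type u
  [cat : Category.{v} Obj]
  Pro : Obj → Obj → Type w
  Cell : ∀ {a b c d : Obj}, (a ⟶ c) → (b ⟶ d) → ProPath Pro a b → Pro c d → Type z

attribute [instance] VDShape.cat

namespace VDShape

/-- Strings of proarrows of `S`. -/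
abbrev Path (S : VDShape.{u, v, w, z}) : S.Obj → S.Obj → Type (max u w) := ProPath S.Pro

/-- Strings of horizontally adjacent 2-cells. `CellSeq f g p q` has outer frames `f` and `g`; the
targets of its cells form the string `q`, and the concatenation of their sources is `p`. -/
inductive CellSeq (S : VDShape.{u, v, w, z}) : ∀ {a b c d : S.Obj}, (a ⟶ c) → (b ⟶ d) →
    S.Path a b → S.Path c d → Type (max u v w z)
  | nil {a c : S.Obj} (f : a ⟶ c) : CellSeq S f f (.nil a) (.nil c)
  | cons {a b c a' b' c' : S.Obj} {f : a ⟶ a'} {g : b ⟶ b'} {h : c ⟶ c'} {p : S.Path a b}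
      {q : S.Path b c} {s : S.Path a c} {A : S.Pro a' b'} {r : S.Path b' c'}
      (φ : S.Cell f g p A) (Φ : CellSeq S g h q r) (e : s = p.append q) :
      CellSeq S f h s (.cons A r)

namespace CellSeq

variable {S : VDShape.{u, v, w, z}}

/-- Transport along equalities of the source and target strings. -/
def cast {a b c d : S.Obj} {f : a ⟶ c} {g : b ⟶ d} {p p' : S.Path a b} {q q' : S.Path c d}
    (Φ : S.CellSeq f g p q) (ep : p' = p) (eq : q' = q) : S.CellSeq f g p' q' := by
  subst ep eq; exact Φ

@[simp] theorem cast_rfl {a b c d : S.Obj} {f : a ⟶ c} {g : b ⟶ d} {p : S.Path a b}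
    {q : S.Path c d} (Φ : S.CellSeq f g p q) (ep : p = p) (eq : q = q) : Φ.cast ep eq = Φ := rfl

/-- Concatenation of strings of cells. -/
def append {a b c a' b' c' : S.Obj} {f : a ⟶ a'} {g : b ⟶ b'} {h : c ⟶ c'} {p : S.Path a b}
    {p' : S.Path b c} {q : S.Path a' b'} {q' : S.Path b' c'} :
    S.CellSeq f g p q → S.CellSeq g h p' q' → S.CellSeq f h (p.append p') (q.append q')
  | nil _, Ψ => Ψ
  | cons φ Φ e, Ψ => cons φ (append Φ Ψ) (by rw [e, ProPath.append_assoc])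

/-- A string consisting of one cell. -/
def single {a b c d : S.Obj} {f : a ⟶ c} {g : b ⟶ d} {p : S.Path a b} {A : S.Pro c d}
    (φ : S.Cell f g p A) : S.CellSeq f g p (.single A) :=
  cons φ (nil g) (ProPath.append_nil p).symm

/-- A string consisting of two cells. -/
def pair {a b c a' b' c' : S.Obj} {f : a ⟶ a'} {g : b ⟶ b'} {h : c ⟶ c'} {p : S.Path a b}
    {q : S.Path b c} {s : S.Path a c} {A : S.Pro a' b'} {B : S.Pro b' c'} (φ : S.Cell f g p A)
    (ψ : S.Cell g h q B) (e : s = p.append q := by rfl) : S.CellSeq f h s (.pair A B) :=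
  cons φ (single ψ) e

/-- A string of cells cut into two strings. -/
structure Cut {a b c c' c'' : S.Obj} (f : a ⟶ c) (g : b ⟶ c'') (p : S.Path a b)
    (q₁ : S.Path c c') (q₂ : S.Path c' c'') where
  {mid : S.Obj}
  {frame : mid ⟶ c'}
  {src₁ : S.Path a mid}
  {src₂ : S.Path mid b}
  fst : S.CellSeq f frame src₁ q₁
  snd : S.CellSeq frame g src₂ q₂
  eq : p = src₁.append src₂

/-- Putting one more cell in front of a string that has been cut. -/
def Cut.cons {a a₁ b c c₁ c' c'' : S.Obj} {f : a ⟶ c} {f₁ : a₁ ⟶ c₁} {g : b ⟶ c''}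
    {p : S.Path a a₁} {q : S.Path a₁ b} {s : S.Path a b} {A : S.Pro c c₁} {q₁ : S.Path c₁ c'}
    {q₂ : S.Path c' c''} (φ : S.Cell f f₁ p A) (C : Cut f₁ g q q₁ q₂) (e : s = p.append q) :
    Cut f g s (.cons A q₁) q₂ :=
  ⟨.cons φ C.fst rfl, C.snd, by
    rw [e, ProPath.append_assoc]; exact congrArg _ C.eq⟩

/-- Cutting a string of cells according to a decomposition of its target. -/
def cut : ∀ {a b c c' c'' : S.Obj} {f : a ⟶ c} {g : b ⟶ c''} {p : S.Path a b}
    (q₁ : S.Path c c') {q₂ : S.Path c' c''}, S.CellSeq f g p (q₁.append q₂) → Cut f g p q₁ q₂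
  | _, _, _, _, _, f, _, _, .nil _, _, Φ => ⟨nil f, Φ, rfl⟩
  | _, _, _, _, _, _, _, _, .cons A q₁, q₂, Φ =>
    match (Φ : S.CellSeq _ _ _ (.cons A (q₁.append q₂))) with
    | cons φ Φ e => .cons φ (cut q₁ Φ) e

theorem cut_append {a b c a' b' c' : S.Obj} {f : a ⟶ a'} {g : b ⟶ b'} {h : c ⟶ c'}
    {p : S.Path a b} {p' : S.Path b c} {q : S.Path a' b'} {q' : S.Path b' c'}
    (Φ : S.CellSeq f g p q) (Ψ : S.CellSeq g h p' q') :
    cut q (Φ.append Ψ) = ⟨Φ, Ψ, rfl⟩ := by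
  induction Φ with
  | nil f => rfl
  | cons φ Φ e ih =>
    subst e
    change Cut.cons φ (cut _ (append Φ Ψ)) (ProPath.append_assoc _ _ _) = _
    rw [ih]
    rfl

end CellSeq

end VDShape

/-- The operations of a virtual double category: identity 2-cells, and the composition of a 2-cell
with a string of 2-cells whose targets form its source. The frames of the composite are recorded up
to an equality, as composition of vertical arrows is associative and unital only propositionally. -/
structure VDOps extends VDShape.{u, v, w, z} where
  idCell : ∀ {a b : Obj} (A : Pro a b), Cell (𝟙 a) (𝟙 b) (.single A) A
  comp : ∀ {a b c d e e' : Obj} {h : a ⟶ c} {k : b ⟶ d} {f : c ⟶ e} {g : d ⟶ e'}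
    {p : ProPath Pro a b} {q : ProPath Pro c d} {B : Pro e e'} {f' : a ⟶ e} {g' : b ⟶ e'},
    toVDShape.CellSeq h k p q → Cell f g q B → f' = h ≫ f → g' = k ≫ g → Cell f' g' p B

namespace VDOps

variable (D : VDOps.{u, v, w, z})

/-- The string of identity cells on a string of proarrows. -/
def idSeq : ∀ {a b : D.Obj} (p : D.Path a b), D.CellSeq (𝟙 a) (𝟙 b) p p
  | _, _, .nil a => .nil (𝟙 a)
  | _, _, .cons A p => .cons (D.idCell A) (idSeq p) rfl

variable {D}

/-- Composition of a string of cells `Φ` with a string of cells `Ψ` whose source is the target of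
`Φ`: each cell of `Ψ` is composed with the corresponding part of `Φ`. -/
def compSeq : ∀ {a b c d e e' : D.Obj} {h : a ⟶ c} {k : b ⟶ d} {f : c ⟶ e} {g : d ⟶ e'}
    {p : D.Path a b} {q : D.Path c d} {r : D.Path e e'} {f' : a ⟶ e} {g' : b ⟶ e'},
    D.CellSeq h k p q → D.CellSeq f g q r → f' = h ≫ f → g' = k ≫ g → D.CellSeq f' g' p r
  | _, _, _, _, _, _, _, _, _, _, _, _, _, _, _, .nil h, .nil f, ef, eg => by
    subst ef eg; exact .nil (h ≫ f)
  | _, _, _, _, _, _, _, _, _, _, _, _, _, _, _, Φ, .cons (p := q₁) ψ Ψ e, ef, eg =>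
    let C := (Φ.cast rfl e.symm).cut q₁
    .cons (D.comp C.fst ψ ef rfl) (compSeq C.snd Ψ rfl eg) C.eq

end VDOps

/-- A virtual double category. -/
structure VirtualDoubleCategory extends VDOps.{u, v, w, z} where
  id_comp : ∀ {a b c d : Obj} {f : a ⟶ c} {g : b ⟶ d} {p : ProPath Pro a b} {B : Pro c d}
    (φ : Cell f g p B), comp (toVDOps.idSeq p) φ (Category.id_comp f).symm
      (Category.id_comp g).symm = φ
  comp_id : ∀ {a b c d : Obj} {f : a ⟶ c} {g : b ⟶ d} {p : ProPath Pro a b} {B : Pro c d}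
    (φ : Cell f g p B), comp (.single φ) (idCell B) (Category.comp_id f).symm
      (Category.comp_id g).symm = φ
  assoc : ∀ {a b a₁ b₁ a₂ b₂ a₃ b₃ : Obj} {f₁ : a ⟶ a₁} {g₁ : b ⟶ b₁} {f₂ : a₁ ⟶ a₂}
    {g₂ : b₁ ⟶ b₂} {f₃ : a₂ ⟶ a₃} {g₃ : b₂ ⟶ b₃} {p : ProPath Pro a b} {q : ProPath Pro a₁ b₁}
    {r : ProPath Pro a₂ b₂} {B : Pro a₃ b₃} (Φ : toVDShape.CellSeq f₁ g₁ p q)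
    (Ψ : toVDShape.CellSeq f₂ g₂ q r) (χ : Cell f₃ g₃ r B),
    comp (VDOps.compSeq (D := toVDOps) Φ Ψ rfl rfl) χ (Category.assoc f₁ f₂ f₃).symm
      (Category.assoc g₁ g₂ g₃).symm = comp Φ (comp Ψ χ rfl rfl) rfl rfl

namespace ProPath

variable {O : Type u} {P : O → O → Type w}

theorem append_left_cancel {a b c : O} : ∀ (p : ProPath P a b) {q q' : ProPath P b c},
    p.append q = p.append q' → q = q'
  | nil _, _, _, h => h
  | cons A p, _, _, h => append_left_cancel p (by
      simp only [cons_append] at h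
      injection h)

end ProPath

namespace VDShape

variable {S : VDShape.{u, v, w, z}}

/-- A 2-cell together with its boundary. -/
structure AnyCell (S : VDShape.{u, v, w, z}) where
  {a b c d : S.Obj}
  {f : a ⟶ c}
  {g : b ⟶ d}
  {p : S.Path a b}
  {B : S.Pro c d}
  cell : S.Cell f g p B

namespace CellSeq

/-- The list of the cells of a string of cells. -/
def toList {a b c d : S.Obj} {f : a ⟶ c} {g : b ⟶ d} {p : S.Path a b} {q : S.Path c d} :
    S.CellSeq f g p q → List S.AnyCell
  | nil _ => []
  | cons φ Φ _ => ⟨φ⟩ :: toList Φ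

@[simp] theorem toList_nil {a c : S.Obj} (f : a ⟶ c) : (nil f : S.CellSeq _ _ _ _).toList = [] := rfl

@[simp] theorem toList_cons {a b c a' b' c' : S.Obj} {f : a ⟶ a'} {g : b ⟶ b'} {h : c ⟶ c'}
    {p : S.Path a b} {q : S.Path b c} {s : S.Path a c} {A : S.Pro a' b'} {r : S.Path b' c'}
    (φ : S.Cell f g p A) (Φ : CellSeq S g h q r) (e : s = p.append q) :
    (cons φ Φ e).toList = ⟨φ⟩ :: Φ.toList := rfl

@[simp] theorem toList_single {a b c d : S.Obj} {f : a ⟶ c} {g : b ⟶ d} {p : S.Path a b}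
    {A : S.Pro c d} (φ : S.Cell f g p A) : (single φ).toList = [⟨φ⟩] := rfl

@[simp] theorem toList_pair {a b c a' b' c' : S.Obj} {f : a ⟶ a'} {g : b ⟶ b'} {h : c ⟶ c'}
    {p : S.Path a b} {q : S.Path b c} {s : S.Path a c} {A : S.Pro a' b'} {B : S.Pro b' c'}
    (φ : S.Cell f g p A) (ψ : S.Cell g h q B) (e : s = p.append q) : (pair φ ψ e).toList = [⟨φ⟩, ⟨ψ⟩] := rfl

@[simp] theorem toList_cast {a b c d : S.Obj} {f : a ⟶ c} {g : b ⟶ d} {p p' : S.Path a b}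
    {q q' : S.Path c d} (Φ : S.CellSeq f g p q) (ep : p' = p) (eq : q' = q) :
    (Φ.cast ep eq).toList = Φ.toList := by
  subst ep eq; rfl

@[simp] theorem toList_append {a b c a' b' c' : S.Obj} {f : a ⟶ a'} {g : b ⟶ b'} {h : c ⟶ c'}
    {p : S.Path a b} {p' : S.Path b c} {q : S.Path a' b'} {q' : S.Path b' c'}
    (Φ : S.CellSeq f g p q) (Ψ : S.CellSeq g h p' q') :
    (Φ.append Ψ).toList = Φ.toList ++ Ψ.toList := by
  induction Φ with
  | nil f => rfl
  | cons φ Φ e ih => exact congrArg _ (ih Ψ)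

theorem ext_toList {a b c d : S.Obj} {f : a ⟶ c} {g : b ⟶ d} {p : S.Path a b} {q : S.Path c d}
    {Φ Ψ : S.CellSeq f g p q} (h : Φ.toList = Ψ.toList) : Φ = Ψ := by
  induction Φ with
  | nil f => cases Ψ; rfl
  | cons φ Φ e ih =>
    cases Ψ with
    | cons ψ Ψ e' =>
      simp only [toList_cons, List.cons.injEq, AnyCell.mk.injEq] at h
      obtain ⟨⟨-, h₁, -, -, -, h₂, h₃, -, h₄⟩, h₅⟩ := h
      subst h₁ h₂ h₃ h₄ e
      obtain rfl := ProPath.append_left_cancel _ e'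
      rw [ih h₅]

end CellSeq

end VDShape

namespace VDOps

variable {D : VDOps.{u, v, w, z}}

theorem compSeq_nil {a b c : D.Obj} (h : a ⟶ b) (f : b ⟶ c) {f' g' : a ⟶ c} (ef : f' = h ≫ f)
    (eg : g' = h ≫ f) : (compSeq (D := D) (.nil h) (.nil f) ef eg).toList = [] := by
  subst ef eg; rfl

theorem compSeq_cons {a b b₁ c d d₁ e e' e₁ : D.Obj} {h : a ⟶ c} {k₁ : b₁ ⟶ d₁} {k : b ⟶ d}
    {f : c ⟶ e} {g₁ : d₁ ⟶ e₁} {g : d ⟶ e'} {p : D.Path a b₁} {p₁ : D.Path b₁ b}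
    {q : D.Path c d₁} {q₁ : D.Path d₁ d} {s : D.Path a b} {t : D.Path c d} {A : D.Pro e e₁}
    {r : D.Path e₁ e'} {f' : a ⟶ e} {g' : b ⟶ e'} (X : D.CellSeq h k s t) (Φ : D.CellSeq h k₁ p q)
    (Φ₁ : D.CellSeq k₁ k p₁ q₁) (hX : X.toList = Φ.toList ++ Φ₁.toList)
    (ψ : D.Cell f g₁ q A) (Ψ : D.CellSeq g₁ g q₁ r)
    (es : s = p.append p₁) (et : t = q.append q₁) (ef : f' = h ≫ f) (eg : g' = k ≫ g)
    {w : b₁ ⟶ e₁} (ew : w = k₁ ≫ g₁) :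
    compSeq X (.cons ψ Ψ et) ef eg = .cons (D.comp Φ ψ ef ew) (compSeq Φ₁ Ψ ew eg) es := by
  obtain rfl : X = (Φ.append Φ₁).cast es et := VDShape.CellSeq.ext_toList (by simpa using hX)
  subst es et ew
  have key : ∀ C : VDShape.CellSeq.Cut h k (p.append p₁) q q₁, C = ⟨Φ, Φ₁, rfl⟩ →
      VDShape.CellSeq.cons (D.comp C.fst ψ ef rfl) (compSeq C.snd Ψ rfl eg) C.eq =
        .cons (D.comp Φ ψ ef rfl) (compSeq Φ₁ Ψ rfl eg) rfl := by
    rintro _ rfl; rfl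
  rw [compSeq]
  exact key _ (VDShape.CellSeq.cut_append Φ Φ₁)

end VDOps

namespace VDOps

variable {D : VDOps.{u, v, w, z}}

@[simp] theorem idSeq_nil (a : D.Obj) : D.idSeq (.nil a) = .nil (𝟙 a) := rfl

@[simp] theorem idSeq_cons {a b c : D.Obj} (A : D.Pro a b) (p : D.Path b c) :
    D.idSeq (.cons A p) = .cons (D.idCell A) (D.idSeq p) rfl := rfl

@[simp] theorem toList_idSeq_append {a b c : D.Obj} (p : D.Path a b) (q : D.Path b c) :
    (D.idSeq (p.append q)).toList = (D.idSeq p).toList ++ (D.idSeq q).toList := by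
  induction p with
  | nil a => rfl
  | cons A p ih => exact congrArg _ (ih q)

theorem exists_cut {S : VDShape.{u, v, w, z}} {a b c c' c'' : S.Obj} {f : a ⟶ c} {g : b ⟶ c''}
    {p : S.Path a b} {t : S.Path c c''} (Φ : S.CellSeq f g p t) (q₁ : S.Path c c')
    (q₂ : S.Path c' c'') (et : t = q₁.append q₂) :
    ∃ (m : S.Obj) (k : m ⟶ c') (p₁ : S.Path a m) (p₂ : S.Path m b) (Φ₁ : S.CellSeq f k p₁ q₁)
      (Φ₂ : S.CellSeq k g p₂ q₂), p = p₁.append p₂ ∧ Φ.toList = Φ₁.toList ++ Φ₂.toList := by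
  induction q₁ generalizing a with
  | nil => exact ⟨_, f, .nil _, p, .nil f, Φ.cast rfl et.symm, rfl,
    (VDShape.CellSeq.toList_cast Φ rfl et.symm).symm⟩
  | cons A q ih =>
    rw [ProPath.cons_append] at et
    cases Φ with
    | nil f => cases et
    | cons φ Φ e =>
      cases et
      obtain ⟨m, k, p₁, p₂, Φ₁, Φ₂, h₁, h₂⟩ := ih Φ q₂ rfl
      exact ⟨m, k, _, p₂, .cons φ Φ₁ rfl, Φ₂, by rw [e, h₁, ProPath.append_assoc], by
        simp [h₂]⟩

theorem compSeq_append {a b c a₁ b₁ c₁ a₂ b₂ c₂ : D.Obj} {f : a ⟶ a₁} {g : b ⟶ b₁} {h : c ⟶ c₁}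
    {f₁ : a₁ ⟶ a₂} {g₁ : b₁ ⟶ b₂} {h₁ : c₁ ⟶ c₂} {f₂ : a ⟶ a₂} {g₂ : b ⟶ b₂} {h₂ : c ⟶ c₂}
    {p : D.Path a b} {p' : D.Path b c} {q : D.Path a₁ b₁} {q' : D.Path b₁ c₁} {r : D.Path a₂ b₂}
    {r' : D.Path b₂ c₂} {s : D.Path a c} {t : D.Path a₁ c₁} {x : D.Path a₂ c₂}
    (X : D.CellSeq f h s t) (Y : D.CellSeq f₁ h₁ t x)
    (Φ : D.CellSeq f g p q) (Φ' : D.CellSeq g h p' q') (Ψ : D.CellSeq f₁ g₁ q r)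
    (Ψ' : D.CellSeq g₁ h₁ q' r') (es : s = p.append p') (et : t = q.append q')
    (ex : x = r.append r') (hX : X.toList = Φ.toList ++ Φ'.toList)
    (hY : Y.toList = Ψ.toList ++ Ψ'.toList) (ef : f₂ = f ≫ f₁) (eg : g₂ = g ≫ g₁)
    (eh : h₂ = h ≫ h₁) :
    (compSeq X Y ef eh).toList = (compSeq Φ Ψ ef eg).toList ++ (compSeq Φ' Ψ' eg eh).toList := by
  induction Ψ generalizing a with
  | nil k =>
    cases Φ with
    | nil k' =>
      subst es et ex ef eg
      rw [compSeq_nil]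
      obtain rfl : X = Φ' := VDShape.CellSeq.ext_toList hX
      obtain rfl : Y = Ψ' := VDShape.CellSeq.ext_toList hY
      rfl
  | cons ψ Ψ e ih =>
    rename_i qa qb _ _ _
    obtain ⟨m, k, p₁, p₂, Φ₁, Φ₂, h₁, h₂⟩ := exists_cut Φ _ _ e
    subst e ex
    rw [compSeq_cons Φ Φ₁ Φ₂ h₂ ψ Ψ h₁ rfl ef eg rfl]
    subst et
    obtain rfl : Y = .cons ψ (Ψ.append Ψ') (ProPath.append_assoc _ _ _) :=
      VDShape.CellSeq.ext_toList (by simpa using hY)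
    refine (congrArg VDShape.CellSeq.toList (compSeq_cons X Φ₁ (Φ₂.append Φ') (by simp [hX, h₂]) ψ
      (Ψ.append Ψ') (by rw [es, h₁, ProPath.append_assoc]) _ ef eh rfl)).trans ?_
    simp only [VDShape.CellSeq.toList_cons, List.cons_append]
    rw [ih (X := Φ₂.append Φ') (Y := Ψ.append Ψ') (Φ := Φ₂) Φ' Ψ' rfl rfl rfl (by simp) (by simp)
      rfl eg]

theorem toList_compSeq_single {a b c a₁ b₁ : D.Obj} {b₂ : D.Obj} {f : a ⟶ a₁} {g : b ⟶ b₁}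
    {f₁ : a₁ ⟶ c} {g₁ : b₁ ⟶ b₂} {f₂ : a ⟶ c} {g₂ : b ⟶ b₂} {p : D.Path a b} {q : D.Path a₁ b₁}
    {A : D.Pro c b₂} (Φ : D.CellSeq f g p q) (ψ : D.Cell f₁ g₁ q A) (ef : f₂ = f ≫ f₁)
    (eg : g₂ = g ≫ g₁) :
    compSeq Φ (.single ψ) ef eg = .single (D.comp Φ ψ ef eg) := by
  rw [VDShape.CellSeq.single, compSeq_cons Φ Φ (.nil g) (by simp) ψ (.nil g₁) (by simp) _ ef eg eg]
  exact VDShape.CellSeq.ext_toList (by simp [compSeq_nil])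

end VDOps

namespace VirtualDoubleCategory

variable {D : VirtualDoubleCategory.{u, v, w, z}}

theorem id_compSeq {a b c d : D.Obj} {f f' : a ⟶ c} {g g' : b ⟶ d} {p : D.Path a b}
    {q : D.Path c d} (Φ : D.CellSeq f g p q) (ef : f' = 𝟙 a ≫ f) (eg : g' = 𝟙 b ≫ g) :
    (VDOps.compSeq (D.idSeq p) Φ ef eg).toList = Φ.toList := by
  induction Φ with
  | nil f => exact VDOps.compSeq_nil _ _ _ _
  | cons φ Φ e ih =>
    subst e
    obtain rfl := ef.trans (Category.id_comp _)
    rw [VDOps.compSeq_cons (D.idSeq _) (D.idSeq _) (D.idSeq _) (by simp) φ Φ rfl rfl _ eg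
      (Category.id_comp _).symm, D.id_comp]
    exact congrArg _ (ih _ _)

theorem compSeq_id {a b c d : D.Obj} {f f' : a ⟶ c} {g g' : b ⟶ d} {p : D.Path a b}
    {q : D.Path c d} (Φ : D.CellSeq f g p q) (ef : f' = f ≫ 𝟙 c) (eg : g' = g ≫ 𝟙 d) :
    (VDOps.compSeq Φ (D.idSeq q) ef eg).toList = Φ.toList := by
  induction Φ with
  | nil f => exact VDOps.compSeq_nil _ _ _ _
  | cons φ Φ e ih =>
    subst e
    obtain rfl := ef.trans (Category.comp_id _)
    rw [VDOps.idSeq_cons, VDOps.compSeq_cons (.cons φ Φ rfl) (.single φ) Φ (by simp) _ _ rfl rfl _ eg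
      (Category.comp_id _).symm, D.comp_id]
    exact congrArg _ (ih _ _)

theorem comp_comp {a b a₁ b₁ a₂ b₂ a₃ b₃ : D.Obj} {f₁ : a ⟶ a₁} {g₁ : b ⟶ b₁} {f₂ : a₁ ⟶ a₂}
    {g₂ : b₁ ⟶ b₂} {f₃ : a₂ ⟶ a₃} {g₃ : b₂ ⟶ b₃} {p : D.Path a b} {q : D.Path a₁ b₁}
    {r : D.Path a₂ b₂} {B : D.Pro a₃ b₃} {f₂₃ : a₁ ⟶ a₃} {g₂₃ : b₁ ⟶ b₃} {f : a ⟶ a₃} {g : b ⟶ b₃}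
    {f₁₂ : a ⟶ a₂} {g₁₂ : b ⟶ b₂} (Φ : D.CellSeq f₁ g₁ p q) (Ψ : D.CellSeq f₂ g₂ q r)
    (χ : D.Cell f₃ g₃ r B) (e₁ : f₂₃ = f₂ ≫ f₃) (e₂ : g₂₃ = g₂ ≫ g₃) (e₃ : f = f₁ ≫ f₂₃)
    (e₄ : g = g₁ ≫ g₂₃) (Ω : D.CellSeq f₁₂ g₁₂ p r) (e₅ : f₁₂ = f₁ ≫ f₂) (e₆ : g₁₂ = g₁ ≫ g₂)
    (hΩ : (VDOps.compSeq Φ Ψ e₅ e₆).toList = Ω.toList) :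
    D.comp Φ (D.comp Ψ χ e₁ e₂) e₃ e₄ =
      D.comp Ω χ (by rw [e₃, e₁, e₅, Category.assoc]) (by rw [e₄, e₂, e₆, Category.assoc]) := by
  obtain rfl := VDShape.CellSeq.ext_toList hΩ
  subst e₁ e₂ e₃ e₄ e₅ e₆
  exact (D.assoc Φ Ψ χ).symm

end VirtualDoubleCategory

namespace VirtualDoubleCategory

open VDShape (CellSeq)

variable {D : VirtualDoubleCategory.{u, v, w, z}}

theorem comp_single {a b a₁ b₁ a₂ b₂ a₃ b₃ : D.Obj} {f₁ : a ⟶ a₁} {g₁ : b ⟶ b₁} {f₂ : a₁ ⟶ a₂}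
    {g₂ : b₁ ⟶ b₂} {f₃ : a₂ ⟶ a₃} {g₃ : b₂ ⟶ b₃} {p : D.Path a b} {q : D.Path a₁ b₁}
    {A : D.Pro a₂ b₂} {B : D.Pro a₃ b₃} {f₂₃ : a₁ ⟶ a₃} {g₂₃ : b₁ ⟶ b₃} {f : a ⟶ a₃} {g : b ⟶ b₃}
    {f₁₂ : a ⟶ a₂} {g₁₂ : b ⟶ b₂} (Φ : D.CellSeq f₁ g₁ p q) (ψ : D.Cell f₂ g₂ q A)
    (χ : D.Cell f₃ g₃ (.single A) B) (e₁ : f₂₃ = f₂ ≫ f₃) (e₂ : g₂₃ = g₂ ≫ g₃) (e₃ : f = f₁ ≫ f₂₃)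
    (e₄ : g = g₁ ≫ g₂₃) (e₅ : f₁₂ = f₁ ≫ f₂) (e₆ : g₁₂ = g₁ ≫ g₂) :
    D.comp Φ (D.comp (.single ψ) χ e₁ e₂) e₃ e₄ =
      D.comp (.single (D.comp Φ ψ e₅ e₆)) χ (by rw [e₃, e₁, e₅, Category.assoc])
        (by rw [e₄, e₂, e₆, Category.assoc]) :=
  comp_comp Φ _ χ e₁ e₂ e₃ e₄ _ e₅ e₆ (by rw [VDOps.toList_compSeq_single])

theorem comp_pair {a b c a₁ b₁ c₁ a₂ b₂ c₂ a₃ c₃ : D.Obj} {f₁ : a ⟶ a₁} {g₁ : b ⟶ b₁}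
    {h₁ : c ⟶ c₁} {f₂ : a₁ ⟶ a₂} {g₂ : b₁ ⟶ b₂} {h₂ : c₁ ⟶ c₂} {f₃ : a₂ ⟶ a₃} {h₃ : c₂ ⟶ c₃}
    {p : D.Path a b} {p' : D.Path b c} {q : D.Path a₁ b₁} {q' : D.Path b₁ c₁} {s : D.Path a c}
    {A : D.Pro a₂ b₂} {A' : D.Pro b₂ c₂} {B : D.Pro a₃ c₃} {f₂₃ : a₁ ⟶ a₃} {h₂₃ : c₁ ⟶ c₃}
    {f : a ⟶ a₃} {h : c ⟶ c₃} {f₁₂ : a ⟶ a₂} {g₁₂ : b ⟶ b₂} {h₁₂ : c ⟶ c₂}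
    {t : D.Path a₁ c₁}
    (X : D.CellSeq f₁ h₁ s t) (Φ : D.CellSeq f₁ g₁ p q) (Φ' : D.CellSeq g₁ h₁ p' q')
    (ψ : D.Cell f₂ g₂ q A) (ψ' : D.Cell g₂ h₂ q' A')
    (χ : D.Cell f₃ h₃ (.pair A A') B) (es : s = p.append p') (et : t = q.append q')
    (hX : X.toList = Φ.toList ++ Φ'.toList) (e₁ : f₂₃ = f₂ ≫ f₃) (e₂ : h₂₃ = h₂ ≫ h₃)
    (e₃ : f = f₁ ≫ f₂₃) (e₄ : h = h₁ ≫ h₂₃) (e₅ : f₁₂ = f₁ ≫ f₂) (e₆ : g₁₂ = g₁ ≫ g₂)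
    (e₇ : h₁₂ = h₁ ≫ h₂) :
    D.comp X (D.comp (.pair ψ ψ' et) χ e₁ e₂) e₃ e₄ =
      D.comp (.pair (D.comp Φ ψ e₅ e₆) (D.comp Φ' ψ' e₆ e₇) es) χ
        (by rw [e₃, e₁, e₅, Category.assoc]) (by rw [e₄, e₂, e₇, Category.assoc]) := by
  refine comp_comp X _ χ e₁ e₂ e₃ e₄ _ e₅ e₇ ?_
  rw [CellSeq.pair, VDOps.compSeq_cons X Φ Φ' hX ψ (.single ψ') es et e₅ e₇ e₆,
    VDOps.toList_compSeq_single]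
  rfl

variable (D)

/-- Monoids `(c, M, e, m)` in a virtual double category. -/
structure Mon where
  obj : D.Obj
  pro : D.Pro obj obj
  unit : D.Cell (𝟙 obj) (𝟙 obj) (.nil obj) pro
  mul : D.Cell (𝟙 obj) (𝟙 obj) (.pair pro pro) pro
  unit_mul : D.comp (.pair unit (D.idCell pro)) mul (by simp) (by simp) = D.idCell pro
  mul_unit : D.comp (.pair (D.idCell pro) unit) mul (by simp) (by simp) = D.idCell pro
  mul_assoc : D.comp (p := .cons pro (.pair pro pro)) (f' := 𝟙 obj) (g' := 𝟙 obj) (.pair mul (D.idCell pro)) mul (by simp) (by simp) =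
    D.comp (.pair (D.idCell pro) mul) mul (by simp) (by simp)

variable {D}

namespace Mon

/-- Monoid homomorphisms. -/
@[ext] structure Hom (M N : D.Mon) where
  hom : M.obj ⟶ N.obj
  cell : D.Cell hom hom (.single M.pro) N.pro
  unit_cell : D.comp (f' := hom) (g' := hom) (.single M.unit) cell (by simp) (by simp) =
    D.comp (.nil hom) N.unit (by simp) (by simp)
  mul_cell : D.comp (f' := hom) (g' := hom) (.single M.mul) cell (by simp) (by simp) =
    D.comp (.pair cell cell) N.mul (by simp) (by simp)

theorem Hom.ext' {M N : D.Mon} {f g : Hom M N} (h : f.hom = g.hom)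
    (hc : D.comp (f' := g.hom) (g' := g.hom) (.single f.cell) (D.idCell N.pro) (by simp [h])
      (by simp [h]) = g.cell) : f = g := by
  obtain ⟨f, φ, _, _⟩ := f
  obtain ⟨g, ψ, _, _⟩ := g
  obtain rfl : f = g := h
  obtain rfl : φ = ψ := (D.comp_id φ).symm.trans hc
  rfl

/-- The identity homomorphism. -/
def Hom.id (M : D.Mon) : Hom M M where
  hom := 𝟙 M.obj
  cell := D.idCell M.pro
  unit_cell := (D.comp_id M.unit).trans (D.id_comp M.unit).symm
  mul_cell := (D.comp_id M.mul).trans (D.id_comp M.mul).symm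

/-- Composition of monoid homomorphisms. -/
def Hom.comp {M N P : D.Mon} (f : Hom M N) (g : Hom N P) : Hom M P where
  hom := f.hom ≫ g.hom
  cell := D.comp (.single f.cell) g.cell rfl rfl
  unit_cell := by
    rw [comp_single (f₁₂ := f.hom) (g₁₂ := f.hom) _ _ _ _ _ _ _ (by simp) (by simp), f.unit_cell,
      ← comp_single (f₂₃ := g.hom) (g₂₃ := g.hom) _ _ _ (by simp) (by simp) rfl rfl, g.unit_cell]
    exact comp_comp _ _ _ _ _ _ _ _ rfl rfl (VDOps.compSeq_nil _ _ _ _)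
  mul_cell := by
    rw [comp_single (f₁₂ := f.hom) (g₁₂ := f.hom) _ _ _ _ _ _ _ (by simp) (by simp), f.mul_cell,
      ← comp_single (f₂₃ := g.hom) (g₂₃ := g.hom) _ _ _ (by simp) (by simp) rfl rfl, g.mul_cell]
    exact comp_pair _ (.single f.cell) (.single f.cell) _ _ _ rfl rfl rfl _ _ _ _ _ _ _

instance : Category D.Mon where
  Hom := Hom
  id := Hom.id
  comp := Hom.comp
  id_comp {M N} f := Hom.ext' (Category.id_comp _) ((comp_single (f₂₃ := f.hom) (g₂₃ := f.hom)
    (.single (D.idCell M.pro)) f.cell (D.idCell N.pro) (by simp) (by simp) (by simp) (by simp) rfl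
    rfl).symm.trans ((congrArg (fun x => D.comp _ x _ _) (D.comp_id _)).trans (D.id_comp f.cell)))
  comp_id {M N} f := Hom.ext' (Category.comp_id _) ((comp_single (f₂₃ := 𝟙 _) (g₂₃ := 𝟙 _)
    (.single f.cell) (D.idCell N.pro) (D.idCell N.pro) (by simp) (by simp) (by simp) (by simp) rfl
    rfl).symm.trans ((congrArg (fun x => D.comp _ x _ _) (D.comp_id _)).trans (D.comp_id f.cell)))
  assoc {M N P Q} f g h := Hom.ext' (Category.assoc _ _ _) ((comp_single (f₂₃ := h.hom)
    (g₂₃ := h.hom) (.single (f.comp g).cell) h.cell (D.idCell Q.pro) (by simp) (by simp)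
    (by simp [Hom.comp]) (by simp [Hom.comp]) rfl rfl).symm.trans
    ((congrArg (fun x => D.comp _ x _ _) (D.comp_id _)).trans
      (comp_single _ _ _ _ _ _ _ rfl rfl).symm))

end Mon

end VirtualDoubleCategory

namespace VDOps

/-- The string of cells `Ξ`, with identity frames, surrounded by identity cells. -/
def whisker (D : VDOps.{u, v, w, z}) {a b c d : D.Obj} (q : D.Path a b) {s t : D.Path b c}
    (Ξ : D.CellSeq (𝟙 b) (𝟙 c) s t) (r : D.Path c d) {s' t' : D.Path a d}
    (es : s' = q.append (s.append r)) (et : t' = q.append (t.append r)) :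
    D.CellSeq (𝟙 a) (𝟙 d) s' t' :=
  ((D.idSeq q).append (Ξ.append (D.idSeq r))).cast es et

end VDOps

namespace VirtualDoubleCategory

open VDShape (CellSeq)

variable {D : VirtualDoubleCategory.{u, v, w, z}}

/-- Bimodules between monoids. -/
structure Bimod (M N : D.Mon) where
  pro : D.Pro M.obj N.obj
  l : D.Cell (𝟙 M.obj) (𝟙 N.obj) (.pair M.pro pro) pro
  r : D.Cell (𝟙 M.obj) (𝟙 N.obj) (.pair pro N.pro) pro
  unit_l : D.comp (.pair M.unit (D.idCell pro)) l (by simp) (by simp) = D.idCell pro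
  unit_r : D.comp (.pair (D.idCell pro) N.unit) r (by simp) (by simp) = D.idCell pro
  assoc_l : D.comp (p := .cons M.pro (.pair M.pro pro)) (f' := 𝟙 _) (g' := 𝟙 _)
      (.pair M.mul (D.idCell pro)) l (by simp) (by simp) =
    D.comp (.pair (D.idCell M.pro) l) l (by simp) (by simp)
  assoc_r : D.comp (p := .cons pro (.pair N.pro N.pro)) (f' := 𝟙 _) (g' := 𝟙 _)
      (.pair (D.idCell pro) N.mul) r (by simp) (by simp) =
    D.comp (.pair r (D.idCell N.pro)) r (by simp) (by simp)
  assoc_lr : D.comp (p := .cons M.pro (.pair pro N.pro)) (f' := 𝟙 _) (g' := 𝟙 _)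
      (.pair l (D.idCell N.pro)) r (by simp) (by simp) =
    D.comp (.pair (D.idCell M.pro) r) l (by simp) (by simp)

/-- The string of proarrows underlying a string of bimodules. -/
def und {M N : D.Mon} (p : ProPath (Bimod (D := D)) M N) : D.Path M.obj N.obj :=
  p.map Mon.obj Bimod.pro

@[simp] theorem und_nil (M : D.Mon) : und (.nil M) = .nil M.obj := rfl

@[simp] theorem und_cons {M N P : D.Mon} (B : Bimod M N) (p : ProPath (Bimod (D := D)) N P) :
    und (.cons B p) = .cons B.pro (und p) := rfl

@[simp] theorem und_append {M N P : D.Mon} (p : ProPath (Bimod (D := D)) M N)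
    (q : ProPath (Bimod (D := D)) N P) : und (p.append q) = (und p).append (und q) :=
  ProPath.map_append _ _ p q

/-- Compatibility with the actions for a cell `φ` whose source is an empty string of bimodules:
letting `M` act on the target of `φ` from the left or from the right gives the same. -/
def NilCompat {M' N' : D.Mon} (C : Bimod M' N') : ∀ {M N : D.Mon}
    (p : ProPath (Bimod (D := D)) M N) (f : Mon.Hom M M') (g : Mon.Hom N N'),
    D.Cell f.hom g.hom (und p) C.pro → Prop
  | _, _, .nil M, f, g, φ =>
    D.comp (p := .single M.pro) (f' := f.hom) (g' := g.hom) (.pair f.cell φ) C.l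
        (by simp) (by simp) =
      D.comp (.pair φ g.cell) C.r (by simp) (by simp)
  | _, _, .cons _ _, _, _, _ => True

/-- Bimodule homomorphisms: a cell from (the underlying proarrows of) a string of bimodules to a
bimodule, with frames underlying monoid homomorphisms, is compatible with the outer actions and
equalizes the inner actions. -/
structure IsBimodHom {M N M' N' : D.Mon} (f : Mon.Hom M M') (g : Mon.Hom N N')
    (p : ProPath (Bimod (D := D)) M N) (C : Bimod M' N') (φ : D.Cell f.hom g.hom (und p) C.pro) :
    Prop where
  left : ∀ {L : D.Mon} (B : Bimod M L) (q : ProPath (Bimod (D := D)) L N) (e : p = .cons B q),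
    D.comp (p := .cons M.pro (und p)) (f' := f.hom) (g' := g.hom)
        (D.whisker (.nil _) (.single B.l) (und q) (by rw [e]; rfl) (by rw [e]; rfl)) φ
        (by simp) (by simp) =
      D.comp (.pair f.cell φ) C.l (by simp) (by simp)
  right : ∀ {L : D.Mon} (q : ProPath (Bimod (D := D)) M L) (B : Bimod L N)
    (e : p = q.append (.single B)),
    D.comp (p := (und p).append (.single N.pro)) (f' := f.hom) (g' := g.hom)
        (D.whisker (und q) (.single B.r) (.nil _) (by rw [e, und_append, ProPath.append_assoc]; rfl)
          (by rw [e, und_append]; rfl)) φ (by simp) (by simp) =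
      D.comp (.pair φ g.cell) C.r (by simp) (by simp)
  inner : ∀ {K L K' : D.Mon} (q : ProPath (Bimod (D := D)) M K) (B : Bimod K L) (B' : Bimod L K')
    (r : ProPath (Bimod (D := D)) K' N) (e : p = q.append (.cons B (.cons B' r))),
    D.comp (p := (und q).append (.cons B.pro (.cons L.pro (.cons B'.pro (und r)))))
        (f' := f.hom) (g' := g.hom)
        (D.whisker (und q) (s := .cons B.pro (.pair L.pro B'.pro)) (.pair B.r (D.idCell B'.pro))
          (und r) rfl (by rw [e, und_append]; rfl)) φ (by simp) (by simp) =
      D.comp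
        (D.whisker (und q) (s := .cons B.pro (.pair L.pro B'.pro)) (.pair (D.idCell B.pro) B'.l)
          (und r) rfl (by rw [e, und_append]; rfl)) φ (by simp) (by simp)
  nil : NilCompat C p f g φ

variable (D)

/-- The objects, vertical arrows, proarrows and 2-cells of the virtual double category of monoids
and modules. -/
@[reducible] def modShape : VDShape.{max u w z, max v z, max w z, z} where
  Obj := D.Mon
  Pro := Bimod
  Cell {_ _ _ _} f g p C :=
    {φ : D.Cell (Mon.Hom.hom f) (Mon.Hom.hom g) (und p) C.pro // IsBimodHom f g p C φ}

end VirtualDoubleCategory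

namespace VirtualDoubleCategory

open VDShape (CellSeq)

variable {D : VirtualDoubleCategory.{u, v, w, z}}

theorem exists_append {S : VDShape.{u, v, w, z}} {a b c a' b' c' : S.Obj} {f : a ⟶ a'} {g : b ⟶ b'}
    {h : c ⟶ c'} {p : S.Path a b} {p' : S.Path b c} {q : S.Path a' b'} {q' : S.Path b' c'}
    {s : S.Path a c} {t : S.Path a' c'} (Φ : S.CellSeq f g p q) (Ψ : S.CellSeq g h p' q')
    (es : s = p.append p') (et : t = q.append q') :
    ∃ Z : S.CellSeq f h s t, Z.toList = Φ.toList ++ Ψ.toList :=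
  ⟨(Φ.append Ψ).cast es et, by simp⟩

theorem toList_compSeq_pair {a b c a₁ b₁ c₁ a₂ b₂ c₂ : D.Obj} {f₁ : a ⟶ a₁} {g₁ : b ⟶ b₁}
    {h₁ : c ⟶ c₁} {f₂ : a₁ ⟶ a₂} {g₂ : b₁ ⟶ b₂} {h₂ : c₁ ⟶ c₂} {p : D.Path a b} {p' : D.Path b c}
    {q : D.Path a₁ b₁} {q' : D.Path b₁ c₁} {s : D.Path a c} {t : D.Path a₁ c₁} {A : D.Pro a₂ b₂}
    {A' : D.Pro b₂ c₂} {f₁₂ : a ⟶ a₂} {g₁₂ : b ⟶ b₂} {h₁₂ : c ⟶ c₂} (X : D.CellSeq f₁ h₁ s t)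
    (Φ : D.CellSeq f₁ g₁ p q) (Φ' : D.CellSeq g₁ h₁ p' q') (ψ : D.Cell f₂ g₂ q A)
    (ψ' : D.Cell g₂ h₂ q' A') (es : s = p.append p') (et : t = q.append q')
    (hX : X.toList = Φ.toList ++ Φ'.toList) (e₅ : f₁₂ = f₁ ≫ f₂) (e₆ : g₁₂ = g₁ ≫ g₂)
    (e₇ : h₁₂ = h₁ ≫ h₂) :
    (VDOps.compSeq X (CellSeq.pair ψ ψ' et) e₅ e₇).toList =
      [⟨D.comp Φ ψ e₅ e₆⟩, ⟨D.comp Φ' ψ' e₆ e₇⟩] := by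
  rw [CellSeq.pair, VDOps.compSeq_cons X Φ Φ' hX ψ (.single ψ') es et e₅ e₇ e₆,
    VDOps.toList_compSeq_single]
  rfl

theorem compSeq_whisker {a b c d a₁ b₁ c₁ d₁ : D.Obj} {f : a ⟶ a₁} {g : b ⟶ b₁} {h : c ⟶ c₁}
    {k : d ⟶ d₁} {f' : a ⟶ a₁} {k' : d ⟶ d₁} {p₁ : D.Path a b} {p₂ : D.Path b c} {p₃ : D.Path c d}
    {q : D.Path a₁ b₁} {s t : D.Path b₁ c₁} {r : D.Path c₁ d₁} {S : D.Path a d} {T T' : D.Path a₁ d₁}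
    (Z : D.CellSeq f k S T') (Γ₁ : D.CellSeq f g p₁ q) (Γ₂ : D.CellSeq g h p₂ s)
    (Γ₃ : D.CellSeq h k p₃ r) (Ξ : D.CellSeq (𝟙 b₁) (𝟙 c₁) s t) (es : T' = q.append (s.append r))
    (et : T = q.append (t.append r)) (eS : S = p₁.append (p₂.append p₃))
    (hZ : Z.toList = Γ₁.toList ++ (Γ₂.toList ++ Γ₃.toList)) (ef : f' = f ≫ 𝟙 a₁)
    (ek : k' = k ≫ 𝟙 d₁) :
    (VDOps.compSeq Z (D.whisker q Ξ r es et) ef ek).toList =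
      Γ₁.toList ++ ((VDOps.compSeq Γ₂ Ξ (Category.comp_id g).symm (Category.comp_id h).symm).toList ++
        Γ₃.toList) := by
  rw [VDOps.compSeq_append Z _ Γ₁ (Γ₂.append Γ₃) (D.idSeq q) (Ξ.append (D.idSeq r)) eS es et
    (by simpa using hZ) (by simp [VDOps.whisker]) ef (Category.comp_id g).symm ek, compSeq_id,
    VDOps.compSeq_append (Γ₂.append Γ₃) _ Γ₂ Γ₃ Ξ (D.idSeq r) rfl rfl rfl (by simp) (by simp) _
    (Category.comp_id h).symm ek, compSeq_id]

theorem whisker_compSeq {a b c d a₁ b₁ c₁ d₁ : D.Obj} {f : a ⟶ a₁} {g : b ⟶ b₁} {h : c ⟶ c₁}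
    {k : d ⟶ d₁} {f' : a ⟶ a₁} {k' : d ⟶ d₁} {q : D.Path a b} {s t : D.Path b c} {r : D.Path c d}
    {q₁ : D.Path a₁ b₁} {q₂ : D.Path b₁ c₁} {q₃ : D.Path c₁ d₁} {S S' : D.Path a d} {T : D.Path a₁ d₁}
    (Z : D.CellSeq f k S T) (Γ₁ : D.CellSeq f g q q₁) (Γ₂ : D.CellSeq g h t q₂)
    (Γ₃ : D.CellSeq h k r q₃) (Ξ : D.CellSeq (𝟙 b) (𝟙 c) s t) (es : S' = q.append (s.append r))
    (et : S = q.append (t.append r)) (eT : T = q₁.append (q₂.append q₃))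
    (hZ : Z.toList = Γ₁.toList ++ (Γ₂.toList ++ Γ₃.toList)) (ef : f' = 𝟙 a ≫ f)
    (ek : k' = 𝟙 d ≫ k) :
    (VDOps.compSeq (D.whisker q Ξ r es et) Z ef ek).toList =
      Γ₁.toList ++ ((VDOps.compSeq Ξ Γ₂ (Category.id_comp g).symm (Category.id_comp h).symm).toList ++
        Γ₃.toList) := by
  rw [VDOps.compSeq_append _ Z (D.idSeq q) (Ξ.append (D.idSeq r)) Γ₁ (Γ₂.append Γ₃) es et eT
    (by simp [VDOps.whisker]) (by simpa using hZ) ef (Category.id_comp g).symm ek, id_compSeq,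
    VDOps.compSeq_append _ (Γ₂.append Γ₃) Ξ (D.idSeq r) Γ₂ Γ₃ rfl rfl rfl (by simp) (by simp) _
    (Category.id_comp h).symm ek, id_compSeq]

/-- Two strings of cells with the same list of cells have the same composites. -/
theorem comp_congr {a b c d e e' : D.Obj} {h : a ⟶ c} {k : b ⟶ d} {f : c ⟶ e} {g : d ⟶ e'}
    {p : D.Path a b} {q : D.Path c d} {B : D.Pro e e'} {f' : a ⟶ e} {g' : b ⟶ e'}
    {X Y : D.CellSeq h k p q} (H : X.toList = Y.toList) (χ : D.Cell f g q B) (ef : f' = h ≫ f)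
    (eg : g' = k ≫ g) : D.comp X χ ef eg = D.comp Y χ ef eg := by
  rw [CellSeq.ext_toList H]

/-- The string of cells underlying a string of bimodule homomorphisms. -/
def undSeq {M N M' N' : D.Mon} {f : M ⟶ M'} {g : N ⟶ N'} {p : ProPath (Bimod (D := D)) M N}
    {q : ProPath (Bimod (D := D)) M' N'} :
    D.modShape.CellSeq f g p q → D.CellSeq (Mon.Hom.hom f) (Mon.Hom.hom g) (und p) (und q)
  | .nil f => .nil (Mon.Hom.hom f)
  | .cons φ Φ e => .cons φ.1 (undSeq Φ) (by rw [e, und_append])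

variable {M' N' M'' N'' : D.Mon} {h : Mon.Hom M' M''} {k : Mon.Hom N' N''}
  {T : ProPath (Bimod (D := D)) M' N'} {C : Bimod M'' N''}
  {χ : D.Cell h.hom k.hom (und T) C.pro}

/-- A bimodule homomorphism equalizes the inner actions on arbitrary cells. -/
theorem IsBimodHom.inner_comp (hχ : IsBimodHom h k T C χ) {K L K' : D.Mon}
    {t₀ : ProPath (Bimod (D := D)) M' K} {A : Bimod K L} {A' : Bimod L K'}
    {t₁ : ProPath (Bimod (D := D)) K' N'} (eT : T = t₀.append (.cons A (.cons A' t₁)))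
    {a b c c' b' a' : D.Obj} {f : a ⟶ M'.obj} {g : b ⟶ K.obj} {l : c ⟶ L.obj} {l' : c' ⟶ L.obj}
    {g' : b' ⟶ K'.obj} {f' : a' ⟶ N'.obj}
    {s₀ : D.Path a b} {s₁ : D.Path b c} {s₂ : D.Path c c'} {s₃ : D.Path c' b'} {s₄ : D.Path b' a'}
    {s₁₂ : D.Path b c'} {s₂₃ : D.Path c b'}
    (Γ₀ : D.CellSeq f g s₀ (und t₀)) (α : D.Cell g l s₁ A.pro) (μ : D.Cell l l' s₂ L.pro)
    (α' : D.Cell l' g' s₃ A'.pro) (Γ₁ : D.CellSeq g' f' s₄ (und t₁))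
    {S : D.Path a a'} (eS : S = s₀.append (s₁.append (s₂.append (s₃.append s₄))))
    (e₁₂ : s₁₂ = s₁.append s₂) (e₂₃ : s₂₃ = s₂.append s₃)
    (X Y : D.CellSeq f f' S (und T)) {u : a ⟶ M''.obj} {v : a' ⟶ N''.obj}
    (hX : X.toList = Γ₀.toList ++ ⟨D.comp (.pair α μ e₁₂) A.r (Category.comp_id g).symm
      (Category.comp_id l').symm⟩ :: ⟨α'⟩ :: Γ₁.toList)
    (hY : Y.toList = Γ₀.toList ++ ⟨α⟩ :: ⟨D.comp (.pair μ α' e₂₃) A'.l (Category.comp_id l).symm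
      (Category.comp_id g').symm⟩ :: Γ₁.toList)
    (eu : u = f ≫ h.hom) (ev : v = f' ≫ k.hom) : D.comp X χ eu ev = D.comp Y χ eu ev := by
  subst eT e₁₂ e₂₃ eS
  let Ξ : D.CellSeq g g' (s₁.append (s₂.append s₃)) (.cons A.pro (.pair L.pro A'.pro)) :=
    .cons α (.pair μ α' rfl) rfl
  have eZ : s₀.append (s₁.append (s₂.append (s₃.append s₄))) =
      s₀.append ((s₁.append (s₂.append s₃)).append s₄) := by simp only [ProPath.append_assoc]
  obtain ⟨Z₀, hZ₀⟩ := exists_append Ξ Γ₁ rfl rfl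
  obtain ⟨Z, hZ⟩ := exists_append (t := (und t₀).append (.cons A.pro (.cons L.pro (.cons A'.pro
    (und t₁))))) Γ₀ Z₀ eZ rfl
  rw [hZ₀] at hZ
  have hr : (VDOps.compSeq Ξ (CellSeq.pair A.r (D.idCell A'.pro)) (Category.comp_id g).symm
      (Category.comp_id g').symm).toList = [⟨D.comp (.pair α μ rfl) A.r (Category.comp_id g).symm
      (Category.comp_id l').symm⟩, ⟨α'⟩] := by
    refine (toList_compSeq_pair Ξ (.pair α μ rfl) (.single α') A.r (D.idCell A'.pro)
      (ProPath.append_assoc _ _ _).symm rfl rfl _ (Category.comp_id l').symm _).trans ?_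
    rw [D.comp_id]
  have hl : (VDOps.compSeq Ξ (CellSeq.pair (D.idCell A.pro) A'.l) (Category.comp_id g).symm
      (Category.comp_id g').symm).toList = [⟨α⟩, ⟨D.comp (.pair μ α' rfl) A'.l
      (Category.comp_id l).symm (Category.comp_id g').symm⟩] := by
    refine (toList_compSeq_pair Ξ (.single α) (.pair μ α' rfl) (D.idCell A.pro) A'.l
      rfl rfl rfl _ (Category.comp_id l).symm _).trans ?_
    rw [D.comp_id]
  have := congrArg (fun x => D.comp Z x eu ev) (hχ.inner t₀ A A' t₁ rfl)
  refine (comp_comp _ _ _ _ _ _ _ X (Category.comp_id f).symm (Category.comp_id f').symm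
    ?_).symm.trans (this.trans (comp_comp _ _ _ _ _ _ _ Y (Category.comp_id f).symm
      (Category.comp_id f').symm ?_))
  · refine (compSeq_whisker _ Γ₀ Ξ Γ₁ _ _ _ eZ hZ _ _).trans ?_
    rw [hr, hX]
    rfl
  · refine (compSeq_whisker _ Γ₀ Ξ Γ₁ _ _ _ eZ hZ _ _).trans ?_
    rw [hl, hY]
    rfl

/-- A bimodule homomorphism is compatible with the left action on arbitrary cells. -/
theorem IsBimodHom.left_comp (hχ : IsBimodHom h k T C χ) {K : D.Mon}
    {A : Bimod M' K} {t₁ : ProPath (Bimod (D := D)) K N'} (eT : T = .cons A t₁)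
    {a b c d : D.Obj} {l : a ⟶ M'.obj} {l' : b ⟶ M'.obj} {g : c ⟶ K.obj} {f' : d ⟶ N'.obj}
    {s₁ : D.Path a b} {s₂ : D.Path b c} {s₃ : D.Path c d} {s₁₂ : D.Path a c} {s₂₃ : D.Path b d}
    (μ : D.Cell l l' s₁ M'.pro) (α : D.Cell l' g s₂ A.pro) (Γ₁ : D.CellSeq g f' s₃ (und t₁))
    {S : D.Path a d} (eS : S = s₁.append s₂₃) (e₁₂ : s₁₂ = s₁.append s₂)
    (e₂₃ : s₂₃ = s₂.append s₃)
    (X : D.CellSeq l f' S (und T)) (Y : D.CellSeq l' f' s₂₃ (und T)) {u : a ⟶ M''.obj}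
    {v : d ⟶ N''.obj} {x : b ⟶ M''.obj}
    (hX : X.toList = ⟨D.comp (.pair μ α e₁₂) A.l (Category.comp_id l).symm
      (Category.comp_id g).symm⟩ :: Γ₁.toList) (hY : Y.toList = ⟨α⟩ :: Γ₁.toList)
    (eu : u = l ≫ h.hom) (ev : v = f' ≫ k.hom) (ex : x = l' ≫ h.hom) :
    D.comp X χ eu ev = D.comp (.pair (D.comp (.single μ) h.cell eu ex) (D.comp Y χ ex ev) eS) C.l
      (Category.comp_id u).symm (Category.comp_id v).symm := by
  subst eT e₁₂ e₂₃ eS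
  obtain ⟨Z, hZ⟩ := exists_append (t := .cons M'.pro (und (.cons A t₁))) (.single μ) Y rfl rfl
  have hl : (VDOps.compSeq (CellSeq.pair μ α rfl) (CellSeq.single A.l) (Category.comp_id l).symm
      (Category.comp_id g).symm).toList = [⟨D.comp (.pair μ α rfl) A.l (Category.comp_id l).symm
      (Category.comp_id g).symm⟩] := by
    rw [VDOps.toList_compSeq_single]; rfl
  have := congrArg (fun x => D.comp Z x eu ev) (hχ.left A t₁ rfl)
  refine (comp_comp _ _ _ _ _ _ _ X (Category.comp_id l).symm (Category.comp_id f').symm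
    ?_).symm.trans (this.trans (comp_pair Z (.single μ) Y h.cell χ C.l rfl rfl hZ _ _ _ _ _ _ _))
  refine (compSeq_whisker Z (.nil l) (.pair μ α rfl) Γ₁ _ _ _ (ProPath.append_assoc _ _ _).symm
    (by rw [hZ, hY]; rfl) _ _).trans ?_
  rw [hl, hX]
  rfl

/-- A bimodule homomorphism is compatible with the right action on arbitrary cells. -/
theorem IsBimodHom.right_comp (hχ : IsBimodHom h k T C χ) {K : D.Mon}
    {t₀ : ProPath (Bimod (D := D)) M' K} {A : Bimod K N'} (eT : T = t₀.append (.single A))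
    {a b c d : D.Obj} {f : a ⟶ M'.obj} {g : b ⟶ K.obj} {l : c ⟶ N'.obj} {l' : d ⟶ N'.obj}
    {s₁ : D.Path a b} {s₂ : D.Path b c} {s₃ : D.Path c d} {s₁₂ : D.Path a c} {s₂₃ : D.Path b d}
    (Γ₀ : D.CellSeq f g s₁ (und t₀)) (α : D.Cell g l s₂ A.pro) (μ : D.Cell l l' s₃ N'.pro)
    {S : D.Path a d} (eS : S = s₁₂.append s₃) (e₁₂ : s₁₂ = s₁.append s₂)
    (e₂₃ : s₂₃ = s₂.append s₃)
    (X : D.CellSeq f l' S (und T)) (Y : D.CellSeq f l s₁₂ (und T)) {u : a ⟶ M''.obj}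
    {v : d ⟶ N''.obj} {x : c ⟶ N''.obj}
    (hX : X.toList = Γ₀.toList ++ [⟨D.comp (.pair α μ e₂₃) A.r (Category.comp_id g).symm
      (Category.comp_id l').symm⟩]) (hY : Y.toList = Γ₀.toList ++ [⟨α⟩])
    (eu : u = f ≫ h.hom) (ev : v = l' ≫ k.hom) (ex : x = l ≫ k.hom) :
    D.comp X χ eu ev = D.comp (.pair (D.comp Y χ eu ex) (D.comp (.single μ) k.cell ex ev) eS) C.r
      (Category.comp_id u).symm (Category.comp_id v).symm := by
  subst eT e₁₂ e₂₃ eS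
  obtain ⟨Z, hZ⟩ := exists_append (t := (und (t₀.append (.single A))).append (.single N'.pro))
    Y (.single μ) rfl rfl
  have hr : (VDOps.compSeq (CellSeq.pair α μ rfl) (CellSeq.single A.r) (Category.comp_id g).symm
      (Category.comp_id l').symm).toList = [⟨D.comp (.pair α μ rfl) A.r (Category.comp_id g).symm
      (Category.comp_id l').symm⟩] := by
    rw [VDOps.toList_compSeq_single]; rfl
  have := congrArg (fun x => D.comp Z x eu ev) (hχ.right t₀ A rfl)
  refine (comp_comp _ _ _ _ _ _ _ X (Category.comp_id f).symm (Category.comp_id l').symm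
    ?_).symm.trans (this.trans (comp_pair Z Y (.single μ) χ k.cell C.r rfl rfl hZ _ _ _ _ _ _ _))
  refine (compSeq_whisker Z Γ₀ (.pair α μ rfl) (.nil l') _ _ _
    (by rw [ProPath.append_assoc, ProPath.append_nil]) (by rw [hZ, hY]; simp) _ _).trans ?_
  rw [hr, hX]
  rfl

theorem toList_whisker {a b c d : D.Obj} (q : D.Path a b) {s t : D.Path b c}
    (Ξ : D.CellSeq (𝟙 b) (𝟙 c) s t) (r : D.Path c d) {s' t' : D.Path a d}
    (es : s' = q.append (s.append r)) (et : t' = q.append (t.append r)) :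
    (D.whisker q Ξ r es et).toList = (D.idSeq q).toList ++ (Ξ.toList ++ (D.idSeq r).toList) := by
  simp [VDOps.whisker]

theorem toList_idSeq_und_append {M N P : D.Mon} (p : ProPath (Bimod (D := D)) M N)
    (q : ProPath (Bimod (D := D)) N P) :
    (D.idSeq (und (p.append q))).toList = (D.idSeq (und p)).toList ++ (D.idSeq (und q)).toList := by
  rw [und_append, VDOps.toList_idSeq_append]

@[simp] theorem undSeq_nil {M M' : D.Mon} (f : M ⟶ M') :
    undSeq (.nil f : D.modShape.CellSeq _ _ _ _) = .nil (Mon.Hom.hom f) := rfl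

@[simp] theorem toList_undSeq_cons {M N P M' N' P' : D.Mon} {f : M ⟶ M'} {g : N ⟶ N'} {h : P ⟶ P'}
    {p : ProPath (Bimod (D := D)) M N} {q : ProPath (Bimod (D := D)) N P}
    {s : ProPath (Bimod (D := D)) M P} {A : Bimod M' N'} {r : ProPath (Bimod (D := D)) N' P'}
    (φ : D.modShape.Cell f g p A) (Φ : D.modShape.CellSeq g h q r) (e : s = p.append q) :
    (undSeq (.cons φ Φ e)).toList = ⟨φ.1⟩ :: (undSeq Φ).toList := rfl

theorem left_head {M N N₁ L P' Q' R' : D.Mon} {f : M ⟶ P'} {f₁ : N₁ ⟶ Q'} {g : N ⟶ R'}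
    {p' : ProPath (Bimod (D := D)) N₁ N} {t' : ProPath (Bimod (D := D)) Q' R'}
    (Φ' : D.modShape.CellSeq f₁ g p' t') {p₁ : ProPath (Bimod (D := D)) L N₁} {A : Bimod P' Q'}
    {B : Bimod M L} (φ : D.modShape.Cell f f₁ (.cons B p₁) A)
    {q : ProPath (Bimod (D := D)) L N} (eq : q = p₁.append p')
    (e : ProPath.cons B q = (ProPath.cons B p₁).append p') :
    (VDOps.compSeq (D.whisker (.nil _) (.single B.l) (und q) rfl rfl)
      (undSeq (.cons φ Φ' e)) (Category.id_comp _).symm (Category.id_comp _).symm).toList =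
    ⟨D.comp (.pair (Mon.Hom.cell f) φ.1 rfl) A.l
      (Category.comp_id _).symm (Category.comp_id _).symm⟩ :: (undSeq Φ').toList := by
  subst eq
  refine (congrArg CellSeq.toList (VDOps.compSeq_cons _
    (D.whisker (.nil _) (.single B.l) (und p₁) rfl rfl) (D.idSeq (und p')) ?_ φ.1 (undSeq Φ')
    (by rw [und_append]; rfl) (congrArg (ProPath.cons B.pro) (und_append p₁ p')) _ _ (Category.id_comp _).symm)).trans ?_
  · refine (toList_whisker _ _ _ _ _).trans (Eq.trans ?_ (congrArg (· ++ _)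
      (toList_whisker _ _ _ _ _)).symm)
    rw [toList_idSeq_und_append]; rfl
  · rw [CellSeq.toList_cons, id_compSeq]
    exact congrArg (fun x => CellSeq.toList (CellSeq.cons x (undSeq Φ') rfl)) (φ.2.left B p₁ rfl)

theorem nil_head {M N P' Q' R' : D.Mon} {f : M ⟶ P'} {f₁ : M ⟶ Q'} {g : N ⟶ R'}
    {p : ProPath (Bimod (D := D)) M N} {t' : ProPath (Bimod (D := D)) Q' R'}
    (Φ' : D.modShape.CellSeq f₁ g p t') {A : Bimod P' Q'}
    (φ : D.modShape.Cell f f₁ (.nil M) A) (e : p = (ProPath.nil M).append p)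
    {S : D.Path M.obj N.obj} (W : D.CellSeq (𝟙 _) (𝟙 _) S (und p)) :
    (VDOps.compSeq W
      (undSeq (.cons φ Φ' e)) (Category.id_comp _).symm (Category.id_comp _).symm).toList =
    ⟨φ.1⟩ :: (VDOps.compSeq W (undSeq Φ') (Category.id_comp _).symm
      (Category.id_comp _).symm).toList := by
  refine (congrArg CellSeq.toList (VDOps.compSeq_cons W (.nil _) W rfl φ.1 (undSeq Φ')
    rfl rfl _ _ (Category.id_comp _).symm)).trans ?_
  exact congrArg (fun x => VDShape.AnyCell.mk x :: (VDOps.compSeq W (undSeq Φ')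
    (Category.id_comp _).symm (Category.id_comp _).symm).toList) (D.id_comp φ.1)

/-- The left action on the source of a string of bimodule homomorphisms can be moved to the
target of its first cell. -/
theorem IsBimodHom.left_seq {N N₁ Q' N' : D.modShape.Obj} {f₁ : N₁ ⟶ Q'} {g : N ⟶ N'}  {k : Mon.Hom N' N''}  {T : ProPath (Bimod (D := D)) M' N'} {χ : D.Cell h.hom k.hom (und T) C.pro}
    {p' : ProPath (Bimod (D := D)) N₁ N} {t' : ProPath (Bimod (D := D)) Q' N'}
    (Φ' : D.modShape.CellSeq f₁ g p' t') (hχ : IsBimodHom h k T C χ) {M L P' : D.Mon} {f : M ⟶ P'}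
    {p₁ : ProPath (Bimod (D := D)) M N₁} {A : Bimod P' Q'} (φ : D.modShape.Cell f f₁ p₁ A)
    {B : Bimod M L} {q : ProPath (Bimod (D := D)) L N} (e : .cons B q = p₁.append p')
    {t₀ : ProPath (Bimod (D := D)) M' P'} (eT : T = t₀.append (.cons A t')) {a : D.Obj}
    {x : a ⟶ M'.obj} {s₀ : D.Path a M.obj} (Γ₀ : D.CellSeq x (Mon.Hom.hom f) s₀ (und t₀))
    {S : D.Path a N.obj} (eS : S = s₀.append (.cons M.pro (und (.cons B q))))
    (X Y : D.CellSeq x (Mon.Hom.hom g) S (und T))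
    (hX : X.toList = Γ₀.toList ++ (VDOps.compSeq (D.whisker (.nil _) (.single B.l) (und q) rfl rfl)
      (undSeq (.cons φ Φ' e)) (Category.id_comp _).symm (Category.id_comp _).symm).toList)
    (hY : Y.toList = Γ₀.toList ++ ⟨D.comp (.pair (Mon.Hom.cell f) φ.1 rfl) A.l
      (Category.comp_id _).symm (Category.comp_id _).symm⟩ :: (undSeq Φ').toList)
    {u : a ⟶ M''.obj} {v : N.obj ⟶ N''.obj} (eu : u = x ≫ h.hom)
    (ev : v = Mon.Hom.hom g ≫ k.hom) : D.comp X χ eu ev = D.comp Y χ eu ev := by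
  induction Φ' generalizing M L P' t₀ a with
  | nil f₁ =>
    cases p₁ with
    | nil => cases e
    | cons B₁ p₁ =>
      cases e
      exact comp_congr (hX.trans ((congrArg (Γ₀.toList ++ ·)
        (left_head (.nil f₁) φ rfl rfl)).trans hY.symm)) _ _ _
  | cons φ₂ Φ'' e₂ ih =>
    cases p₁ with
    | nil =>
      rename_i p₂ q₂ p' A₂ t'
      obtain rfl : p' = .cons B q := e.symm
      obtain ⟨Γ, hΓ⟩ := exists_append (t := und (t₀.append (.single A))) Γ₀ (.single φ.1)
        (ProPath.append_nil _).symm (und_append _ _)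
      obtain ⟨Y', hY'⟩ := exists_append (s := S) (t := und T) Γ
        (.cons (s := .cons _ (und (.cons B q))) (D.comp (.pair (Mon.Hom.cell _) φ₂.1 rfl) A₂.l
          (Category.comp_id _).symm (Category.comp_id _).symm) (undSeq Φ'')
          (by rw [e₂, und_append]; rfl)) eS
        (by rw [eT]; simp [ProPath.append_assoc])
      rw [ih hχ φ₂ e₂ (by rw [eT, ProPath.append_assoc]; rfl) Γ eS X Y'
        (hX.trans ((congrArg (Γ₀.toList ++ ·) (nil_head (.cons φ₂ Φ'' e₂) φ e _)).trans
          (by rw [hΓ]; simp))) hY' eu ev]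
      symm
      refine hχ.inner_comp eT Γ₀ φ.1 (Mon.Hom.cell _) φ₂.1 (undSeq Φ'') ?_ rfl rfl Y Y' ?_ ?_ eu ev
      · rw [eS, e₂, und_append]; rfl
      · rw [hY]
        exact congrArg (fun x => Γ₀.toList ++ VDShape.AnyCell.mk x :: (⟨φ₂.1⟩ ::
          (undSeq Φ'').toList)) φ.2.nil
      · rw [hY', hΓ, List.append_assoc]; rfl
    | cons B₁ p₁ =>
      cases e
      exact comp_congr (hX.trans ((congrArg (Γ₀.toList ++ ·)
        (left_head (.cons φ₂ Φ'' e₂) φ rfl rfl)).trans hY.symm)) _ _ _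

/-- The string of proarrows is empty. -/
def _root_.ProPath.IsNil {O : Type*} {P : O → O → Type*} {a b : O} : ProPath P a b → Prop
  | .nil _ => True
  | .cons _ _ => False

theorem _root_.ProPath.append_eq_append {O : Type*} {P : O → O → Type*} {a b c d : O}
    (p : ProPath P a b) (p' : ProPath P b c) (q : ProPath P a d) (q' : ProPath P d c)
    (e : p.append p' = q.append q') :
    (∃ s : ProPath P b d, q = p.append s ∧ p' = s.append q') ∨
      ∃ s : ProPath P d b, p = q.append s ∧ q' = s.append p' := by
  induction p with
  | nil a => exact .inl ⟨q, rfl, e⟩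
  | cons A p ih =>
    cases q with
    | nil => exact .inr ⟨.cons A p, rfl, e.symm⟩
    | cons B q =>
      simp only [ProPath.cons_append, ProPath.cons.injEq] at e
      obtain ⟨rfl, h₁, h₂⟩ := e
      obtain rfl := eq_of_heq h₁
      rcases ih p' q (eq_of_heq h₂) with ⟨s, rfl, rfl⟩ | ⟨s, rfl, rfl⟩
      · exact .inl ⟨s, rfl, rfl⟩
      · exact .inr ⟨s, rfl, rfl⟩

theorem whisker_hit {a b c d d' a₁ d₁ e₁ : D.Obj} {q : D.Path a b} {s t : D.Path b c}
    (Ξ : D.CellSeq (𝟙 b) (𝟙 c) s t) {r : D.Path c d'} {r₁ : D.Path c d} {r₂ : D.Path d d'}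
    (er : r = r₁.append r₂) {S T : D.Path a d'} (es : S = q.append (s.append r))
    (et : T = q.append (t.append r)) {P P' : D.Path a d} (eP : P = q.append (t.append r₁))
    (eP' : P' = q.append (s.append r₁)) {f f' : a ⟶ a₁} {g : d ⟶ d₁} {h h' : d' ⟶ e₁}
    {A : D.Pro a₁ d₁} {x : D.Path d₁ e₁} (ψ : D.Cell f g P A) (Ψ : D.CellSeq g h r₂ x)
    (e : T = P.append r₂) (ef : f' = 𝟙 a ≫ f) (eh : h' = 𝟙 d' ≫ h) :
    (VDOps.compSeq (D.whisker q Ξ r es et) (.cons ψ Ψ e) ef eh).toList =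
      ⟨D.comp (D.whisker q Ξ r₁ eP' eP) ψ ef (Category.id_comp g).symm⟩ :: Ψ.toList := by
  subst er eP eP'
  rw [VDOps.compSeq_cons _ (D.whisker q Ξ r₁ rfl rfl) (D.idSeq r₂)
    (by simp [toList_whisker]) ψ Ψ (by rw [es]; simp [ProPath.append_assoc]) e ef eh
    (Category.id_comp g).symm, CellSeq.toList_cons, id_compSeq]

theorem whisker_skip {a b b' c d a₁ b₁ d₁ : D.Obj} {q : D.Path a b} {q₁ : D.Path a b'}
    {q₂ : D.Path b' b} (eq : q = q₁.append q₂) {s t : D.Path b c}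
    (Ξ : D.CellSeq (𝟙 b) (𝟙 c) s t) {r : D.Path c d} {S T : D.Path a d}
    (es : S = q.append (s.append r)) (et : T = q.append (t.append r)) {S₂ T₂ : D.Path b' d}
    (es₂ : S₂ = q₂.append (s.append r)) (et₂ : T₂ = q₂.append (t.append r))
    {f f' : a ⟶ a₁} {g : b' ⟶ b₁} {h h' : d ⟶ d₁}
    {A : D.Pro a₁ b₁} {x : D.Path b₁ d₁} (ψ : D.Cell f g q₁ A) (Ψ : D.CellSeq g h T₂ x)
    (e : T = q₁.append T₂) (ef : f' = 𝟙 a ≫ f) (eh : h' = 𝟙 d ≫ h) :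
    (VDOps.compSeq (D.whisker q Ξ r es et) (.cons ψ Ψ e) ef eh).toList =
      ⟨ψ⟩ :: (VDOps.compSeq (D.whisker q₂ Ξ r es₂ et₂) Ψ (Category.id_comp g).symm eh).toList := by
  subst eq
  obtain rfl := ef.trans (Category.id_comp f)
  rw [VDOps.compSeq_cons _ (D.idSeq q₁) (D.whisker q₂ Ξ r es₂ et₂)
    (by simp [toList_whisker]) ψ Ψ (by rw [es, es₂]; simp [ProPath.append_assoc]) e ef eh
    (Category.id_comp g).symm, CellSeq.toList_cons, D.id_comp]

/-- A right action can be moved to the right past cells with empty source. -/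
theorem IsBimodHom.nil_seq {N N₁ Q' N' : D.modShape.Obj} {f₁ : N₁ ⟶ Q'} {g : N ⟶ N'}
    {k : Mon.Hom N' N''} {T : ProPath (Bimod (D := D)) M' N'}
    {χ : D.Cell h.hom k.hom (und T) C.pro}
    {p' : ProPath (Bimod (D := D)) N₁ N} {t' : ProPath (Bimod (D := D)) Q' N'}
    (Φ' : D.modShape.CellSeq f₁ g p' t') (hp' : p'.IsNil) (hχ : IsBimodHom h k T C χ) {P' : D.Mon}
    {A : Bimod P' Q'} {t₀ : ProPath (Bimod (D := D)) M' P'}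
    (eT : T = t₀.append (.cons A t')) {a b : D.Obj} {x : a ⟶ M'.obj} {f : b ⟶ P'.obj}
    {s₀ : D.Path a b} {s₁ : D.Path b N₁.obj} (Γ₀ : D.CellSeq x f s₀ (und t₀))
    (α : D.Cell f (Mon.Hom.hom f₁) s₁ A.pro) {s₁' : D.Path b N₁.obj}
    (e₁ : s₁' = s₁.append (.single N₁.pro))
    {S S' : D.Path a N.obj} (eS : S = S'.append (.single N.pro))
    (eS₁ : S = s₀.append (s₁'.append (und p')))
    (eS' : S' = s₀.append (s₁.append (und p')))
    (X : D.CellSeq x (Mon.Hom.hom g) S (und T)) (Y : D.CellSeq x (Mon.Hom.hom g) S' (und T))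
    (hX : X.toList = Γ₀.toList ++ ⟨D.comp (.pair α (Mon.Hom.cell f₁) e₁) A.r
      (Category.comp_id _).symm (Category.comp_id _).symm⟩ :: (undSeq Φ').toList)
    (hY : Y.toList = Γ₀.toList ++ ⟨α⟩ :: (undSeq Φ').toList)
    {u : a ⟶ M''.obj} {v : N.obj ⟶ N''.obj} (eu : u = x ≫ h.hom)
    (ev : v = Mon.Hom.hom g ≫ k.hom) : D.comp X χ eu ev =
      D.comp (.pair (D.comp Y χ eu ev) (D.comp (.single (Mon.Hom.cell g)) k.cell ev ev) eS) C.r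
      (Category.comp_id u).symm (Category.comp_id v).symm := by
  induction Φ' generalizing P' t₀ b with
  | nil f₁ =>
    exact hχ.right_comp eT Γ₀ α (Mon.Hom.cell f₁) eS (by rw [eS']; simp) e₁ X Y hX hY eu ev ev
  | cons φ₂ Φ'' e₂ ih =>
    rename_i p₂ q₂ p' A₂ t'
    cases p₂ with
    | cons => subst e₂; exact hp'.elim
    | nil =>
      obtain rfl : p' = q₂ := e₂
      obtain ⟨Γ, hΓ⟩ := exists_append (t := und (t₀.append (.single A))) Γ₀ (.single α)
        rfl (und_append _ _)
      have eT' : T = (t₀.append (.single A)).append (.cons A₂ t') := by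
        rw [eT, ProPath.append_assoc]; rfl
      obtain ⟨X', hX'⟩ := exists_append (s := S) (t := und T) Γ
        (.cons (s := .cons _ (und p')) (D.comp (.pair φ₂.1 (Mon.Hom.cell _) rfl) A₂.r
          (Category.comp_id _).symm (Category.comp_id _).symm) (undSeq Φ'') rfl)
          (by rw [eS₁, e₁]; simp [ProPath.append_assoc])
        (by rw [eT']; simp [ProPath.append_assoc])
      rw [← ih hp' hχ eT' Γ φ₂.1 rfl eS (by rw [eS₁, e₁]; simp [ProPath.append_assoc])
        (by rw [eS']; simp [ProPath.append_assoc]) X' Y hX'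
        (by rw [hY, hΓ, List.append_assoc]; rfl) ev]
      refine hχ.inner_comp eT Γ₀ α (Mon.Hom.cell _) φ₂.1 (undSeq Φ'') ?_ e₁ rfl X X' hX ?_ eu ev
      · rw [eS₁, e₁]; simp [ProPath.append_assoc]
      · rw [hX', hΓ, List.append_assoc]
        exact congrArg (fun x => Γ₀.toList ++ ⟨α⟩ :: VDShape.AnyCell.mk x ::
          (undSeq Φ'').toList) φ₂.2.nil.symm

/-- The right action on the source of a string of bimodule homomorphisms can be moved to the
target. -/
theorem IsBimodHom.right_seq {M N P' N' : D.modShape.Obj} {f : M ⟶ P'} {g : N ⟶ N'}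
    {k : Mon.Hom N' N''} {T : ProPath (Bimod (D := D)) M' N'}
    {χ : D.Cell h.hom k.hom (und T) C.pro}
    {p : ProPath (Bimod (D := D)) M N} {t : ProPath (Bimod (D := D)) P' N'}
    (Φ : D.modShape.CellSeq f g p t) (hχ : IsBimodHom h k T C χ) {L : D.Mon}
    {q : ProPath (Bimod (D := D)) M L} {B : Bimod L N} (e : p = q.append (.single B))
    {t₀ : ProPath (Bimod (D := D)) M' P'} (eT : T = t₀.append t) {a : D.Obj}
    {x : a ⟶ M'.obj} {s₀ : D.Path a M.obj} (Γ₀ : D.CellSeq x (Mon.Hom.hom f) s₀ (und t₀))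
    {S₁ : D.Path M.obj N.obj} (es : S₁ = (und q).append ((ProPath.pair B.pro N.pro).append (.nil _)))
    (et : und p = (und q).append ((ProPath.single B.pro).append (.nil _)))
    {S S' : D.Path a N.obj} (eS : S = S'.append (.single N.pro)) (eS₁ : S = s₀.append S₁)
    (eS' : S' = s₀.append (und p))
    (X : D.CellSeq x (Mon.Hom.hom g) S (und T)) (Y : D.CellSeq x (Mon.Hom.hom g) S' (und T))
    (hX : X.toList = Γ₀.toList ++ (VDOps.compSeq (D.whisker (und q) (.single B.r) (.nil _) es et)
      (undSeq Φ) (Category.id_comp _).symm (Category.id_comp _).symm).toList)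
    (hY : Y.toList = Γ₀.toList ++ (undSeq Φ).toList)
    {u : a ⟶ M''.obj} {v : N.obj ⟶ N''.obj} (eu : u = x ≫ h.hom)
    (ev : v = Mon.Hom.hom g ≫ k.hom) : D.comp X χ eu ev =
      D.comp (.pair (D.comp Y χ eu ev) (D.comp (.single (Mon.Hom.cell g)) k.cell ev ev) eS) C.r
      (Category.comp_id u).symm (Category.comp_id v).symm := by
  induction Φ generalizing a with
  | nil f => cases q <;> cases e
  | cons φ Φ' e₂ ih =>
    rename_i p₁ p' p A t'
    have skip : ∀ s : ProPath (Bimod (D := D)) _ L, q = p₁.append s → p' = s.append (.single B) →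
        D.comp X χ eu ev = D.comp (.pair (D.comp Y χ eu ev)
          (D.comp (.single (Mon.Hom.cell _)) k.cell ev ev) eS) C.r
          (Category.comp_id u).symm (Category.comp_id v).symm := by
      rintro s rfl rfl
      obtain ⟨Γ, hΓ⟩ := exists_append (t := und (t₀.append (.single A))) Γ₀ (.single φ.1)
        rfl (und_append _ _)
      refine ih hχ rfl (t₀ := t₀.append (.single A)) (by rw [eT, ProPath.append_assoc]; rfl) Γ
        (S₁ := (und s).append (ProPath.pair B.pro _)) rfl (by simp) eS
        (by rw [eS₁, es]; simp [ProPath.append_assoc])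
        (by rw [eS', e₂]; simp [ProPath.append_assoc]) X Y ?_ ?_ eu ev
      · rw [hX, hΓ, List.append_assoc]
        refine congrArg (Γ₀.toList ++ ·) ?_
        exact whisker_skip (und_append _ _) _ _ _ _ _ φ.1 (undSeq Φ') _ _ _
      · rw [hY, hΓ, List.append_assoc]; rfl
    rcases ProPath.append_eq_append p₁ p' q (.single B) (e₂.symm.trans e) with
      ⟨s, hq, hp⟩ | ⟨s, hq, hp⟩
    · exact skip s hq hp
    · cases s with
      | nil => exact skip (.nil _) (by rw [hq]; simp) hp.symm
      | cons B₁ s =>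
        cases s with
        | cons => cases hp
        | nil =>
          cases hp
          subst hq
          have hd := φ.2.right q B₁ rfl
          refine hχ.nil_seq Φ' trivial eT Γ₀ φ.1 rfl eS ?_ ?_ X Y ?_ hY eu ev
          · rw [eS₁, es]; simp [ProPath.append_assoc]
          · rw [eS', e₂]; simp
          · rw [hX]
            refine congrArg (Γ₀.toList ++ ·) ?_
            refine (whisker_hit (r₁ := .nil _) (r₂ := .nil _)
              (P' := (und (q.append (.single B₁))).append (.single _)) _ rfl es _ (by simp)
              (by rw [und_append, ProPath.append_assoc]; rfl) φ.1 (undSeq Φ') _ _ _).trans ?_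
            exact congrArg (fun x => VDShape.AnyCell.mk x :: (undSeq Φ').toList) hd

/-- A string of bimodule homomorphisms equalizes the inner actions. -/
theorem IsBimodHom.inner_seq {M N P' N' : D.modShape.Obj} {f : M ⟶ P'} {g : N ⟶ N'}
    {k : Mon.Hom N' N''} {T : ProPath (Bimod (D := D)) M' N'}
    {χ : D.Cell h.hom k.hom (und T) C.pro}
    {p : ProPath (Bimod (D := D)) M N} {t : ProPath (Bimod (D := D)) P' N'}
    (Φ : D.modShape.CellSeq f g p t) (hχ : IsBimodHom h k T C χ) {K L K' : D.Mon}
    {q : ProPath (Bimod (D := D)) M K} {B : Bimod K L} {B' : Bimod L K'}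
    {r : ProPath (Bimod (D := D)) K' N} (e : p = q.append (.cons B (.cons B' r)))
    {t₀ : ProPath (Bimod (D := D)) M' P'} (eT : T = t₀.append t) {a : D.Obj}
    {x : a ⟶ M'.obj} {s₀ : D.Path a M.obj} (Γ₀ : D.CellSeq x (Mon.Hom.hom f) s₀ (und t₀))
    {S₁ : D.Path M.obj N.obj}
    (es : S₁ = (und q).append (.append (.cons B.pro (.pair L.pro B'.pro)) (und r)))
    (et : und p = (und q).append (.append (.pair B.pro B'.pro) (und r)))
    {S : D.Path a N.obj} (eS₁ : S = s₀.append S₁)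
    (X Y : D.CellSeq x (Mon.Hom.hom g) S (und T))
    (hX : X.toList = Γ₀.toList ++ (VDOps.compSeq
      (D.whisker (und q) (.pair B.r (D.idCell B'.pro)) (und r) es et)
      (undSeq Φ) (Category.id_comp _).symm (Category.id_comp _).symm).toList)
    (hY : Y.toList = Γ₀.toList ++ (VDOps.compSeq
      (D.whisker (und q) (.pair (D.idCell B.pro) B'.l) (und r) es et)
      (undSeq Φ) (Category.id_comp _).symm (Category.id_comp _).symm).toList)
    {u : a ⟶ M''.obj} {v : N.obj ⟶ N''.obj} (eu : u = x ≫ h.hom)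
    (ev : v = Mon.Hom.hom g ≫ k.hom) : D.comp X χ eu ev = D.comp Y χ eu ev := by
  induction Φ generalizing a with
  | nil f => cases q <;> cases e
  | cons φ Φ' e₂ ih =>
    rename_i p₁ p' p A t'
    obtain ⟨Γ, hΓ⟩ := exists_append (t := und (t₀.append (.single A))) Γ₀ (.single φ.1)
      rfl (und_append _ _)
    have eT' : T = (t₀.append (.single A)).append t' := by rw [eT, ProPath.append_assoc]; rfl
    have skip : ∀ s : ProPath (Bimod (D := D)) _ K, q = p₁.append s →
        p' = s.append (.cons B (.cons B' r)) → D.comp X χ eu ev = D.comp Y χ eu ev := by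
      rintro s rfl rfl
      refine ih hχ rfl eT' Γ
        (S₁ := (und s).append (.append (.cons B.pro (.pair L.pro B'.pro)) (und r))) rfl (by simp)
        (by rw [eS₁, es]; simp [ProPath.append_assoc]) X Y ?_ ?_ eu ev
      · rw [hX, hΓ, List.append_assoc]
        refine congrArg (Γ₀.toList ++ ·) ?_
        exact whisker_skip (und_append _ _) _ _ _ _ _ φ.1 (undSeq Φ') _ _ _
      · rw [hY, hΓ, List.append_assoc]
        refine congrArg (Γ₀.toList ++ ·) ?_
        exact whisker_skip (und_append _ _) _ _ _ _ _ φ.1 (undSeq Φ') _ _ _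
    rcases ProPath.append_eq_append p₁ p' q _ (e₂.symm.trans e) with
      ⟨s, hq, hp⟩ | ⟨s, hq, hp⟩
    · exact skip s hq hp
    · cases s with
      | nil => exact skip (.nil _) (by rw [hq]; simp) hp.symm
      | cons B₁ s =>
        cases s with
        | nil =>
          clear ih skip
          cases Φ' with
          | nil => cases hp
          | cons φ₂ Φ'' e₃ =>
            rename_i p₂ p₃ A₂ t''
            cases hp
            subst hq
            have hd := φ.2.right q B rfl
            have eW : und p = (und (q.append (.single B))).append (.append (.single B'.pro) (und r)) := by
              rw [e₂, und_append]; rfl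
            have hW : ∀ es' et', D.whisker (und q) (.pair B.r (D.idCell B'.pro)) (und r) es et =
                D.whisker (und q) (.single B.r) (und (.cons B' r)) es' et' := fun es' et' =>
              CellSeq.ext_toList (by simp [toList_whisker]; rfl)
            have hW' : ∀ es' et', D.whisker (und q) (.pair (D.idCell B.pro) B'.l) (und r) es et =
                D.whisker (und (q.append (.single B))) (.single B'.l) (und r) es' et' := fun es' et' =>
              CellSeq.ext_toList (by simp [toList_whisker]; rfl)
            rw [hW es et] at hX
            rw [hW' (by rw [es]; simp [ProPath.append_assoc]) eW] at hY
            have hX₁ := hX.trans (congrArg (Γ₀.toList ++ ·) ((whisker_hit (r₁ := .nil _)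
              (r₂ := und (.cons B' r)) (P' := (und (q.append (.single B))).append (.single _)) _ rfl es
              et (by simp) (by rw [und_append, ProPath.append_assoc]; rfl) φ.1 (undSeq (.cons φ₂ Φ'' e₃)) _ _ _).trans
              (congrArg (fun x => VDShape.AnyCell.mk x :: (undSeq (.cons φ₂ Φ'' e₃)).toList) hd)))
            have hY₁ := hY.trans (congrArg (Γ₀.toList ++ ·) (whisker_skip (q₂ := .nil _)
              (S₂ := .cons _ (.cons B'.pro (und r))) (T₂ := und (.cons B' r))
              (ProPath.append_nil _).symm _ _ _ rfl rfl φ.1 (undSeq (.cons φ₂ Φ'' e₃)) _ _ _))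
            obtain ⟨Y', hY'⟩ := exists_append (s := S) (t := und T) Γ
              (.cons (s := .cons _ (und (.cons B' r))) (D.comp (.pair (Mon.Hom.cell _) φ₂.1 rfl) A₂.l
                (Category.comp_id _).symm (Category.comp_id _).symm) (undSeq Φ'')
                (by rw [e₃, und_append]; rfl)) (by rw [eS₁, es]; simp [ProPath.append_assoc])
              (by rw [eT']; simp [ProPath.append_assoc])
            refine Eq.trans ?_ (hχ.left_seq Φ'' φ₂ e₃ eT' Γ
              (by rw [eS₁, es]; simp [ProPath.append_assoc]) Y Y' ?_ hY' eu ev).symm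
            · refine hχ.inner_comp eT Γ₀ φ.1 (Mon.Hom.cell _) φ₂.1 (undSeq Φ'') ?_ rfl rfl X Y'
                hX₁ ?_ eu ev
              · rw [eS₁, es]
                have := congrArg und e₃
                rw [und_append, und_cons] at this
                rw [← this]
                simp [ProPath.append_assoc]
              · rw [hY', hΓ, List.append_assoc]; rfl
            · rw [hY₁, hΓ, List.append_assoc]; rfl
        | cons B₂ s =>
          cases hp
          subst hq
          have hd := φ.2.inner q B B' s rfl
          refine comp_congr (hX.trans (Eq.trans (congrArg (Γ₀.toList ++ ·) ?_) hY.symm)) _ _ _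
          refine (whisker_hit (r₁ := und s) (r₂ := und p') _ (und_append _ _) es _ (by simp) rfl φ.1
            (undSeq Φ') _ _ _).trans (Eq.trans ?_ (whisker_hit (r₁ := und s) (r₂ := und p') _
            (und_append _ _) es _ (by simp) rfl φ.1 (undSeq Φ') _ _ _).symm)
          exact congrArg (fun x => VDShape.AnyCell.mk x :: (undSeq Φ').toList) hd

/-- Bimodule homomorphisms are closed under composition. -/
theorem IsBimodHom.comp {M N M' N' M'' N'' : D.modShape.Obj} {f : M ⟶ M'} {g : N ⟶ N'}
    {p : ProPath (Bimod (D := D)) M N} {T : ProPath (Bimod (D := D)) M' N'}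
    (Φ : D.modShape.CellSeq f g p T) {h : M' ⟶ M''} {k : N' ⟶ N''} {C : Bimod M'' N''}
    {χ : D.Cell (Mon.Hom.hom h) (Mon.Hom.hom k) (und T) C.pro} (hχ : IsBimodHom h k T C χ) :
    IsBimodHom (f ≫ h) (g ≫ k) p C (D.comp (undSeq Φ) χ rfl rfl) where
  left {L} B q e := by
    cases Φ with
    | nil => cases e
    | cons φ Φ' e₂ =>
      subst e
      rename_i p₁ p' A t'
      let Y : D.CellSeq (Mon.Hom.hom f) (Mon.Hom.hom g) (.cons M.pro (und (.cons B q)))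
          (und (.cons A t')) := .cons (D.comp (p := .cons M.pro (und p₁))
          (.pair (Mon.Hom.cell f) φ.1 rfl) A.l
          (Category.comp_id _).symm (Category.comp_id _).symm) (undSeq Φ')
          (by rw [e₂, und_append]; rfl)
      refine (comp_comp _ _ _ _ _ _ _ _ (Category.id_comp _).symm (Category.id_comp _).symm
        rfl).trans ((hχ.left_seq Φ' φ e₂ (t₀ := .nil _) rfl (.nil _) rfl _ Y rfl rfl _ _).trans ?_)
      exact hχ.left_comp rfl (Mon.Hom.cell f) φ.1 (undSeq Φ') rfl rfl
        ((congrArg und e₂).trans (und_append p₁ p')) Y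
        (undSeq (.cons φ Φ' e₂)) rfl rfl _ _ _
  right {L} q B e := by
    refine (comp_comp _ _ _ _ _ _ _ _ (Category.id_comp _).symm (Category.id_comp _).symm
        rfl).trans ?_
    exact hχ.right_seq Φ e (t₀ := .nil _) rfl (.nil _) _ _ rfl rfl rfl _ _ rfl rfl _ _
  inner {K L K'} q B B' r e := by
    refine (comp_comp _ _ _ _ _ _ _ _ (Category.id_comp _).symm (Category.id_comp _).symm
        rfl).trans (Eq.trans ?_ (comp_comp _ _ _ _ _ _ _ _ (Category.id_comp _).symm
        (Category.id_comp _).symm rfl).symm)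
    exact hχ.inner_seq Φ e (t₀ := .nil _) rfl (.nil _) _ _ rfl _ _ rfl rfl _ _
  nil := by
    cases Φ with
    | nil f =>
      have := congrArg (fun x => D.comp (.single (Mon.Hom.cell f)) x rfl rfl) hχ.nil
      refine Eq.trans ?_ (this.trans ?_)
      · exact (comp_pair _ (.single (Mon.Hom.cell f)) (.nil _) _ _ _ rfl rfl rfl _ _ _ _ _ _ _).symm
      · exact comp_pair _ (.nil _) (.single (Mon.Hom.cell f)) _ _ _ rfl rfl rfl _ _ _ _ _ _ _
    | cons φ Φ' e₂ =>
      rename_i p₁ p' A t'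
      cases p with
      | cons => trivial
      | nil =>
        cases p₁ with
        | cons => cases e₂
        | nil =>
          cases e₂
          let X : D.CellSeq (Mon.Hom.hom f) (Mon.Hom.hom g) (.single M.pro)
              (und (.cons A t')) := .cons (D.comp (p := .single M.pro)
              (.pair (Mon.Hom.cell f) φ.1 rfl) A.l
              (Category.comp_id _).symm (Category.comp_id _).symm) (undSeq Φ') rfl
          refine (hχ.left_comp rfl (Mon.Hom.cell f) φ.1 (undSeq Φ') rfl rfl rfl X
            (undSeq (.cons φ Φ' rfl)) rfl rfl rfl rfl rfl).symm.trans ?_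
          refine hχ.nil_seq Φ' trivial (t₀ := .nil _) rfl (.nil _) φ.1 rfl rfl rfl rfl X
            (undSeq (.cons φ Φ' rfl)) ?_ rfl _ _
          exact congrArg (fun x => VDShape.AnyCell.mk x :: (undSeq Φ').toList) φ.2.nil

/-- Identity cells are bimodule homomorphisms. -/
theorem IsBimodHom.id {M N : D.Mon} (B : Bimod M N) :
    IsBimodHom (𝟙 M : M ⟶ M) (𝟙 N : N ⟶ N) (.single B) B (D.idCell B.pro) where
  left {L} B' q e := by
    cases e
    exact (comp_congr rfl _ _ _).trans ((D.comp_id B.l).trans (D.id_comp B.l).symm)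
  right {L} q B' e := by
    cases q with
    | nil =>
      cases e
      exact (comp_congr rfl _ _ _).trans ((D.comp_id B.r).trans (D.id_comp B.r).symm)
    | cons _ q => cases q <;> cases e
  inner {K L K'} q B₁ B₂ r e := by
    cases q with
    | nil => cases e
    | cons _ q => cases q <;> cases e
  nil := trivial

theorem toList_undSeq_append {a b c a' b' c' : D.modShape.Obj} {f : a ⟶ a'} {g : b ⟶ b'}
    {h : c ⟶ c'} {s : D.modShape.Path a c} {t : D.modShape.Path a' c'}
    {p : D.modShape.Path a b} {p' : D.modShape.Path b c} {q : D.modShape.Path a' b'}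
    {q' : D.modShape.Path b' c'} (X : D.modShape.CellSeq f h s t) (Φ : D.modShape.CellSeq f g p q)
    (Ψ : D.modShape.CellSeq g h p' q') (es : s = p.append p') (et : t = q.append q')
    (hX : X.toList = Φ.toList ++ Ψ.toList) :
    (undSeq X).toList = (undSeq Φ).toList ++ (undSeq Ψ).toList := by
  subst es et
  obtain rfl : X = Φ.append Ψ := CellSeq.ext_toList (by simpa using hX)
  clear hX
  induction Φ with
  | nil => rfl
  | cons φ Φ e ih => exact congrArg _ (ih Ψ)

variable (D)

/-- The operations of the virtual double category of monoids and modules, which are those of `D`. -/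
@[reducible] def modOps : VDOps.{max u w z, max v z, max w z, z} where
  toVDShape := D.modShape
  idCell B := ⟨D.idCell B.pro, IsBimodHom.id B⟩
  comp Φ χ ef eg := ⟨D.comp (undSeq Φ) χ.1 (congrArg Mon.Hom.hom ef) (congrArg Mon.Hom.hom eg), by
    subst ef eg; exact χ.2.comp Φ⟩

variable {D}

theorem undSeq_idSeq {M N : D.modShape.Obj} (p : D.modShape.Path M N) :
    (undSeq (D.modOps.idSeq p)).toList = (D.idSeq (und p)).toList := by
  induction p with
  | nil => rfl
  | cons B p ih => exact congrArg (List.cons _) ih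

theorem undSeq_compSeq {a b c d e e' : D.modShape.Obj} {h : a ⟶ c} {k : b ⟶ d} {f : c ⟶ e}
    {g : d ⟶ e'} {p : D.modShape.Path a b} {q : D.modShape.Path c d} {r : D.modShape.Path e e'}
    {f' : a ⟶ e} {g' : b ⟶ e'} (Φ : D.modShape.CellSeq h k p q) (Ψ : D.modShape.CellSeq f g q r)
    (ef : f' = h ≫ f) (eg : g' = k ≫ g) :
    (VDOps.compSeq (undSeq Φ) (undSeq Ψ) (congrArg Mon.Hom.hom ef)
      (congrArg Mon.Hom.hom eg)).toList =
      (undSeq (VDOps.compSeq (D := D.modOps) Φ Ψ ef eg)).toList := by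
  induction Ψ generalizing a with
  | nil f =>
    cases Φ
    subst ef eg
    exact VDOps.compSeq_nil _ _ _ _
  | cons ψ Ψ e₁ ih =>
    obtain ⟨m, l, p₁, p₂, Φ₁, Φ₂, h₁, h₂⟩ := VDOps.exists_cut Φ _ _ e₁
    refine Eq.trans ?_ (congrArg (fun x => (undSeq x).toList) (VDOps.compSeq_cons (D := D.modOps) Φ
      Φ₁ Φ₂ h₂ ψ Ψ h₁ e₁ ef eg rfl)).symm
    refine (congrArg CellSeq.toList (VDOps.compSeq_cons (undSeq Φ) (undSeq Φ₁) (undSeq Φ₂)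
      (toList_undSeq_append Φ Φ₁ Φ₂ h₁ e₁ h₂) ψ.1 (undSeq Ψ) ((congrArg und h₁).trans
        (und_append p₁ p₂)) _ _ _ rfl)).trans ?_
    exact congrArg (List.cons _) (ih Φ₂ rfl eg)

variable (D)

/-- The virtual double category of monoids and modules in `D`. -/
@[reducible] def Mod : VirtualDoubleCategory.{max u w z, max v z, max w z, z} where
  toVDOps := D.modOps
  id_comp φ := Subtype.ext ((comp_congr (undSeq_idSeq _) _ _ _).trans (D.id_comp φ.1))
  comp_id φ := Subtype.ext ((comp_congr rfl _ _ _).trans (D.comp_id φ.1))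
  assoc Φ Ψ χ := Subtype.ext (comp_comp (undSeq Φ) (undSeq Ψ) χ.1 rfl rfl rfl rfl _ rfl rfl
    (undSeq_compSeq Φ Ψ rfl rfl)).symm

variable {D}

end VirtualDoubleCategory

namespace VirtualDoubleCategory

open VDShape (CellSeq)

variable {D : VirtualDoubleCategory.{u, v, w, z}}

/-- A cell with identity frames is opcartesian if composing with it, surrounded by identity cells,
is a bijection on cells with arbitrary frames and target. -/
def IsOpcartesian {a b : D.Obj} {p : D.Path a b} {B : D.Pro a b} (θ : D.Cell (𝟙 a) (𝟙 b) p B) :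
    Prop :=
  ∀ ⦃a' b' c d : D.Obj⦄ (q : D.Path a' a) (r : D.Path b b') (f : a' ⟶ c) (g : b' ⟶ d)
    (C : D.Pro c d), Function.Bijective fun χ : D.Cell f g (q.append (.cons B r)) C =>
      (D.comp (D.whisker q (.single θ) r rfl rfl) χ (Category.id_comp f).symm
        (Category.id_comp g).symm : D.Cell f g (q.append (p.append r)) C)

/-- A cell whose source is a single proarrow is cartesian if composing with it is a bijection onto
the cells whose frames factor through its frames. -/
def IsCartesian {a b c d : D.Obj} {f : a ⟶ c} {g : b ⟶ d} {A : D.Pro a b} {B : D.Pro c d}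
    (φ : D.Cell f g (.single A) B) : Prop :=
  ∀ ⦃a' b' : D.Obj⦄ (h : a' ⟶ a) (k : b' ⟶ b) (p : D.Path a' b'),
    Function.Bijective fun χ : D.Cell h k p A =>
      (D.comp (.single χ) φ rfl rfl : D.Cell (h ≫ f) (k ≫ g) p B)

variable (D)

/-- Every object has a unit. -/
def HasUnits : Prop :=
  ∀ x : D.Obj, ∃ (A : D.Pro x x) (η : D.Cell (𝟙 x) (𝟙 x) (.nil x) A), IsOpcartesian η

/-- Every proarrow has a restriction along every pair of vertical arrows into its ends. -/
def HasRestrictions : Prop :=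
  ∀ ⦃a b c d : D.Obj⦄ (f : a ⟶ c) (g : b ⟶ d) (B : D.Pro c d),
    ∃ (A : D.Pro a b) (φ : D.Cell f g (.single A) B), IsCartesian φ

/-- Virtual equipments. -/
structure IsVirtualEquipment : Prop where
  hasUnits : D.HasUnits
  hasRestrictions : D.HasRestrictions

/-- A choice of a unit for each object. -/
structure Units where
  pro : ∀ x : D.Obj, D.Pro x x
  cell : ∀ x : D.Obj, D.Cell (𝟙 x) (𝟙 x) (.nil x) (pro x)
  opcart : ∀ x : D.Obj, IsOpcartesian (cell x)

variable {D}

theorem IsOpcartesian.existsUnique {a b : D.Obj} {p : D.Path a b} {B : D.Pro a b}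
    {θ : D.Cell (𝟙 a) (𝟙 b) p B} (hθ : IsOpcartesian θ) {a' b' c d : D.Obj} (q : D.Path a' a)
    (r : D.Path b b') {f : a' ⟶ c} {g : b' ⟶ d} {C : D.Pro c d} {S T : D.Path a' b'}
    (eS : S = q.append (p.append r)) (eT : T = q.append (.cons B r))
    (X : D.CellSeq (𝟙 a') (𝟙 b') S T)
    (hX : X.toList = (D.idSeq q).toList ++ ⟨θ⟩ :: (D.idSeq r).toList) (γ : D.Cell f g S C) :
    ∃! χ : D.Cell f g T C, D.comp X χ (Category.id_comp f).symm (Category.id_comp g).symm = γ := by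
  subst eS eT
  obtain rfl : X = D.whisker q (.single θ) r rfl rfl := CellSeq.ext_toList
    (hX.trans (toList_whisker q (.single θ) r rfl rfl).symm)
  exact (hθ q r f g C).existsUnique γ

theorem pair_congr {a b c a' b' c' x y : D.Obj} {f : a ⟶ a'} {g : b ⟶ b'} {h : c ⟶ c'}
    {p : D.Path a b} {q : D.Path b c} {s : D.Path a c} {A : D.Pro a' b'} {B : D.Pro b' c'}
    {φ φ' : D.Cell f g p A} {ψ ψ' : D.Cell g h q B} (h₁ : φ = φ') (h₂ : ψ = ψ')
    (e : s = p.append q) {k : a' ⟶ x} {l : c' ⟶ y} {C : D.Pro x y} (χ : D.Cell k l (.pair A B) C)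
    {k' : a ⟶ x} {l' : c ⟶ y} (ek : k' = f ≫ k) (el : l' = h ≫ l) :
    D.comp (.pair φ ψ e) χ ek el = D.comp (.pair φ' ψ' e) χ ek el := by
  rw [h₁, h₂]

/-- The unit bimodule of a monoid. -/
def Mon.self (M : D.Mon) : Bimod M M where
  pro := M.pro
  l := M.mul
  r := M.mul
  unit_l := M.unit_mul
  unit_r := M.mul_unit
  assoc_l := M.mul_assoc
  assoc_r := M.mul_assoc.symm
  assoc_lr := M.mul_assoc

namespace Units

variable (U : D.Units)

theorem exists_lact {x y : D.Obj} (P : D.Pro x y) :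
    ∃! χ : D.Cell (𝟙 x) (𝟙 y) (.pair (U.pro x) P) P,
      D.comp (.pair (U.cell x) (D.idCell P)) χ (by simp) (by simp) = D.idCell P :=
  (U.opcart x).existsUnique (.nil x) (.single P) rfl rfl _ rfl _

theorem exists_ract {x y : D.Obj} (P : D.Pro x y) :
    ∃! χ : D.Cell (𝟙 x) (𝟙 y) (.pair P (U.pro y)) P,
      D.comp (.pair (D.idCell P) (U.cell y)) χ (by simp) (by simp) = D.idCell P :=
  (U.opcart y).existsUnique (.single P) (.nil y) rfl rfl _ rfl _

/-- The left action of the unit on a proarrow, induced by the universal property of the unit. -/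
noncomputable def lact {x y : D.Obj} (P : D.Pro x y) :
    D.Cell (𝟙 x) (𝟙 y) (.pair (U.pro x) P) P := (U.exists_lact P).choose

/-- The right action of the unit on a proarrow, induced by the universal property of the unit. -/
noncomputable def ract {x y : D.Obj} (P : D.Pro x y) :
    D.Cell (𝟙 x) (𝟙 y) (.pair P (U.pro y)) P := (U.exists_ract P).choose

theorem lact_spec {x y : D.Obj} (P : D.Pro x y) :
    D.comp (.pair (U.cell x) (D.idCell P)) (U.lact P) (by simp) (by simp) = D.idCell P :=
  (U.exists_lact P).choose_spec.1

theorem ract_spec {x y : D.Obj} (P : D.Pro x y) :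
    D.comp (.pair (D.idCell P) (U.cell y)) (U.ract P) (by simp) (by simp) = D.idCell P :=
  (U.exists_ract P).choose_spec.1

/-- Acting by the unit cell on the target of a cell does nothing. -/
theorem lact_comp {a b x y : D.Obj} {f : a ⟶ x} {g : b ⟶ y} {p : D.Path a b} {P : D.Pro x y}
    (ψ : D.Cell f g p P) (ν : D.Cell f f (.nil a) (U.pro x))
    (hν : D.comp (.nil f) (U.cell x) (by simp) (by simp) = ν) :
    D.comp (.pair ν ψ) (U.lact P) (by simp) (by simp) = ψ := by
  subst hν
  have := congrArg (fun x => D.comp (.single ψ) x (Category.comp_id _).symm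
    (Category.comp_id _).symm) (U.lact_spec P)
  refine Eq.trans (Eq.symm ?_) (this.trans (D.comp_id ψ))
  refine (comp_pair (.single ψ) (.nil f) (.single ψ) _ _ _ rfl rfl rfl _ _ _ _ (Category.comp_id _).symm (Category.comp_id _).symm
    (Category.comp_id _).symm).trans ?_
  rw [D.comp_id]

theorem ract_comp {a b x y : D.Obj} {f : a ⟶ x} {g : b ⟶ y} {p : D.Path a b} {P : D.Pro x y}
    (ψ : D.Cell f g p P) (ν : D.Cell g g (.nil b) (U.pro y))
    (hν : D.comp (.nil g) (U.cell y) (by simp) (by simp) = ν) :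
    D.comp (.pair ψ ν (by simp)) (U.ract P) (by simp) (by simp) = ψ := by
  subst hν
  have := congrArg (fun x => D.comp (.single ψ) x (Category.comp_id _).symm
    (Category.comp_id _).symm) (U.ract_spec P)
  refine Eq.trans (Eq.symm ?_) (this.trans (D.comp_id ψ))
  refine (comp_pair (.single ψ) (.single ψ) (.nil g) _ _ _ (by simp) rfl rfl _ _ _ _
    (Category.comp_id _).symm (Category.comp_id _).symm (Category.comp_id _).symm).trans ?_
  rw [D.comp_id]

theorem lact_assoc {x y y' : D.Obj} {P : D.Pro x y} {Q : D.Pro y y'} {R : D.Pro x y'}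
    (ψ : D.Cell (𝟙 x) (𝟙 y') (.pair P Q) R) :
    D.comp (p := .cons (U.pro x) (.pair P Q)) (f' := 𝟙 _) (g' := 𝟙 _)
        (.pair (U.lact P) (D.idCell Q)) ψ (by simp) (by simp) =
      D.comp (.pair (D.idCell (U.pro x)) ψ) (U.lact R) (by simp) (by simp) := by
  let X : D.CellSeq (𝟙 x) (𝟙 y') (.pair P Q) (.cons (U.pro x) (.pair P Q)) :=
    .cons (U.cell x) (.pair (D.idCell P) (D.idCell Q)) rfl
  refine ((U.opcart x).existsUnique (.nil x) (.pair P Q) rfl rfl X rfl ψ).unique ?_ ?_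
  · refine (comp_pair X (.pair (U.cell x) (D.idCell P)) (.single (D.idCell Q)) _ _ _ rfl rfl rfl _ _
      _ _ (Category.comp_id _).symm (Category.comp_id _).symm (Category.comp_id _).symm).trans ?_
    exact (pair_congr (U.lact_spec P) (D.comp_id _) _ _ _ _).trans (D.id_comp ψ)
  · refine (comp_pair X (.single (U.cell x)) (.pair (D.idCell P) (D.idCell Q)) _ _ _ rfl rfl rfl _ _
      _ _ (Category.comp_id _).symm (Category.comp_id _).symm (Category.comp_id _).symm).trans ?_
    exact (pair_congr (D.comp_id _) (D.id_comp ψ) _ _ _ _).trans (U.lact_comp ψ _ (D.id_comp _))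

theorem ract_assoc {x y y' : D.Obj} {P : D.Pro x y} {Q : D.Pro y y'} {R : D.Pro x y'}
    (ψ : D.Cell (𝟙 x) (𝟙 y') (.pair P Q) R) :
    D.comp (p := .cons P (.pair Q (U.pro y'))) (f' := 𝟙 _) (g' := 𝟙 _)
        (.pair (D.idCell P) (U.ract Q)) ψ (by simp) (by simp) =
      D.comp (.pair ψ (D.idCell (U.pro y'))) (U.ract R) (by simp) (by simp) := by
  let X : D.CellSeq (𝟙 x) (𝟙 y') (.pair P Q) (.cons P (.pair Q (U.pro y'))) :=
    .cons (D.idCell P) (.pair (D.idCell Q) (U.cell y')) rfl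
  refine ((U.opcart y').existsUnique (.pair P Q) (.nil y') rfl rfl X rfl ψ).unique ?_ ?_
  · refine (comp_pair X (.single (D.idCell P)) (.pair (D.idCell Q) (U.cell y')) _ _ _ rfl rfl rfl _ _
      _ _ (Category.comp_id _).symm (Category.comp_id _).symm (Category.comp_id _).symm).trans ?_
    exact (pair_congr (D.comp_id _) (U.ract_spec Q) _ _ _ _).trans (D.id_comp ψ)
  · refine (comp_pair X (.pair (D.idCell P) (D.idCell Q)) (.single (U.cell y')) _ _ _ rfl rfl rfl _ _
      _ _ (Category.comp_id _).symm (Category.comp_id _).symm (Category.comp_id _).symm).trans ?_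
    exact (pair_congr (D.id_comp ψ) (D.comp_id _) _ _ _ _).trans (U.ract_comp ψ _ (D.id_comp _))

theorem ract_eq_lact (x : D.Obj) : U.ract (U.pro x) = U.lact (U.pro x) := by
  refine (U.exists_ract (U.pro x)).unique (U.ract_spec _) ?_
  refine ((U.opcart x).existsUnique (.nil x) (.nil x) rfl rfl (.single (U.cell x)) rfl
    (U.cell x)).unique ?_ (D.comp_id _)
  refine (comp_pair (.single (U.cell x)) (.single (U.cell x)) (.nil _) _ _ _ rfl rfl rfl _ _
      _ _ (Category.comp_id _).symm (Category.comp_id _).symm (Category.comp_id _).symm).trans ?_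
  rw [D.comp_id, show D.comp (.nil (𝟙 x)) (U.cell x) (Category.comp_id _).symm
      (Category.comp_id _).symm = U.cell x from D.id_comp _]
  exact U.lact_comp (U.cell x) _ (D.id_comp _)

/-- The trivial monoid on an object. -/
noncomputable def triv (x : D.Obj) : D.Mon where
  obj := x
  pro := U.pro x
  unit := U.cell x
  mul := U.lact (U.pro x)
  unit_mul := U.lact_spec _
  mul_unit := by rw [← U.ract_eq_lact]; exact U.ract_spec _
  mul_assoc := U.lact_assoc _

/-- A proarrow as a bimodule between trivial monoids. -/
noncomputable def trivBimod {x y : D.Obj} (P : D.Pro x y) : Bimod (U.triv x) (U.triv y) where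
  pro := P
  l := U.lact P
  r := U.ract P
  unit_l := U.lact_spec P
  unit_r := U.ract_spec P
  assoc_l := U.lact_assoc _
  assoc_r := by
    refine Eq.trans ?_ (U.ract_assoc (U.ract P))
    rw [U.ract_eq_lact]; rfl
  assoc_lr := U.lact_assoc _

theorem exists_trivCell {x y : D.Obj} (f : x ⟶ y) :
    ∃! χ : D.Cell f f (.single (U.pro x)) (U.pro y),
      D.comp (.single (U.cell x)) χ (Category.id_comp f).symm (Category.id_comp f).symm =
        D.comp (.nil f) (U.cell y) (Category.comp_id f).symm (Category.comp_id f).symm :=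
  (U.opcart x).existsUnique (.nil x) (.nil x) rfl rfl _ rfl _

/-- The unit cell on a vertical arrow. -/
noncomputable def trivCell {x y : D.Obj} (f : x ⟶ y) : D.Cell f f (.single (U.pro x)) (U.pro y) :=
  (U.exists_trivCell f).choose

theorem trivCell_spec {x y : D.Obj} (f : x ⟶ y) :
    D.comp (.single (U.cell x)) (U.trivCell f) (Category.id_comp f).symm
        (Category.id_comp f).symm =
      D.comp (.nil f) (U.cell y) (Category.comp_id f).symm (Category.comp_id f).symm :=
  (U.exists_trivCell f).choose_spec.1

/-- The homomorphism of trivial monoids given by a vertical arrow. -/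
noncomputable def trivMap {x y : D.Obj} (f : x ⟶ y) : U.triv x ⟶ U.triv y :=
  show Mon.Hom _ _ from
  { hom := f
    cell := U.trivCell f
    unit_cell := U.trivCell_spec f
    mul_cell := by
      refine ((U.opcart x).existsUnique (.nil x) (.single (U.pro x)) rfl rfl
        (.pair (U.cell x) (D.idCell (U.pro x))) rfl (U.trivCell f)).unique ?_ ?_
      · refine (comp_single _ _ _ _ _ _ _ (Category.comp_id _).symm
          (Category.comp_id _).symm).trans ?_
        refine (congrArg (fun x => D.comp (.single x) _ _ _) (U.lact_spec _)).trans ?_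
        exact D.id_comp _
      · refine (comp_pair _ (.single (U.cell x)) (.single (D.idCell _)) _ _ _ rfl rfl rfl _ _
          _ _ (Category.id_comp _).symm (Category.id_comp _).symm (Category.id_comp _).symm).trans ?_
        exact (pair_congr rfl (D.id_comp (U.trivCell f)) _ _ _ _).trans
          (U.lact_comp _ _ (U.trivCell_spec f).symm) }

end Units

end VirtualDoubleCategory

namespace VirtualDoubleCategory

open VDShape (CellSeq)

variable {D : VirtualDoubleCategory.{u, v, w, z}}

namespace Units

variable (U : D.Units)

/-- Embeddings of a monoid into an object: homomorphisms to the trivial monoid. -/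
abbrev Emb (M : D.Mon) (x : D.Obj) : Type (max v z) := Mon.Hom M (U.triv x)

variable {U}

/-- The composite of an embedding with (the unit cell on) a vertical arrow. -/
noncomputable def Emb.comp {M : D.Mon} {x y : D.Obj} (i : U.Emb M x) (f : x ⟶ y) : U.Emb M y :=
  Mon.Hom.comp i (U.trivMap f)

variable (U)

/-- Embeddings `φ` of a bimodule into a proarrow, for given embeddings `i` and `j` of monoids. -/
def IsBimodEmb {M N : D.Mon} {x y : D.Obj} (i : U.Emb M x) (j : U.Emb N y) (B : Bimod M N)
    (P : D.Pro x y) (φ : D.Cell i.hom j.hom (.single B.pro) P) : Prop :=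
  IsBimodHom i j (.single B) (U.trivBimod P) φ

/-- Collapses of monoids: universal embeddings. -/
def IsCollapse {M : D.Mon} {x : D.Obj} (i : U.Emb M x) : Prop :=
  ∀ ⦃y : D.Obj⦄ (j : U.Emb M y), ∃! f : x ⟶ y, i.comp f = j

/-- Collapses of bimodules: universal embeddings over given collapses of the monoids. -/
structure IsBimodCollapse {M N : D.Mon} {x y : D.Obj} (i : U.Emb M x) (j : U.Emb N y)
    (B : Bimod M N) (P : D.Pro x y) (φ : D.Cell i.hom j.hom (.single B.pro) P) : Prop where
  left : U.IsCollapse i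
  right : U.IsCollapse j
  emb : U.IsBimodEmb i j B P φ
  universal : ∀ ⦃x' y' : D.Obj⦄ (f : x ⟶ x') (g : y ⟶ y') (Q : D.Pro x' y')
    (ψ : D.Cell (i.hom ≫ f) (j.hom ≫ g) (.single B.pro) Q),
    U.IsBimodEmb (i.comp f) (j.comp g) B Q ψ →
      ∃! χ : D.Cell f g (.single P) Q, D.comp (.single φ) χ rfl rfl = ψ

/-- Normal collapses: the collapse `i` of `M` also exhibits the unit proarrow of the target as a
collapse of the unit bimodule of `M`. -/
def IsNormalCollapse {M : D.Mon} {x : D.Obj} (i : U.Emb M x) : Prop :=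
  U.IsCollapse i ∧ U.IsBimodCollapse i i M.self (U.pro x) i.cell

/-- Kernels of a vertical arrow `f : c ⟶ d`: monoids on `c` obtained by restricting the trivial
monoid on `d`. -/
structure Kernel {c d : D.Obj} (f : c ⟶ d) where
  mon : D.Mon
  obj_eq : mon.obj = c
  emb : U.Emb mon d
  hom_eq : emb.hom = eqToHom obj_eq ≫ f
  cart : IsCartesian emb.cell

/-- Regular covers: the kernel is a normal collapse. -/
def IsRegularCover {c d : D.Obj} (f : c ⟶ d) : Prop :=
  ∃ K : U.Kernel f, U.IsNormalCollapse K.emb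

/-- Effective monoids: the kernels of vertical arrows. -/
def IsEffective (M : D.Mon) : Prop :=
  ∃ (d : D.Obj) (i : U.Emb M d), IsCartesian i.cell

/-- Effective bimodules: those with a cartesian embedding into a proarrow. -/
def IsEffectiveBimod {M N : D.Mon} (B : Bimod M N) : Prop :=
  ∃ (x y : D.Obj) (i : U.Emb M x) (j : U.Emb N y) (P : D.Pro x y)
    (φ : D.Cell i.hom j.hom (.single B.pro) P), U.IsBimodEmb i j B P φ ∧
      IsCartesian i.cell ∧ IsCartesian j.cell ∧ IsCartesian φ

/-- Regularity of a virtual double category with units `U`. In `collapse_restriction`, `R` with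
`φ` is the restriction of `B` along `f` and `g`, as a bimodule between the kernels. -/
structure IsRegular : Prop where
  effective_collapse : ∀ M : D.Mon, U.IsEffective M →
    ∃ (x : D.Obj) (i : U.Emb M x), U.IsNormalCollapse i
  collapse_restriction : ∀ ⦃c d c' d' : D.Obj⦄ (f : c ⟶ d) (g : c' ⟶ d') (B : D.Pro d d'),
    U.IsRegularCover f → U.IsRegularCover g → ∀ (K : U.Kernel f) (K' : U.Kernel g)
      (R : Bimod K.mon K'.mon) (φ : D.Cell K.emb.hom K'.emb.hom (.single R.pro) B),
      U.IsBimodEmb K.emb K'.emb R B φ → IsCartesian φ →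
        U.IsBimodCollapse K.emb K'.emb R B φ

/-- Exactness of a virtual double category with units `U`. -/
structure IsExact : Prop where
  regular : U.IsRegular
  effective : ∀ M : D.Mon, U.IsEffective M
  effective_bimod : ∀ ⦃M N : D.Mon⦄ (B : Bimod M N), U.IsEffectiveBimod B

end Units

end VirtualDoubleCategory

namespace VirtualDoubleCategory

open VDShape (CellSeq)

variable {D : VirtualDoubleCategory.{u, v, w, z}}

/-! ### Cartesian cells: cancellation, composition and invertibility. -/

section Cartesian

variable {a b c d : D.Obj} {f : a ⟶ c} {g : b ⟶ d} {A : D.Pro a b} {B : D.Pro c d}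
  {φ : D.Cell f g (.single A) B}

/-! A monoid `A` in Mod(D) sits on a monoid M of D: it is an (M,M)-bimodule with a unit and a
multiplication that are bimodule homomorphisms. Forgetting M leaves a monoid of D on the same
object, `Mon.flat`, and m ↦ m·1 is a homomorphism from M to it, with identity vertical arrow. In the
same way a bimodule `B` in Mod(D) has an underlying bimodule `Bimod.flat` in D.

The base can be forgotten without loss. Since (m·1)β = m·β, the base acts through the underlying
monoid (`Bimod.flat_smul_flatMapCell`). If j embeds `A` into y, then j(m·1) is the image of m under
the base homomorphism of j (`Mon.flatMapCell_comp`), so j is determined by its cell. Thus embeddings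
of `A` into y and homomorphisms `A.flat ⟶ y` are the same cells of D subject to the same equations,
and likewise for bimodules. The universal embeddings `Mon.flatEmb` and `Bimod.flatCell` are identity
cells underneath. A bimodule homomorphism with cartesian underlying cell is cartesian
(`isCartesian_mod`), so these collapses are cartesian; this yields effectiveness, the collapses and
their normality.

Mod(D) is a virtual equipment because every monoid, as a bimodule over itself, is a unit: an
inserted copy of M is absorbed by a neighbouring bimodule, or by the target if there is no neighbour
(`Mon.isOpcartesian_unitCell`). Restrictions are taken on underlying proarrows, and the actions are
lifted along the cartesian cell (`exists_restriction_of_isCartesian`).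

For the second half of regularity, let f be a regular cover in Mod(D). Some kernel embedding of f is
a collapse, hence `Mon.flatEmb` followed by an isomorphism, so the vertical arrow of D underlying f
is invertible. For any kernel K of f, the homomorphism out of the underlying monoid of K that its
embedding induces then has an invertible vertical arrow and a cartesian cell, so it is an
isomorphism (`Units.Kernel.isIso_flatDesc`). A cartesian embedding over such kernels is therefore
`Bimod.flatCell` followed by a cartesian cell over isomorphisms, which is invertible, and so it is
again a collapse.

All these notions depend on a choice of units. The argument uses the unit bimodules; the invertible
comparison between two choices carries the result to all others. -/

theorem IsCartesian.existsUnique (hφ : IsCartesian φ) {a' b' : D.Obj} {h : a' ⟶ a} {k : b' ⟶ b}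
    {p : D.Path a' b'} {f' : a' ⟶ c} {g' : b' ⟶ d} (ef : f' = h ≫ f) (eg : g' = k ≫ g)
    (γ : D.Cell f' g' p B) : ∃! χ : D.Cell h k p A, D.comp (.single χ) φ ef eg = γ := by
  subst ef eg
  exact (hφ h k p).existsUnique γ

/-- Frames of composites agree only propositionally, so the equalities of frames are arguments; an
equation can then be tested against `φ` whatever form its frames have. -/
theorem IsCartesian.hom_ext (hφ : IsCartesian φ) {a' b' : D.Obj} {h : a' ⟶ a} {k : b' ⟶ b}
    {p : D.Path a' b'} {χ χ' : D.Cell h k p A} {f' : a' ⟶ c} {g' : b' ⟶ d} (ef : f' = h ≫ f)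
    (eg : g' = k ≫ g) (H : D.comp (.single χ) φ ef eg = D.comp (.single χ') φ ef eg) : χ = χ' := by
  subst ef eg
  exact (hφ h k p).injective H

theorem isCartesian_of_existsUnique (H : ∀ ⦃a' b' : D.Obj⦄ (h : a' ⟶ a) (k : b' ⟶ b)
    (p : D.Path a' b') (γ : D.Cell (h ≫ f) (k ≫ g) p B),
    ∃! χ : D.Cell h k p A, D.comp (.single χ) φ rfl rfl = γ) : IsCartesian φ :=
  fun _ _ h k p => (Function.bijective_iff_existsUnique _).2 (H h k p)

/-- A cell with a two-sided inverse is cartesian. -/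
theorem isCartesian_of_inverse {f' : c ⟶ a} {g' : d ⟶ b} {ψ : D.Cell f' g' (.single B) A}
    {ef : 𝟙 a = f ≫ f'} {eg : 𝟙 b = g ≫ g'} {ef' : 𝟙 c = f' ≫ f} {eg' : 𝟙 d = g' ≫ g}
    (h₁ : D.comp (.single φ) ψ ef eg = D.idCell A) (h₂ : D.comp (.single ψ) φ ef' eg' = D.idCell B) :
    IsCartesian φ := by
  refine isCartesian_of_existsUnique fun a' b' h k p γ => ?_
  refine ⟨D.comp (.single γ) ψ (by simp [← ef]) (by simp [← eg]), ?_, ?_⟩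
  · refine (comp_single _ _ _ ef' eg' (by simp) (by simp) _ _).symm.trans ?_
    rw [h₂]
    exact D.comp_id γ
  · rintro χ rfl
    refine Eq.trans ?_ (comp_single _ _ _ ef eg (by simp) (by simp) _ _)
    rw [h₁]
    exact (D.comp_id χ).symm

theorem isCartesian_idCell (A : D.Pro a b) : IsCartesian (D.idCell A) :=
  isCartesian_of_inverse (ef := (Category.comp_id _).symm) (eg := (Category.comp_id _).symm)
    (ef' := (Category.comp_id _).symm) (eg' := (Category.comp_id _).symm) (D.comp_id _) (D.comp_id _)

theorem IsCartesian.comp (hφ : IsCartesian φ) {x y : D.Obj} {f' : c ⟶ x} {g' : d ⟶ y}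
    {C : D.Pro x y} {ψ : D.Cell f' g' (.single B) C} (hψ : IsCartesian ψ) {f'' : a ⟶ x} {g'' : b ⟶ y}
    (ef : f'' = f ≫ f') (eg : g'' = g ≫ g') : IsCartesian (D.comp (.single φ) ψ ef eg) := by
  subst ef eg
  refine isCartesian_of_existsUnique fun a' b' h k p γ => ?_
  obtain ⟨γ', h₁, h₂⟩ := hψ.existsUnique (h := h ≫ f) (k := k ≫ g) (Category.assoc _ _ _).symm
    (Category.assoc _ _ _).symm γ
  obtain ⟨χ, h₃, h₄⟩ := hφ.existsUnique rfl rfl γ'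
  refine ⟨χ, ?_, fun χ' h' => h₄ _ (h₂ _ ?_)⟩
  · subst h₁ h₃
    exact comp_single _ _ _ _ _ _ _ rfl rfl
  · subst h'
    exact (comp_single _ _ _ _ _ _ _ rfl rfl).symm

/-- A cartesian cell over isomorphisms is invertible. -/
theorem IsCartesian.exists_inverse (hφ : IsCartesian φ) {f' : c ⟶ a} {g' : d ⟶ b}
    (ef : 𝟙 a = f ≫ f') (eg : 𝟙 b = g ≫ g') (ef' : 𝟙 c = f' ≫ f) (eg' : 𝟙 d = g' ≫ g) :
    ∃ ψ : D.Cell f' g' (.single B) A, D.comp (.single φ) ψ ef eg = D.idCell A ∧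
      D.comp (.single ψ) φ ef' eg' = D.idCell B := by
  obtain ⟨ψ, hψ, -⟩ := hφ.existsUnique ef' eg' (D.idCell B)
  -- The lift ψ of the identity is a one-sided inverse by construction. For the other side, φ
  -- followed by ψ and the identity have the same composite with φ, which can be cancelled.
  refine ⟨ψ, (hφ.existsUnique (Category.id_comp f).symm (Category.id_comp g).symm φ).unique ?_
    (D.id_comp φ), hψ⟩
  refine (comp_single _ _ _ ef' eg' (Category.comp_id f).symm (Category.comp_id g).symm _ _).symm.trans ?_
  rw [hψ]
  exact D.comp_id φ

/-- Cells factor uniquely through a cartesian cell over isomorphisms. -/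
theorem IsCartesian.existsUnique_factor (hφ : IsCartesian φ) [IsIso f] [IsIso g] {x y : D.Obj}
    {f₁ : c ⟶ x} {g₁ : d ⟶ y} {f₂ : a ⟶ x} {g₂ : b ⟶ y} {Q : D.Pro x y} (ef : f₂ = f ≫ f₁)
    (eg : g₂ = g ≫ g₁) (ψ : D.Cell f₂ g₂ (.single A) Q) :
    ∃! χ : D.Cell f₁ g₁ (.single B) Q, D.comp (.single φ) χ ef eg = ψ := by
  obtain ⟨τ, h₁, h₂⟩ := hφ.exists_inverse (IsIso.hom_inv_id f).symm (IsIso.hom_inv_id g).symm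
    (IsIso.inv_hom_id f).symm (IsIso.inv_hom_id g).symm
  refine ⟨D.comp (.single τ) ψ (by simp [ef]) (by simp [eg]), ?_, ?_⟩
  · refine (comp_single _ _ _ _ _ _ _ (IsIso.hom_inv_id f).symm (IsIso.hom_inv_id g).symm).trans ?_
    rw [h₁]
    exact D.id_comp ψ
  · rintro χ rfl
    refine Eq.trans ?_ (comp_single _ _ _ _ _ _ _ (IsIso.inv_hom_id f).symm
      (IsIso.inv_hom_id g).symm).symm
    rw [h₂]
    exact (D.id_comp χ).symm

/-- Two cartesian cells with the same frames and target differ by an invertible cell. -/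
theorem IsCartesian.exists_comparison (hφ : IsCartesian φ) {A' : D.Pro a b}
    {φ' : D.Cell f g (.single A') B} (hφ' : IsCartesian φ') :
    ∃ (σ : D.Cell (𝟙 a) (𝟙 b) (.single A) A') (τ : D.Cell (𝟙 a) (𝟙 b) (.single A') A),
      D.comp (.single σ) τ (Category.comp_id _).symm (Category.comp_id _).symm = D.idCell A ∧
      D.comp (.single τ) σ (Category.comp_id _).symm (Category.comp_id _).symm = D.idCell A' ∧
      D.comp (.single σ) φ' (Category.id_comp f).symm (Category.id_comp g).symm = φ := by
  obtain ⟨σ, hσ, -⟩ := hφ'.existsUnique (Category.id_comp f).symm (Category.id_comp g).symm φ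
  obtain ⟨τ, hτ, -⟩ := hφ.existsUnique (Category.id_comp f).symm (Category.id_comp g).symm φ'
  refine ⟨σ, τ, ?_, ?_, hσ⟩
  · refine (hφ.existsUnique (Category.id_comp f).symm (Category.id_comp g).symm φ).unique ?_
      (D.id_comp φ)
    refine (comp_single _ _ _ (Category.id_comp f).symm (Category.id_comp g).symm
      (Category.id_comp f).symm (Category.id_comp g).symm _ _).symm.trans ?_
    rw [hτ, hσ]
  · refine (hφ'.existsUnique (Category.id_comp f).symm (Category.id_comp g).symm φ').unique ?_
      (D.id_comp φ')
    refine (comp_single _ _ _ (Category.id_comp f).symm (Category.id_comp g).symm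
      (Category.id_comp f).symm (Category.id_comp g).symm _ _).symm.trans ?_
    rw [hσ, hτ]

end Cartesian

/-! ### Composition with identity cells as transport along equalities of frames. -/

theorem comp_comp_idCell {a b c d x y : D.Obj} {h : a ⟶ c} {k : b ⟶ d} {f : c ⟶ x} {g : d ⟶ y}
    {p : D.Path a b} {q : D.Path c d} {B : D.Pro x y} (Φ : D.CellSeq h k p q) (ψ : D.Cell f g q B)
    {f' f'' : a ⟶ x} {g' g'' : b ⟶ y} (e₁ : f' = h ≫ f) (e₂ : g' = k ≫ g) (e₃ : f'' = f' ≫ 𝟙 x)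
    (e₄ : g'' = g' ≫ 𝟙 y) : D.comp (.single (D.comp Φ ψ e₁ e₂)) (D.idCell B) e₃ e₄ =
      D.comp Φ ψ (by rw [e₃, e₁, Category.comp_id]) (by rw [e₄, e₂, Category.comp_id]) := by
  obtain rfl := e₃.trans (Category.comp_id _)
  obtain rfl := e₄.trans (Category.comp_id _)
  exact D.comp_id _

theorem comp_idCell_eq {a b c d : D.Obj} {f f' : a ⟶ c} {g g' : b ⟶ d} {A : D.Pro a b} {B : D.Pro c d}
    (φ : D.Cell f g (.single A) B) (e₁ : f' = f ≫ 𝟙 c) (e₂ : g' = g ≫ 𝟙 d) (e₃ : f' = 𝟙 a ≫ f)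
    (e₄ : g' = 𝟙 b ≫ g) :
    D.comp (.single φ) (D.idCell B) e₁ e₂ = D.comp (.single (D.idCell A)) φ e₃ e₄ := by
  obtain rfl := e₁.trans (Category.comp_id _)
  obtain rfl := e₂.trans (Category.comp_id _)
  exact (D.comp_id φ).trans (D.id_comp φ).symm

/-- The trailing identity cell only changes how the frames are written, as in `Mon.Hom.ext'`. This
is the form in which a cell factors through an embedding whose underlying cell is an identity. -/
theorem idCell_comp_comp_idCell {a b c d : D.Obj} {f f' : a ⟶ c} {g g' : b ⟶ d} {A : D.Pro a b}
    {B : D.Pro c d} (φ : D.Cell f g (.single A) B) (e₁ : f' = f ≫ 𝟙 c) (e₂ : g' = g ≫ 𝟙 d)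
    (e₃ : f = 𝟙 a ≫ f') (e₄ : g = 𝟙 b ≫ g') :
    D.comp (.single (D.idCell A)) (D.comp (.single φ) (D.idCell B) e₁ e₂) e₃ e₄ = φ := by
  obtain rfl := e₁.trans (Category.comp_id _)
  obtain rfl := e₂.trans (Category.comp_id _)
  exact (D.id_comp _).trans (D.comp_id φ)

theorem single_congr {a b c d x y : D.Obj} {h : a ⟶ c} {k : b ⟶ d} {p : D.Path a b} {A : D.Pro c d}
    {φ φ' : D.Cell h k p A} (H : φ = φ') {f : c ⟶ x} {g : d ⟶ y} {B : D.Pro x y}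
    (ψ : D.Cell f g (.single A) B) {f' : a ⟶ x} {g' : b ⟶ y} (ef : f' = h ≫ f) (eg : g' = k ≫ g) :
    D.comp (.single φ) ψ ef eg = D.comp (.single φ') ψ ef eg := by
  rw [H]

/-! ### Actions on cells -/

section Actions

variable {M N : D.Mon}

/-- The left action of a bimodule, applied to two adjacent cells. -/
def Bimod.smul (B : Bimod M N) {a b c : D.Obj} {x : a ⟶ M.obj} {y : b ⟶ M.obj} {t : c ⟶ N.obj}
    {p : D.Path a b} {q : D.Path b c} {s : D.Path a c} (μ : D.Cell x y p M.pro)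
    (β : D.Cell y t q B.pro) (e : s = p.append q := by rfl) : D.Cell x t s B.pro :=
  D.comp (.pair μ β e) B.l (Category.comp_id x).symm (Category.comp_id t).symm

/-- The right action of a bimodule, applied to two adjacent cells. -/
def Bimod.rsmul (B : Bimod M N) {a b c : D.Obj} {x : a ⟶ M.obj} {y : b ⟶ N.obj} {t : c ⟶ N.obj}
    {p : D.Path a b} {q : D.Path b c} {s : D.Path a c} (β : D.Cell x y p B.pro)
    (μ : D.Cell y t q N.pro) (e : s = p.append q := by rfl) : D.Cell x t s B.pro :=
  D.comp (.pair β μ e) B.r (Category.comp_id x).symm (Category.comp_id t).symm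

/-- The unit of a monoid at a vertical arrow. -/
def Mon.unitAt (M : D.Mon) {a : D.Obj} (x : a ⟶ M.obj) : D.Cell x x (.nil a) M.pro :=
  D.comp (.nil x) M.unit (Category.comp_id x).symm (Category.comp_id x).symm

variable (B : Bimod M N) {a b c d : D.Obj}

/-- Substitution into an action acts on each factor. The string `X` is fixed only through its list
of cells, since its type need not be that of a concatenation on the nose. -/
theorem Bimod.comp_smul {a' b' c' : D.Obj} {x : a' ⟶ M.obj} {y : b' ⟶ M.obj} {t : c' ⟶ N.obj}
    {p' : D.Path a' b'} {q' : D.Path b' c'} {s' : D.Path a' c'} (μ : D.Cell x y p' M.pro)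
    (β : D.Cell y t q' B.pro) (e : s' = p'.append q') {h : a ⟶ a'} {k : b ⟶ b'} {l : c ⟶ c'}
    {p : D.Path a b} {q : D.Path b c} {s : D.Path a c} (X : D.CellSeq h l s s')
    (Φ : D.CellSeq h k p p') (Φ' : D.CellSeq k l q q') (es : s = p.append q)
    (hX : X.toList = Φ.toList ++ Φ'.toList) {x' : a ⟶ M.obj} {t' : c ⟶ N.obj} {y' : b ⟶ M.obj}
    (ex : x' = h ≫ x) (et : t' = l ≫ t) (ey : y' = k ≫ y) :
    D.comp X (B.smul μ β e) ex et = B.smul (D.comp Φ μ ex ey) (D.comp Φ' β ey et) es :=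
  comp_pair X Φ Φ' μ β B.l es e hX _ _ _ _ _ _ _

theorem Bimod.comp_rsmul {a' b' c' : D.Obj} {x : a' ⟶ M.obj} {y : b' ⟶ N.obj} {t : c' ⟶ N.obj}
    {p' : D.Path a' b'} {q' : D.Path b' c'} {s' : D.Path a' c'} (β : D.Cell x y p' B.pro)
    (μ : D.Cell y t q' N.pro) (e : s' = p'.append q') {h : a ⟶ a'} {k : b ⟶ b'} {l : c ⟶ c'}
    {p : D.Path a b} {q : D.Path b c} {s : D.Path a c} (X : D.CellSeq h l s s')
    (Φ : D.CellSeq h k p p') (Φ' : D.CellSeq k l q q') (es : s = p.append q)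
    (hX : X.toList = Φ.toList ++ Φ'.toList) {x' : a ⟶ M.obj} {t' : c ⟶ N.obj} {y' : b ⟶ N.obj}
    (ex : x' = h ≫ x) (et : t' = l ≫ t) (ey : y' = k ≫ y) :
    D.comp X (B.rsmul β μ e) ex et = B.rsmul (D.comp Φ β ex ey) (D.comp Φ' μ ey et) es :=
  comp_pair X Φ Φ' β μ B.r es e hX _ _ _ _ _ _ _

theorem Bimod.smul_congr {x : a ⟶ M.obj} {y : b ⟶ M.obj} {t : c ⟶ N.obj}
    {p : D.Path a b} {q : D.Path b c} {s : D.Path a c} {μ μ' : D.Cell x y p M.pro}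
    {β β' : D.Cell y t q B.pro} (hμ : μ = μ') (hβ : β = β') (e : s = p.append q) :
    B.smul μ β e = B.smul μ' β' e := by
  rw [hμ, hβ]

theorem Bimod.rsmul_congr {x : a ⟶ M.obj} {y : b ⟶ N.obj} {t : c ⟶ N.obj}
    {p : D.Path a b} {q : D.Path b c} {s : D.Path a c} {β β' : D.Cell x y p B.pro}
    {μ μ' : D.Cell y t q N.pro} (hβ : β = β') (hμ : μ = μ') (e : s = p.append q) :
    B.rsmul β μ e = B.rsmul β' μ' e := by
  rw [hμ, hβ]

/-- The unit axiom concerns the identity cell; substituting `β` gives the general law. With the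
associativity laws below, cells into a bimodule can be handled like elements of a module. -/
theorem Bimod.smul_unitAt {x : a ⟶ M.obj} {t : c ⟶ N.obj} {q : D.Path a c}
    (β : D.Cell x t q B.pro) : B.smul (M.unitAt x) β = β := by
  have := congrArg (fun χ => D.comp (.single β) χ (Category.comp_id x).symm
    (Category.comp_id t).symm) B.unit_l
  refine Eq.trans (Eq.symm ?_) (this.trans (D.comp_id β))
  refine (comp_pair (.single β) (.nil x) (.single β) _ _ _ rfl rfl rfl _ _ _ _
    (Category.comp_id _).symm (Category.comp_id _).symm (Category.comp_id _).symm).trans ?_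
  rw [D.comp_id]
  rfl

theorem Bimod.rsmul_unitAt {x : a ⟶ M.obj} {t : c ⟶ N.obj} {q : D.Path a c}
    (β : D.Cell x t q B.pro) (e : q = q.append (.nil c) := (ProPath.append_nil q).symm) :
    B.rsmul β (N.unitAt t) e = β := by
  have := congrArg (fun χ => D.comp (.single β) χ (Category.comp_id x).symm
    (Category.comp_id t).symm) B.unit_r
  refine Eq.trans (Eq.symm ?_) (this.trans (D.comp_id β))
  refine (comp_pair (.single β) (.single β) (.nil t) _ _ _ e rfl rfl _ _ _ _
    (Category.comp_id _).symm (Category.comp_id _).symm (Category.comp_id _).symm).trans ?_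
  rw [D.comp_id]
  rfl

section Assoc

variable {p : D.Path a b} {q : D.Path b c} {r : D.Path c d} {pq : D.Path a c} {qr : D.Path b d}
  {s : D.Path a d}

/-- The associativity axiom, precomposed with the string of the three cells. A product in the monoid
is written as an action on `M.self`. -/
theorem Bimod.smul_smul {x : a ⟶ M.obj} {y : b ⟶ M.obj} {t : c ⟶ M.obj} {l : d ⟶ N.obj}
    (μ : D.Cell x y p M.pro) (μ' : D.Cell y t q M.pro) (β : D.Cell t l r B.pro)
    (e₁ : pq = p.append q) (e₂ : s = pq.append r) (e₃ : qr = q.append r) (e₄ : s = p.append qr) :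
    B.smul (M.self.smul μ μ' e₁) β e₂ = B.smul μ (B.smul μ' β e₃) e₄ := by
  subst e₁ e₃ e₄
  let X : D.CellSeq x l (p.append (q.append r)) (.cons M.pro (.pair M.pro B.pro)) :=
    .cons μ (.pair μ' β) rfl
  have := congrArg (fun χ => D.comp X χ (Category.comp_id x).symm (Category.comp_id l).symm)
    B.assoc_l
  refine Eq.trans (Eq.symm ?_) (this.trans ?_)
  · refine (comp_pair X (.pair μ μ') (.single β) _ _ _ e₂ rfl rfl _ _ _ _
      (Category.comp_id _).symm (Category.comp_id _).symm (Category.comp_id _).symm).trans ?_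
    rw [D.comp_id]
    rfl
  · refine (comp_pair X (.single μ) (.pair μ' β) _ _ _ rfl rfl rfl _ _ _ _
      (Category.comp_id _).symm (Category.comp_id _).symm (Category.comp_id _).symm).trans ?_
    rw [D.comp_id]
    rfl

theorem Bimod.rsmul_rsmul {x : a ⟶ M.obj} {y : b ⟶ N.obj} {t : c ⟶ N.obj} {l : d ⟶ N.obj}
    (β : D.Cell x y p B.pro) (μ : D.Cell y t q N.pro) (μ' : D.Cell t l r N.pro)
    (e₁ : pq = p.append q) (e₂ : s = pq.append r) (e₃ : qr = q.append r) (e₄ : s = p.append qr) :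
    B.rsmul (B.rsmul β μ e₁) μ' e₂ = B.rsmul β (N.self.smul μ μ' e₃) e₄ := by
  subst e₁ e₃ e₄
  let X : D.CellSeq x l (p.append (q.append r)) (.cons B.pro (.pair N.pro N.pro)) :=
    .cons β (.pair μ μ') rfl
  have := congrArg (fun χ => D.comp X χ (Category.comp_id x).symm (Category.comp_id l).symm)
    B.assoc_r
  refine Eq.trans (Eq.symm ?_) (this.symm.trans ?_)
  · refine (comp_pair X (.pair β μ) (.single μ') _ _ _ e₂ rfl rfl _ _ _ _
      (Category.comp_id _).symm (Category.comp_id _).symm (Category.comp_id _).symm).trans ?_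
    rw [D.comp_id]
    rfl
  · refine (comp_pair X (.single β) (.pair μ μ') _ _ _ rfl rfl rfl _ _ _ _
      (Category.comp_id _).symm (Category.comp_id _).symm (Category.comp_id _).symm).trans ?_
    rw [D.comp_id]
    rfl

theorem Bimod.rsmul_smul {x : a ⟶ M.obj} {y : b ⟶ M.obj} {t : c ⟶ N.obj} {l : d ⟶ N.obj}
    (μ : D.Cell x y p M.pro) (β : D.Cell y t q B.pro) (ν : D.Cell t l r N.pro)
    (e₁ : pq = p.append q) (e₂ : s = pq.append r) (e₃ : qr = q.append r) (e₄ : s = p.append qr) :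
    B.rsmul (B.smul μ β e₁) ν e₂ = B.smul μ (B.rsmul β ν e₃) e₄ := by
  subst e₁ e₃ e₄
  let X : D.CellSeq x l (p.append (q.append r)) (.cons M.pro (.pair B.pro N.pro)) :=
    .cons μ (.pair β ν) rfl
  have := congrArg (fun χ => D.comp X χ (Category.comp_id x).symm (Category.comp_id l).symm)
    B.assoc_lr
  refine Eq.trans (Eq.symm ?_) (this.trans ?_)
  · refine (comp_pair X (.pair μ β) (.single ν) _ _ _ e₂ rfl rfl _ _ _ _
      (Category.comp_id _).symm (Category.comp_id _).symm (Category.comp_id _).symm).trans ?_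
    rw [D.comp_id]
    rfl
  · refine (comp_pair X (.single μ) (.pair β ν) _ _ _ rfl rfl rfl _ _ _ _
      (Category.comp_id _).symm (Category.comp_id _).symm (Category.comp_id _).symm).trans ?_
    rw [D.comp_id]
    rfl

end Assoc

end Actions

/-! ### Bimodule homomorphisms with one or two sources -/

section Hom

variable {M N M' N' : D.Mon} {f : Mon.Hom M M'} {g : Mon.Hom N N'}

/-- A string of length one has a single first and a single last entry, no adjacent pair and is not
empty, so only the two outer conditions remain. -/
theorem isBimodHom_single_iff {A : Bimod M N} {C : Bimod M' N'}
    {φ : D.Cell f.hom g.hom (.single A.pro) C.pro} : IsBimodHom f g (.single A) C φ ↔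
      D.comp (.single A.l) φ (Category.id_comp _).symm (Category.id_comp _).symm = C.smul f.cell φ ∧
      D.comp (.single A.r) φ (Category.id_comp _).symm (Category.id_comp _).symm =
        C.rsmul φ g.cell := by
  refine ⟨fun h => ⟨(comp_congr rfl _ _ _).trans (h.left A _ rfl),
    (comp_congr rfl _ _ _).trans (h.right (.nil _) A rfl)⟩, fun ⟨left, right⟩ => ⟨?_, ?_, ?_, trivial⟩⟩
  · intro L B' q e
    cases e
    exact (comp_congr rfl _ _ _).trans left
  · intro L q B' e
    cases q with
    | nil =>
      cases e
      exact (comp_congr rfl _ _ _).trans right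
    | cons _ q => cases q <;> cases e
  · intro K L K' q B₁ B₂ r e
    cases q with
    | nil => cases e
    | cons _ q => cases q <;> cases e

theorem isBimodHom_pair {L : D.Mon} {A : Bimod M L} {B : Bimod L N} {C : Bimod M' N'}
    {φ : D.Cell f.hom g.hom (.pair A.pro B.pro) C.pro}
    (left : D.comp (p := .cons M.pro (.pair A.pro B.pro)) (.pair A.l (D.idCell B.pro)) φ
      (Category.id_comp _).symm (Category.id_comp _).symm = C.smul f.cell φ)
    (right : D.comp (p := .cons A.pro (.pair B.pro N.pro)) (.pair (D.idCell A.pro) B.r) φ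
      (Category.id_comp _).symm (Category.id_comp _).symm = C.rsmul φ g.cell)
    (inner : D.comp (p := .cons A.pro (.pair L.pro B.pro)) (.pair A.r (D.idCell B.pro)) φ
        (Category.id_comp _).symm (Category.id_comp _).symm =
      D.comp (.pair (D.idCell A.pro) B.l) φ (Category.id_comp _).symm (Category.id_comp _).symm) :
    IsBimodHom f g (.pair A B) C φ where
  left {L} B' q e := by
    cases e
    exact (comp_congr rfl _ _ _).trans left
  right {L} q B' e := by
    cases q with
    | nil => cases e
    | cons _ q =>
      cases q with
      | nil =>
        cases e
        exact (comp_congr rfl _ _ _).trans right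
      | cons _ q => cases q <;> cases e
  inner {K L K'} q B₁ B₂ r e := by
    cases q with
    | nil =>
      cases e
      exact (comp_congr rfl _ _ _).trans (inner.trans (comp_congr rfl _ _ _))
    | cons _ q =>
      cases q with
      | nil => cases e
      | cons _ q => cases q <;> cases e
  nil := trivial

theorem IsBimodHom.map_smul {A : Bimod M N} {C : Bimod M' N'}
    {φ : D.Cell f.hom g.hom (.single A.pro) C.pro} (hφ : IsBimodHom f g (.single A) C φ)
    {a b c : D.Obj} {x : a ⟶ M.obj} {y : b ⟶ M.obj} {t : c ⟶ N.obj}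
    {p : D.Path a b} {q : D.Path b c} {s : D.Path a c} (μ : D.Cell x y p M.pro)
    (α : D.Cell y t q A.pro) (e : s = p.append q) {x' : a ⟶ M'.obj} {y' : b ⟶ M'.obj}
    {t' : c ⟶ N'.obj} (ex : x' = x ≫ f.hom) (ey : y' = y ≫ f.hom) (et : t' = t ≫ g.hom) :
    D.comp (.single (A.smul μ α e)) φ ex et =
      C.smul (D.comp (.single μ) f.cell ex ey) (D.comp (.single α) φ ey et) e :=
  hφ.left_comp rfl μ α (.nil t) e e (ProPath.append_nil _).symm _ (.single α) rfl rfl ex et ey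

theorem IsBimodHom.map_rsmul {A : Bimod M N} {C : Bimod M' N'}
    {φ : D.Cell f.hom g.hom (.single A.pro) C.pro} (hφ : IsBimodHom f g (.single A) C φ)
    {a b c : D.Obj} {x : a ⟶ M.obj} {y : b ⟶ N.obj} {t : c ⟶ N.obj}
    {p : D.Path a b} {q : D.Path b c} {s : D.Path a c} (α : D.Cell x y p A.pro)
    (μ : D.Cell y t q N.pro) (e : s = p.append q) {x' : a ⟶ M'.obj} {y' : b ⟶ N'.obj}
    {t' : c ⟶ N'.obj} (ex : x' = x ≫ f.hom) (ey : y' = y ≫ g.hom) (et : t' = t ≫ g.hom) :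
    D.comp (.single (A.rsmul α μ e)) φ ex et =
      C.rsmul (D.comp (.single α) φ ex ey) (D.comp (.single μ) g.cell ey et) e :=
  hφ.right_comp (t₀ := .nil _) rfl (.nil x) α μ e rfl e _ (.single α) rfl rfl ex et ey

/-- Both actions of a unit bimodule are the multiplication, so multiplicativity is each of the two
conditions. -/
theorem Mon.Hom.isBimodHom (f : Mon.Hom M M') :
    IsBimodHom f f (.single M.self) M'.self f.cell :=
  isBimodHom_single_iff.2 ⟨f.mul_cell, f.mul_cell⟩

theorem Mon.comp_unitAt (M : D.Mon) {a b : D.Obj} (h : a ⟶ b) (x : b ⟶ M.obj) {y : a ⟶ M.obj}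
    (e : y = h ≫ x) : D.comp (.nil h) (M.unitAt x) e e = M.unitAt y := by
  subst e
  exact comp_comp _ _ _ _ _ _ _ _ rfl rfl (VDOps.compSeq_nil _ _ _ _)

theorem Mon.Hom.map_unitAt (f : Mon.Hom M M') {a : D.Obj} (x : a ⟶ M.obj) {y : a ⟶ M'.obj}
    (e : y = x ≫ f.hom) : D.comp (.single (M.unitAt x)) f.cell e e = M'.unitAt y := by
  refine (comp_single (.nil x) M.unit f.cell (Category.id_comp _).symm (Category.id_comp _).symm
    e e (Category.comp_id x).symm (Category.comp_id x).symm).symm.trans ?_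
  rw [f.unit_cell]
  exact M'.comp_unitAt x f.hom e

theorem Mon.Hom.map_mul (f : Mon.Hom M M') {a b c : D.Obj} {x : a ⟶ M.obj} {y : b ⟶ M.obj}
    {t : c ⟶ M.obj} {p : D.Path a b} {q : D.Path b c} {s : D.Path a c} (μ : D.Cell x y p M.pro)
    (α : D.Cell y t q M.pro) (e : s = p.append q) {x' : a ⟶ M'.obj} {y' : b ⟶ M'.obj}
    {t' : c ⟶ M'.obj} (ex : x' = x ≫ f.hom) (ey : y' = y ≫ f.hom) (et : t' = t ≫ f.hom) :
    D.comp (.single (M.self.smul μ α e)) f.cell ex et =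
      M'.self.smul (D.comp (.single μ) f.cell ex ey) (D.comp (.single α) f.cell ey et) e :=
  f.isBimodHom.map_smul μ α e ex ey et

end Hom

/-! ### Units in the virtual double category of monoids and modules -/

/-- The left action of a bimodule, as a bimodule homomorphism. -/
def Bimod.lCell {M N : D.Mon} (B : Bimod M N) :
    D.Mod.Cell (𝟙 M : M ⟶ M) (𝟙 N : N ⟶ N) (.pair M.self B) B :=
  ⟨B.l, isBimodHom_pair B.assoc_l B.assoc_lr.symm B.assoc_l⟩

/-- The right action of a bimodule, as a bimodule homomorphism. -/
def Bimod.rCell {M N : D.Mon} (B : Bimod M N) :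
    D.Mod.Cell (𝟙 M : M ⟶ M) (𝟙 N : N ⟶ N) (.pair B N.self) B :=
  ⟨B.r, isBimodHom_pair B.assoc_lr B.assoc_r B.assoc_r.symm⟩

/-- The cell of a monoid homomorphism, as a homomorphism of unit bimodules. -/
def Mon.selfCell {M N : D.Mod.Obj} (f : M ⟶ N) : D.Mod.Cell f f (.single (Mon.self M)) (Mon.self N) :=
  ⟨Mon.Hom.cell f, Mon.Hom.isBimodHom f⟩

/-- The unit of a monoid, as a bimodule homomorphism. -/
def Mon.unitCell (M : D.Mod.Obj) : D.Mod.Cell (𝟙 M) (𝟙 M) (.nil M) (Mon.self M) :=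
  ⟨Mon.unit M,
    { left := fun _ _ e => by cases e
      right := fun q _ e => by cases q <;> cases e
      inner := fun q _ _ _ e => by cases q <;> cases e
      nil := (Mon.mul_unit M).trans (Mon.unit_mul M).symm }⟩

/-- Case distinction at the right end of a string, needed because an inserted unit is absorbed by
the bimodule immediately to its left. The recursion runs from the left, so the motive is generalized
over the proarrow that is put in front. -/
theorem _root_.ProPath.cases_append_single {O : Type*} {P : O → O → Type*}
    {motive : ∀ {a b : O}, ProPath P a b → Prop} (nil : ∀ a, motive (.nil a))
    (append : ∀ {a b c : O} (q : ProPath P a b) (B : P b c), motive (q.append (.single B))) :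
    ∀ {a b : O} (p : ProPath P a b), motive p
  | _, _, .nil a => nil a
  | _, _, .cons A p => p.cases_append_single
      (motive := fun {x _} p => ∀ {a' : O} (A : P a' x), motive (.cons A p))
      (fun _ _ A => append (.nil _) A) (fun q B _ A => append (.cons A q) B) A

theorem toList_undSeq_whisker {L M N K : D.Mod.Obj} (q : D.Mod.Path L M) {s t : D.Mod.Path M N}
    (Ξ : D.Mod.CellSeq (𝟙 M) (𝟙 N) s t) (r : D.Mod.Path N K) {s' t' : D.Mod.Path L K}
    (es : s' = q.append (s.append r)) (et : t' = q.append (t.append r)) :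
    (undSeq (D.Mod.whisker q Ξ r es et)).toList =
      (D.idSeq (und q)).toList ++ ((undSeq Ξ).toList ++ (D.idSeq (und r)).toList) := by
  subst es et
  rw [toList_undSeq_append _ (D.Mod.idSeq q) (Ξ.append (D.Mod.idSeq r)) rfl rfl
    (by simp [VDOps.whisker]), toList_undSeq_append _ Ξ (D.Mod.idSeq r) rfl rfl (by simp),
    undSeq_idSeq, undSeq_idSeq]

theorem idSeq_toList_comp {a b c d : D.Obj} {f : a ⟶ c} {g : b ⟶ d} {p : D.Path a b} {B : D.Pro c d}
    (φ : D.Cell f g p B) (X : D.CellSeq (𝟙 a) (𝟙 b) p p) (hX : X.toList = (D.idSeq p).toList) :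
    D.comp X φ (Category.id_comp f).symm (Category.id_comp g).symm = φ :=
  (comp_congr hX _ _ _).trans (D.id_comp φ)

theorem bijective_comp_of_inverse {a b c d : D.Obj} {p q : D.Path a b} (X : D.CellSeq (𝟙 a) (𝟙 b) p q)
    (Y : D.CellSeq (𝟙 a) (𝟙 b) q p) {f : a ⟶ c} {g : b ⟶ d} {C : D.Pro c d}
    (h₁ : ∀ γ : D.Cell f g p C, D.comp X (D.comp Y γ (Category.id_comp f).symm
      (Category.id_comp g).symm) (Category.id_comp f).symm (Category.id_comp g).symm = γ)
    (h₂ : ∀ χ : D.Cell f g q C, D.comp Y (D.comp X χ (Category.id_comp f).symm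
      (Category.id_comp g).symm) (Category.id_comp f).symm (Category.id_comp g).symm = χ) :
    Function.Bijective fun χ : D.Cell f g q C =>
      D.comp X χ (Category.id_comp f).symm (Category.id_comp g).symm :=
  Function.bijective_iff_has_inverse.2 ⟨fun γ => D.comp Y γ (Category.id_comp f).symm
    (Category.id_comp g).symm, h₂, h₁⟩

/-! ### Inserting a unit into a string and absorbing it into a neighbour. -/

section Whisker

variable {a b c d x y : D.Obj} {f : a ⟶ x} {g : d ⟶ y} {C : D.Pro x y}

/-- The first round trip is trivial already on strings: b ↦ (b, 1) ↦ b·1 = b, by the unit law `hρ`.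
-/
theorem comp_whisker_unit_right (q : D.Path a b) {B : D.Pro b c} {V : D.Pro c c} (r : D.Path c d)
    {θ : D.Cell (𝟙 c) (𝟙 c) (.nil c) V} {ρ : D.Cell (𝟙 b) (𝟙 c) (.pair B V) B}
    (hρ : D.comp (.pair (D.idCell B) θ) ρ (Category.comp_id _).symm (Category.comp_id _).symm =
      D.idCell B) {S T : D.Path a d} (es : S = (q.append (.single B)).append ((ProPath.nil c).append r))
    (et : T = (q.append (.single B)).append ((ProPath.single V).append r))
    (es' : T = q.append ((ProPath.pair B V).append r))
    (et' : S = q.append ((ProPath.single B).append r)) (γ : D.Cell f g S C) :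
    D.comp (D.whisker (q.append (.single B)) (.single θ) r es et)
      (D.comp (D.whisker q (.single ρ) r es' et') γ (Category.id_comp f).symm
        (Category.id_comp g).symm) (Category.id_comp f).symm (Category.id_comp g).symm = γ := by
  subst et'
  refine (comp_comp _ _ _ _ _ _ _ (D.idSeq _) (Category.id_comp _).symm
    (Category.id_comp _).symm ?_).trans (D.id_comp γ)
  refine (compSeq_whisker _ (D.idSeq q) (.pair (D.idCell B) θ) (D.idSeq r) _ _ _ rfl
    ((toList_whisker _ _ _ _ _).trans (by
      rw [VDOps.toList_idSeq_append, List.append_assoc]; rfl)) _ _).trans ?_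
  rw [VDOps.toList_compSeq_single, VDOps.toList_idSeq_append]
  exact congrArg (fun x => (D.idSeq q).toList ++ VDShape.AnyCell.mk x :: (D.idSeq r).toList) hρ

theorem comp_whisker_unit_left {B : D.Pro a b} {V : D.Pro a a} (r : D.Path b d)
    {θ : D.Cell (𝟙 a) (𝟙 a) (.nil a) V} {ρ : D.Cell (𝟙 a) (𝟙 b) (.pair V B) B}
    (hρ : D.comp (.pair θ (D.idCell B)) ρ (Category.comp_id _).symm (Category.comp_id _).symm =
      D.idCell B) (γ : D.Cell f g (.cons B r) C) :
    D.comp (D.whisker (.nil a) (.single θ) (.cons B r) rfl rfl)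
      (D.comp (D.whisker (.nil a) (.single ρ) r rfl rfl) γ (Category.id_comp f).symm
        (Category.id_comp g).symm) (Category.id_comp f).symm (Category.id_comp g).symm = γ := by
  refine (comp_comp _ _ _ _ _ _ _ (D.idSeq _) (Category.id_comp _).symm
    (Category.id_comp _).symm ?_).trans (D.id_comp γ)
  refine (compSeq_whisker _ (.nil _) (.pair θ (D.idCell B)) (D.idSeq r) _ _ _ rfl
    (toList_whisker _ _ _ _ _) _ _).trans ?_
  rw [VDOps.toList_compSeq_single]
  exact congrArg (fun x => VDShape.AnyCell.mk x :: (D.idSeq r).toList) hρ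

/-- The second round trip is not trivial on strings: (b, v) becomes (b·v, 1). It becomes the
identity only after composing with a cell that equalizes the inner actions. -/
theorem comp_whisker_whisker_right (q : D.Path a b) {B : D.Pro b c} {V : D.Pro c c} (r : D.Path c d)
    (θ : D.Cell (𝟙 c) (𝟙 c) (.nil c) V) (ρ : D.Cell (𝟙 b) (𝟙 c) (.pair B V) B)
    {S T : D.Path a d} (es : S = (q.append (.single B)).append ((ProPath.nil c).append r))
    (et : T = (q.append (.single B)).append ((ProPath.single V).append r))
    (es' : T = q.append ((ProPath.pair B V).append r))
    (et' : S = q.append ((ProPath.single B).append r)) (χ : D.Cell f g T C) :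
    D.comp (D.whisker q (.single ρ) r es' et')
      (D.comp (D.whisker (q.append (.single B)) (.single θ) r es et) χ (Category.id_comp f).symm
        (Category.id_comp g).symm) (Category.id_comp f).symm (Category.id_comp g).symm =
    D.comp (D.whisker q (.pair ρ θ) r es' es') χ (Category.id_comp f).symm
        (Category.id_comp g).symm := by
  subst et' et
  refine comp_comp _ _ _ _ _ _ _ _ (Category.id_comp _).symm (Category.id_comp _).symm ?_
  refine (whisker_compSeq _ (D.idSeq q) (.pair (D.idCell B) θ) (D.idSeq r) _ _ _ es'
    ((toList_whisker _ _ _ _ _).trans (by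
      rw [VDOps.toList_idSeq_append, List.append_assoc]; rfl)) _ _).trans ?_
  refine Eq.trans ?_ (toList_whisker _ _ _ _ _).symm
  refine congrArg (fun l => _ ++ (l ++ (D.idSeq r).toList))
    ((toList_compSeq_pair _ (.single ρ) (.nil _) _ _ rfl rfl rfl _ (Category.id_comp _).symm _).trans ?_)
  exact congrArg₂ (fun x y => [x, y]) (congrArg VDShape.AnyCell.mk (D.comp_id ρ))
    (congrArg VDShape.AnyCell.mk (D.id_comp θ))

theorem comp_whisker_whisker_left {B : D.Pro a b} {V : D.Pro a a} (r : D.Path b d)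
    (θ : D.Cell (𝟙 a) (𝟙 a) (.nil a) V) (ρ : D.Cell (𝟙 a) (𝟙 b) (.pair V B) B)
    (χ : D.Cell f g (.cons V (.cons B r)) C) :
    D.comp (D.whisker (.nil a) (.single ρ) r rfl rfl)
      (D.comp (D.whisker (.nil a) (.single θ) (.cons B r) rfl rfl) χ (Category.id_comp f).symm
        (Category.id_comp g).symm) (Category.id_comp f).symm (Category.id_comp g).symm =
    D.comp (D.whisker (.nil a) (s := .pair V B) (.pair θ ρ) r rfl rfl) χ (Category.id_comp f).symm
        (Category.id_comp g).symm := by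
  refine comp_comp _ _ _ _ _ _ _ _ (Category.id_comp _).symm (Category.id_comp _).symm ?_
  refine (whisker_compSeq _ (.nil _) (.pair θ (D.idCell B)) (D.idSeq r) _ _ _ rfl
    (toList_whisker _ _ _ _ _) _ _).trans ?_
  refine Eq.trans ?_ (toList_whisker _ _ _ _ _).symm
  refine congrArg (fun l => _ ++ (l ++ (D.idSeq r).toList))
    ((toList_compSeq_pair _ (.nil _) (.single ρ) _ _ rfl rfl rfl _ (Category.id_comp _).symm _).trans ?_)
  exact congrArg₂ (fun x y => [x, y]) (congrArg VDShape.AnyCell.mk (D.id_comp θ))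
    (congrArg VDShape.AnyCell.mk (D.comp_id ρ))

end Whisker

/-- The inverse must remove M from a string (q, M, r). If `q` is not empty, M acts on the last
bimodule of `q`; otherwise, if `r` is not empty, it acts on the first bimodule of `r`; if both are
empty, it acts on the target. Each inverse is built from composites in Mod(D), so it yields bimodule
homomorphisms. -/
theorem Mon.isOpcartesian_unitCell (M : D.Mod.Obj) : IsOpcartesian (D := D.Mod) (Mon.unitCell M) := by
  intro a' b' c d q
  revert c d b'
  refine ProPath.cases_append_single (motive := fun {a' M} (q : D.Mod.Path a' M) =>
    ∀ ⦃b' c d : D.Mod.Obj⦄ (r : D.Mod.Path M b') (f : a' ⟶ c) (g : b' ⟶ d) (C : D.Mod.Pro c d),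
      Function.Bijective fun χ : D.Mod.Cell f g (q.append (.cons (Mon.self M) r)) C =>
        (D.Mod.comp (D.Mod.whisker q (.single (Mon.unitCell M)) r rfl rfl) χ (Category.id_comp f).symm
          (Category.id_comp g).symm : D.Mod.Cell f g (q.append ((ProPath.nil M).append r)) C)) ?_ ?_ q
  · intro M b' c d r f g C
    cases r with
    | nil =>
      -- No neighbour on either side: the inverse sends γ to m ↦ f(m)·γ. One round trip is f(m)·χ(1)
      -- = χ(m·1) = χ(m) by equivariance of χ, the other is f(1)·γ = 1·γ = γ.
      refine Function.bijective_iff_has_inverse.2 ⟨fun γ => D.Mod.comp (.pair (Mon.selfCell f) γ)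
        (Bimod.lCell C) (Category.comp_id f).symm (Category.comp_id g).symm, ?_, ?_⟩
      · intro χ
        refine Subtype.ext ?_
        refine Eq.trans ?_ (idSeq_toList_comp χ.1 (.single (M.self.smul (D.idCell M.pro) M.unit)) ?_)
        · refine Eq.trans ?_ (χ.2.map_smul (D.idCell M.pro) M.unit rfl (Category.id_comp _).symm
            (Category.id_comp _).symm (Category.id_comp _).symm).symm
          exact congrArg (fun x => C.smul x _) (D.id_comp _).symm
        · exact congrArg (fun x => [VDShape.AnyCell.mk x]) M.mul_unit
      · intro γ
        refine Subtype.ext ?_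
        refine (C.comp_smul (Mon.Hom.cell f) γ.1 rfl _ (.single M.unit) (.nil (𝟙 _)) rfl rfl
          (Category.id_comp _).symm (Category.id_comp _).symm (Category.id_comp _).symm).trans ?_
        exact (pair_congr (Mon.Hom.unit_cell f) (D.id_comp γ.1) _ _ _ _).trans (C.smul_unitAt γ.1)
    | cons B r =>
      refine bijective_comp_of_inverse (D := D.Mod) _
        (D.Mod.whisker (.nil _) (.single (Bimod.lCell B)) r rfl rfl)
        (comp_whisker_unit_left (D := D.Mod) r (Subtype.ext B.unit_l)) fun χ =>
        (comp_whisker_whisker_left (D := D.Mod) r _ _ χ).trans (Subtype.ext ?_)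
      -- After the round trip the string is (1, m·b, …). Since χ equalizes the actions of M, this
      -- may be replaced by (1·m, b, …) = (m, b, …).
      refine Eq.trans ?_ (idSeq_toList_comp χ.1 (.cons (M.self.rsmul M.unit (D.idCell M.pro))
          (D.idSeq (und (.cons B r))) rfl) ?_)
      · symm
        refine χ.2.inner_comp (t₀ := .nil _) rfl (.nil _) M.unit (D.idCell _) (D.idCell B.pro)
          (D.idSeq (und r)) rfl rfl rfl _ _ rfl ?_ _ _
        refine (toList_undSeq_whisker _ _ _ _ _).trans ?_
        exact congrArg (fun x => ⟨M.unit⟩ :: VDShape.AnyCell.mk x :: (D.idSeq (und r)).toList)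
          (D.id_comp B.l).symm
      · exact congrArg (fun x => VDShape.AnyCell.mk x :: (D.idSeq (und (.cons B r))).toList)
          M.unit_mul
  · intro L K M q B N c d r f g C
    have es : (q.append (.single B)).append (.cons M.self r) =
        q.append ((ProPath.pair B M.self).append r) := ProPath.append_assoc _ _ _
    have et : (q.append (.single B)).append r = q.append ((ProPath.single B).append r) :=
      ProPath.append_assoc _ _ _
    refine bijective_comp_of_inverse (D := D.Mod) _
        (D.Mod.whisker q (.single (Bimod.rCell B)) r es et)
        (comp_whisker_unit_right (D := D.Mod) q (B := B) (V := Mon.self M) r (θ := Mon.unitCell M)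
          (ρ := B.rCell) (Subtype.ext B.unit_r) _ _ _ _) fun χ =>
        (comp_whisker_whisker_right (D := D.Mod) q r _ _ _ _ _ _ χ).trans (Subtype.ext ?_)
    -- Mirror image: (…, b·m, 1, …) is identified by χ with (…, b, m·1, …) = (…, b, m, …).
    refine Eq.trans ?_ (idSeq_toList_comp χ.1 (undSeq (D.Mod.whisker q (s := .pair B M.self)
      (.pair (D.Mod.idCell B) (D.Mod.idCell M.self)) r es es)) ?_)
    · refine χ.2.inner_comp (ProPath.append_assoc _ _ _) (D.idSeq (und q)) (D.idCell B.pro)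
        (D.idCell M.pro) M.unit (D.idSeq (und r)) ?_ rfl rfl _ _ ?_ ?_ _ _
      · rw [ProPath.append_assoc, und_append]; rfl
      · refine (toList_undSeq_whisker _ _ _ _ _).trans ?_
        exact congrArg (fun x => (D.idSeq (und q)).toList ++ VDShape.AnyCell.mk x :: ⟨M.unit⟩ ::
          (D.idSeq (und r)).toList) (D.id_comp B.r).symm
      · refine (toList_undSeq_whisker _ _ _ _ _).trans ?_
        exact congrArg (fun x => (D.idSeq (und q)).toList ++ ⟨D.idCell B.pro⟩ ::
          VDShape.AnyCell.mk x :: (D.idSeq (und r)).toList) M.mul_unit.symm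
    · refine (toList_undSeq_whisker _ _ _ _ _).trans ?_
      rw [ProPath.append_assoc, toList_idSeq_und_append]
      rfl

/-! ### Restrictions in the virtual double category of monoids and modules -/

section Restriction

variable {M N M' N' : D.Mod.Obj} {f : M ⟶ M'} {g : N ⟶ N'}

/-- A cell into a bimodule is a bimodule homomorphism if its composite with a bimodule homomorphism
that is a cartesian cell is one. -/
theorem IsBimodHom.of_comp {A : Bimod M N} {C : Bimod M' N'}
    {φ : D.Cell (Mon.Hom.hom f) (Mon.Hom.hom g) (.single A.pro) C.pro}
    (hφ : IsBimodHom f g (.single A) C φ) (hc : IsCartesian φ) {L K : D.Mod.Obj} {h : L ⟶ M}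
    {k : K ⟶ N} {p : D.Mod.Path L K} {χ : D.Cell (Mon.Hom.hom h) (Mon.Hom.hom k) (und p) A.pro}
    (hχ : IsBimodHom (h ≫ f) (k ≫ g) p C (D.comp (.single χ) φ rfl rfl)) :
    IsBimodHom h k p A χ where
  -- Each condition is tested after composing with φ: one side becomes the condition known for the
  -- composite, the other is rewritten by equivariance of φ.
  left B q e := hc.hom_ext rfl rfl (((comp_single _ _ _ rfl rfl (Category.id_comp _).symm
    (Category.id_comp _).symm _ _).symm.trans (hχ.left B q e)).trans
    (hφ.map_smul (Mon.Hom.cell h) χ rfl rfl rfl rfl).symm)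
  right q B e := hc.hom_ext rfl rfl (((comp_single _ _ _ rfl rfl (Category.id_comp _).symm
    (Category.id_comp _).symm _ _).symm.trans (hχ.right q B e)).trans
    (hφ.map_rsmul χ (Mon.Hom.cell k) rfl rfl rfl rfl).symm)
  inner q B B' r e := hc.hom_ext rfl rfl (((comp_single _ _ _ rfl rfl (Category.id_comp _).symm
    (Category.id_comp _).symm _ _).symm.trans (hχ.inner q B B' r e)).trans
    (comp_single _ _ _ rfl rfl (Category.id_comp _).symm (Category.id_comp _).symm _ _))
  nil := by
    cases p with
    | cons => trivial
    | nil =>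
      exact hc.hom_ext rfl rfl (((hφ.map_smul (Mon.Hom.cell h) χ rfl rfl rfl rfl).trans hχ.nil).trans
        (hφ.map_rsmul χ (Mon.Hom.cell k) rfl rfl rfl rfl).symm)

/-- A bimodule homomorphism is cartesian if its underlying cell is. -/
theorem isCartesian_mod {A : D.Mod.Pro M N} {C : D.Mod.Pro M' N'} {φ : D.Mod.Cell f g (.single A) C}
    (hφ : IsCartesian φ.1) : IsCartesian (D := D.Mod) φ := by
  refine isCartesian_of_existsUnique (D := D.Mod) fun L K h k p γ => ?_
  obtain ⟨χ, h₁, h₂⟩ := hφ.existsUnique rfl rfl γ.1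
  have hχ : IsBimodHom h k p A χ := φ.2.of_comp hφ (h₁ ▸ γ.2)
  exact ⟨⟨χ, hχ⟩, Subtype.ext h₁, fun χ' h' => Subtype.ext (h₂ _ (congrArg Subtype.val h'))⟩

variable (f g) in
/-- The restriction of a bimodule along monoid homomorphisms, on a restriction of the underlying
proarrow. -/
theorem exists_restriction_of_isCartesian (C : Bimod M' N') {R : D.Pro (Mon.obj M) (Mon.obj N)}
    {φ : D.Cell (Mon.Hom.hom f) (Mon.Hom.hom g) (.single R) C.pro} (hφ : IsCartesian φ) :
    ∃ (A : D.Mod.Pro M N) (ψ : D.Mod.Cell f g (.single A) C), IsCartesian ψ.1 := by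
  have i₁ := (Category.id_comp (Mon.Hom.hom f)).symm
  have i₂ := (Category.id_comp (Mon.Hom.hom g)).symm
  -- The actions on R are forced by equivariance of φ: m·ρ is the unique lift of f(m)·φ(ρ), and ρ·n
  -- that of φ(ρ)·g(n).
  obtain ⟨l, hl, -⟩ := hφ.existsUnique (p := .pair (Mon.pro M) R) i₁ i₂ (C.smul (Mon.Hom.cell f) φ)
  obtain ⟨r, hr, -⟩ := hφ.existsUnique (p := .pair R (Mon.pro N)) i₁ i₂ (C.rsmul φ (Mon.Hom.cell g))
  -- Equivariance of φ for arbitrary cells in place of identities, with all frames up to equality so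
  -- that it fits each axiom below.
  have hL : ∀ {a b c : D.Obj} {x : a ⟶ Mon.obj M} {y : b ⟶ Mon.obj M} {t : c ⟶ Mon.obj N}
      {p : D.Path a b} {q : D.Path b c} {s : D.Path a c} (μ : D.Cell x y p (Mon.pro M))
      (α : D.Cell y t q R) (e : s = p.append q) {x₁ : a ⟶ Mon.obj M} {t₁ : c ⟶ Mon.obj N}
      {x' : a ⟶ Mon.obj M'} {y' : b ⟶ Mon.obj M'} {t' : c ⟶ Mon.obj N'} (ex₁ : x₁ = x ≫ 𝟙 _)
      (et₁ : t₁ = t ≫ 𝟙 _) (ex : x' = x₁ ≫ Mon.Hom.hom f) (et : t' = t₁ ≫ Mon.Hom.hom g)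
      (ex' : x' = x ≫ Mon.Hom.hom f) (ey : y' = y ≫ Mon.Hom.hom f) (et' : t' = t ≫ Mon.Hom.hom g),
      D.comp (.single (D.comp (.pair μ α e) l ex₁ et₁)) φ ex et =
        C.smul (D.comp (.single μ) (Mon.Hom.cell f) ex' ey) (D.comp (.single α) φ ey et') e := by
    intro a b c x y t p q s μ α e x₁ t₁ x' y' t' ex₁ et₁ ex et ex' ey et'
    refine (comp_single _ _ _ i₁ i₂ ex' et' _ _).symm.trans ?_
    exact (congrArg (fun χ => D.comp _ χ _ _) hl).trans
      (C.comp_smul (Mon.Hom.cell f) φ rfl (.pair μ α e) (.single μ) (.single α) e rfl _ _ _)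
  have hR : ∀ {a b c : D.Obj} {x : a ⟶ Mon.obj M} {y : b ⟶ Mon.obj N} {t : c ⟶ Mon.obj N}
      {p : D.Path a b} {q : D.Path b c} {s : D.Path a c} (α : D.Cell x y p R)
      (μ : D.Cell y t q (Mon.pro N)) (e : s = p.append q) {x₁ : a ⟶ Mon.obj M} {t₁ : c ⟶ Mon.obj N}
      {x' : a ⟶ Mon.obj M'} {y' : b ⟶ Mon.obj N'} {t' : c ⟶ Mon.obj N'} (ex₁ : x₁ = x ≫ 𝟙 _)
      (et₁ : t₁ = t ≫ 𝟙 _) (ex : x' = x₁ ≫ Mon.Hom.hom f) (et : t' = t₁ ≫ Mon.Hom.hom g)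
      (ex' : x' = x ≫ Mon.Hom.hom f) (ey : y' = y ≫ Mon.Hom.hom g) (et' : t' = t ≫ Mon.Hom.hom g),
      D.comp (.single (D.comp (.pair α μ e) r ex₁ et₁)) φ ex et =
        C.rsmul (D.comp (.single α) φ ex' ey) (D.comp (.single μ) (Mon.Hom.cell g) ey et') e := by
    intro a b c x y t p q s α μ e x₁ t₁ x' y' t' ex₁ et₁ ex et ex' ey et'
    refine (comp_single _ _ _ i₁ i₂ ex' et' _ _).symm.trans ?_
    exact (congrArg (fun χ => D.comp _ χ _ _) hr).trans
      (C.comp_rsmul φ (Mon.Hom.cell g) rfl (.pair α μ e) (.single α) (.single μ) e rfl _ _ _)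
  have hM : D.comp (.single (D.idCell _)) (Mon.Hom.cell f) i₁ i₁ = Mon.Hom.cell f := D.id_comp _
  have hN : D.comp (.single (D.idCell _)) (Mon.Hom.cell g) i₂ i₂ = Mon.Hom.cell g := D.id_comp _
  have hφ' : D.comp (.single (D.idCell _)) φ i₁ i₂ = φ := D.id_comp _
  -- Since φ can be cancelled, every axiom for R reduces to the same axiom for C at images under f,
  -- φ and g, using that f and g respect units and products.
  let A : Bimod M N :=
    { pro := R
      l := l
      r := r
      unit_l := hφ.hom_ext i₁ i₂ <| (hL _ _ rfl _ _ _ _ i₁ i₁ i₂).trans <|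
        (C.smul_congr (Mon.Hom.unit_cell f) hφ' rfl).trans <| (C.smul_unitAt φ).trans hφ'.symm
      unit_r := hφ.hom_ext i₁ i₂ <| (hR _ _ rfl _ _ _ _ i₁ i₂ i₂).trans <|
        (C.rsmul_congr hφ' (Mon.Hom.unit_cell g) rfl).trans <| (C.rsmul_unitAt φ).trans hφ'.symm
      assoc_l := hφ.hom_ext i₁ i₂ <| (hL _ _ rfl _ _ _ _ i₁ i₁ i₂).trans <|
        (C.smul_congr (Mon.Hom.mul_cell f) hφ' rfl).trans <|
        (C.smul_smul _ _ _ rfl rfl rfl rfl).trans <|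
        ((hL _ _ rfl _ _ _ _ i₁ i₁ i₂).trans (C.smul_congr hM hl rfl)).symm
      assoc_r := hφ.hom_ext i₁ i₂ <| (hR _ _ rfl _ _ _ _ i₁ i₂ i₂).trans <|
        (C.rsmul_congr hφ' (Mon.Hom.mul_cell g) rfl).trans <|
        (C.rsmul_rsmul _ _ _ rfl rfl rfl rfl).symm.trans <|
        ((hR _ _ rfl _ _ _ _ i₁ i₂ i₂).trans (C.rsmul_congr hr hN rfl)).symm
      assoc_lr := hφ.hom_ext i₁ i₂ <| (hR _ _ rfl _ _ _ _ i₁ i₂ i₂).trans <|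
        (C.rsmul_congr hl hN rfl).trans <|
        (C.rsmul_smul _ _ _ rfl rfl rfl rfl).trans <|
        ((hL _ _ rfl _ _ _ _ i₁ i₁ i₂).trans (C.smul_congr hM hr rfl)).symm }
  exact ⟨A, ⟨φ, (isBimodHom_single_iff (A := A)).2 ⟨hl, hr⟩⟩, hφ⟩

theorem hasRestrictions_mod (h : D.HasRestrictions) : D.Mod.HasRestrictions := by
  intro M N M' N' f g C
  obtain ⟨R, φ, hφ⟩ := h (Mon.Hom.hom f) (Mon.Hom.hom g) C.pro
  obtain ⟨A, ψ, hψ⟩ := exists_restriction_of_isCartesian f g C hφ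
  exact ⟨A, ψ, isCartesian_mod hψ⟩

/-- The underlying cell of a cartesian bimodule homomorphism is cartesian. -/
theorem IsCartesian.val (h : D.HasRestrictions) {A : D.Mod.Pro M N} {C : D.Mod.Pro M' N'}
    {φ : D.Mod.Cell f g (.single A) C} (hφ : IsCartesian (D := D.Mod) φ) : IsCartesian φ.1 := by
  obtain ⟨R, φ', hφ'⟩ := h (Mon.Hom.hom f) (Mon.Hom.hom g) C.pro
  obtain ⟨A', ψ, hψ⟩ := exists_restriction_of_isCartesian f g C hφ'
  -- In Mod(D), φ differs by an invertible cell from a restriction built on a cartesian cell of D;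
  -- the underlying cell of that comparison is invertible too.
  obtain ⟨σ, τ, h₁, h₂, rfl⟩ := hφ.exists_comparison (isCartesian_mod hψ)
  exact (isCartesian_of_inverse (congrArg Subtype.val h₁) (congrArg Subtype.val h₂)).comp hψ _ _

theorem isVirtualEquipment_mod (h : D.HasRestrictions) : D.Mod.IsVirtualEquipment where
  hasUnits M := ⟨_, _, Mon.isOpcartesian_unitCell M⟩
  hasRestrictions := hasRestrictions_mod h

end Restriction

/-! ### The unit bimodules as units -/

variable (D) in
/-- The units of the virtual double category of monoids and modules given by the unit bimodules. -/
def modUnits : D.Mod.Units where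
  pro M := Mon.self M
  cell := Mon.unitCell
  opcart := Mon.isOpcartesian_unitCell

/-- The action induced by the universal property is the only one with the unit law, and the action
that the bimodule already carries has it. So viewing a proarrow of Mod(D) as a bimodule between
trivial monoids recovers its own actions, and embeddings can be computed in D. -/
theorem lact_modUnits {M N : D.Mod.Obj} (P : D.Mod.Pro M N) : D.modUnits.lact P = P.lCell :=
  (D.modUnits.exists_lact P).unique (D.modUnits.lact_spec P) (Subtype.ext P.unit_l)

theorem ract_modUnits {M N : D.Mod.Obj} (P : D.Mod.Pro M N) : D.modUnits.ract P = P.rCell :=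
  (D.modUnits.exists_ract P).unique (D.modUnits.ract_spec P) (Subtype.ext P.unit_r)

/-- The unit cell on an arrow is determined by its value on the unit, and a monoid homomorphism
preserves units. -/
theorem trivCell_modUnits {M N : D.Mod.Obj} (f : M ⟶ N) :
    D.modUnits.trivCell f = Mon.selfCell f :=
  (D.modUnits.exists_trivCell f).unique (D.modUnits.trivCell_spec f)
    (Subtype.ext (Mon.Hom.unit_cell f))

/-- Once the induced actions on `P` are known to be its own, being an embedding is a pair of
equations in D. They mention only the actions of the monoids `A` and `A'`, not those of their bases.
-/
theorem isBimodEmb_modUnits_iff {A A' : D.Mod.Mon} {x y : D.Mod.Obj} {i : D.modUnits.Emb A x}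
    {j : D.modUnits.Emb A' y} {B : Bimod A A'} {P : D.Mod.Pro x y}
    {φ : D.Mod.Cell i.hom j.hom (.single B.pro) P} : D.modUnits.IsBimodEmb i j B P φ ↔
      D.comp (.single B.l.1) φ.1 (Category.id_comp _).symm (Category.id_comp _).symm =
        P.smul i.cell.1 φ.1 ∧
      D.comp (.single B.r.1) φ.1 (Category.id_comp _).symm (Category.id_comp _).symm =
        P.rsmul φ.1 j.cell.1 := by
  refine (isBimodHom_single_iff (D := D.Mod)).trans (and_congr ?_ ?_)
  · refine Subtype.ext_iff.trans (Eq.congr_right ?_)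
    exact congrArg (fun x => D.comp (.pair i.cell.1 φ.1) x (Category.comp_id _).symm
      (Category.comp_id _).symm) (congrArg Subtype.val (lact_modUnits P))
  · refine Subtype.ext_iff.trans (Eq.congr_right ?_)
    exact congrArg (fun x => D.comp (.pair φ.1 j.cell.1) x (Category.comp_id _).symm
      (Category.comp_id _).symm) (congrArg Subtype.val (ract_modUnits P))

/-! ### Collapses in the virtual double category of monoids and modules -/

/-- The proarrow of a monoid of modules, as a bimodule. -/
abbrev Mon.base (A : D.Mod.Mon) : Bimod (D := D) A.obj A.obj := A.pro

/-- The proarrow of a bimodule of modules, as a bimodule. -/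
abbrev Bimod.base {A A' : D.Mod.Mon} (B : Bimod A A') : Bimod (D := D) A.obj A'.obj := B.pro

/-- The monoid in `D` underlying a monoid in the virtual double category of monoids and modules. -/
def Mon.flat (A : D.Mod.Mon) : D.Mod.Obj where
  obj := Mon.obj (Mon.obj A)
  pro := A.base.pro
  unit := A.unit.1
  mul := A.mul.1
  unit_mul := congrArg Subtype.val A.unit_mul
  mul_unit := congrArg Subtype.val A.mul_unit
  mul_assoc := congrArg Subtype.val A.mul_assoc

/-- The bimodule in `D` underlying a bimodule in the virtual double category of monoids and
modules. -/
def Bimod.flat {A A' : D.Mod.Mon} (B : Bimod A A') : D.Mod.Pro A.flat A'.flat where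
  pro := B.base.pro
  l := B.l.1
  r := B.r.1
  unit_l := congrArg Subtype.val B.unit_l
  unit_r := congrArg Subtype.val B.unit_r
  assoc_l := congrArg Subtype.val B.assoc_l
  assoc_r := congrArg Subtype.val B.assoc_r
  assoc_lr := congrArg Subtype.val B.assoc_lr

section Flat

variable {A A' : D.Mod.Mon} (B : Bimod A A') {a b c d : D.Obj} {p : D.Path a b} {q : D.Path b c}
  {r : D.Path c d} {pq : D.Path a c} {qr : D.Path b d} {s : D.Path a d}

/-- The action of `A` on `B` is itself a bimodule homomorphism; this is its compatibility with the
outer left action of the base monoid: (m·α)β = m·(αβ). -/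
theorem Bimod.flat_smul_smul {x : a ⟶ Mon.obj A.obj} {y : b ⟶ Mon.obj A.obj}
    {t : c ⟶ Mon.obj A.obj} {l : d ⟶ Mon.obj A'.obj} (μ : D.Cell x y p (Mon.pro A.obj))
    (α : D.Cell y t q (A.base.pro)) (β : D.Cell t l r (B.base.pro))
    (e₁ : pq = p.append q) (e₂ : s = pq.append r) (e₃ : qr = q.append r) (e₄ : s = p.append qr) :
    B.flat.smul (A.base.smul μ α e₁) β e₂ = B.base.smul μ (B.flat.smul α β e₃) e₄ := by
  refine (B.l.2.left_comp rfl μ α (.single β) e₄ e₁ e₃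
    (.pair _ β e₂) (.pair α β e₃) rfl rfl (Category.comp_id _).symm (Category.comp_id _).symm
    (Category.comp_id _).symm).trans ?_
  exact Bimod.smul_congr _ (D.comp_id μ) rfl _

theorem Bimod.flat_rsmul_rsmul {x : a ⟶ Mon.obj A.obj} {y : b ⟶ Mon.obj A'.obj}
    {t : c ⟶ Mon.obj A'.obj} {l : d ⟶ Mon.obj A'.obj} (β : D.Cell x y p (B.base.pro))
    (α : D.Cell y t q (A'.base.pro)) (μ : D.Cell t l r (Mon.pro A'.obj))
    (e₁ : pq = p.append q) (e₂ : s = pq.append r) (e₃ : qr = q.append r) (e₄ : s = p.append qr) :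
    B.flat.rsmul β (A'.base.rsmul α μ e₃) e₄ = B.base.rsmul (B.flat.rsmul β α e₁) μ e₂ := by
  refine (B.r.2.right_comp (t₀ := .single B.pro) rfl (.single β) α μ e₂ e₁ e₃
    (.pair β _ e₄) (.pair β α e₁) rfl rfl (Category.comp_id _).symm (Category.comp_id _).symm
    (Category.comp_id _).symm).trans ?_
  exact Bimod.rsmul_congr _ rfl (D.comp_id μ) _

end Flat

/-- The cell of the homomorphism from the base monoid of `A` to the monoid underlying `A`. -/
def Mon.flatMapCell (A : D.Mod.Mon) : D.Cell (𝟙 (Mon.obj A.obj)) (𝟙 _) (.single (Mon.pro A.obj))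
    (A.base.pro) :=
  A.base.smul (D.idCell _) A.unit.1

/-- m·1 = 1·m is the condition that the unit of `A` satisfies as a bimodule homomorphism with empty
source. -/
theorem Mon.flatMapCell_eq (A : D.Mod.Mon) :
    A.flatMapCell = A.base.rsmul A.unit.1 (D.idCell _) :=
  A.unit.2.nil

section Flat

variable {A A' : D.Mod.Mon} (B : Bimod A A') {a b c : D.Obj} {p : D.Path a b} {q : D.Path b c}
  {s : D.Path a c}

/-- (m·1)β = m·(1β) = m·β. Hence the action of the base is the restriction of the action of the
underlying monoid and carries no further information. -/
theorem Bimod.flat_smul_flatMapCell {x : a ⟶ Mon.obj A.obj} {y : b ⟶ Mon.obj A.obj}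
    {l : c ⟶ Mon.obj A'.obj} (μ : D.Cell x y p (Mon.pro A.obj))
    (β : D.Cell y l q (B.base.pro)) (e : s = p.append q) :
    B.flat.smul (D.comp (.single μ) A.flatMapCell (Category.comp_id _).symm
      (Category.comp_id _).symm) β e = B.base.smul μ β e := by
  have h : D.comp (.single μ) A.flatMapCell (Category.comp_id _).symm (Category.comp_id _).symm =
      A.base.smul μ (A.flat.unitAt y) (ProPath.append_nil _).symm := by
    refine (Bimod.comp_smul _ _ _ _ _ (.single μ) (.nil y) (ProPath.append_nil _).symm rfl
      (Category.comp_id _).symm (Category.comp_id _).symm (Category.comp_id _).symm).trans ?_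
    exact Bimod.smul_congr _ (D.comp_id μ) rfl _
  refine (B.flat.smul_congr h rfl e).trans ?_
  refine (B.flat_smul_smul μ _ β _ _ rfl e).trans ?_
  exact Bimod.smul_congr _ rfl (B.flat.smul_unitAt β) _

/-- The mirror computation β(1·m) = (β1)·m = β·m, which needs the second description of the map from
the base. -/
theorem Bimod.flat_rsmul_flatMapCell {x : a ⟶ Mon.obj A.obj} {y : b ⟶ Mon.obj A'.obj}
    {l : c ⟶ Mon.obj A'.obj} (β : D.Cell x y p (B.base.pro)) (μ : D.Cell y l q (Mon.pro A'.obj))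
    (e : s = p.append q) :
    B.flat.rsmul β (D.comp (.single μ) A'.flatMapCell (Category.comp_id _).symm
      (Category.comp_id _).symm) e = B.base.rsmul β μ e := by
  have h : D.comp (.single μ) A'.flatMapCell (Category.comp_id _).symm (Category.comp_id _).symm =
      A'.base.rsmul (A'.flat.unitAt y) μ := by
    rw [A'.flatMapCell_eq]
    refine (Bimod.comp_rsmul _ _ _ _ _ (.nil y) (.single μ) rfl rfl
      (Category.comp_id _).symm (Category.comp_id _).symm (Category.comp_id _).symm).trans ?_
    exact Bimod.rsmul_congr _ rfl (D.comp_id μ) _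
  refine (B.flat.rsmul_congr rfl h e).trans ?_
  refine (B.flat_rsmul_rsmul β _ μ (ProPath.append_nil _).symm e _ _).trans ?_
  exact Bimod.rsmul_congr _ (B.flat.rsmul_unitAt β) rfl _

end Flat

/-- The homomorphism from the base monoid of `A` to the monoid underlying `A`. -/
def Mon.flatMap (A : D.Mod.Mon) : A.obj ⟶ A.flat :=
  show Mon.Hom _ _ from
  { hom := 𝟙 _
    cell := A.flatMapCell
    unit_cell := by
      refine (Bimod.comp_smul _ _ _ _ _ (.single (Mon.unit A.obj)) (.nil _) rfl rfl
        (Category.comp_id _).symm (Category.comp_id _).symm (Category.comp_id _).symm).trans ?_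
      refine (Bimod.smul_congr (μ' := Mon.unitAt A.obj (𝟙 _)) _
        ((D.comp_id _).trans (D.id_comp _).symm) rfl rfl).trans ?_
      exact Bimod.smul_unitAt _ _
    mul_cell := by
      refine (Bimod.comp_smul _ _ _ _ _ (.single (Mon.mul A.obj)) (.nil _) rfl rfl
        (Category.comp_id _).symm (Category.comp_id _).symm (Category.comp_id _).symm).trans ?_
      refine (Bimod.smul_congr (β' := A.unit.1) (μ' := (Mon.self A.obj).smul (D.idCell _) (D.idCell _))
        _ ((D.comp_id _).trans (D.id_comp _).symm) (D.id_comp _) rfl).trans ?_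
      -- (m m')·1 = m·(m'·1), and this is the product (m·1)(m'·1) because the base acts on `A`
      -- through the underlying monoid.
      refine (Bimod.smul_smul _ _ _ _ _ _ rfl rfl).trans ?_
      refine ((Bimod.flat_smul_flatMapCell A.self (D.idCell _) A.flatMapCell rfl).symm).trans ?_
      exact pair_congr (D.id_comp _) rfl _ _ _ _ }

/-- The identity cell, as a homomorphism from (the base of) `B` to its underlying bimodule. -/
def Bimod.flatCell {A A' : D.Mod.Mon} (B : Bimod A A') :
    D.Mod.Cell A.flatMap A'.flatMap (.single B.pro) B.flat :=
  ⟨D.idCell _, by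
    -- For an identity cell, equivariance says that the actions of the bases are the restrictions of
    -- the actions of the underlying monoids.
    refine (isBimodHom_single_iff (A := B.base) (C := B.flat)).2 ⟨?_, ?_⟩
    · refine (D.comp_id _).trans ?_
      refine (D.id_comp (B.base.l)).symm.trans ?_
      refine (B.flat_smul_flatMapCell (D.idCell _) (D.idCell _) rfl).symm.trans ?_
      exact pair_congr (D.id_comp _) rfl _ _ _ _
    · refine (D.comp_id _).trans ?_
      refine (D.id_comp (B.base.r)).symm.trans ?_
      refine (B.flat_rsmul_flatMapCell (D.idCell _) (D.idCell _) rfl).symm.trans ?_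
      exact pair_congr rfl (D.id_comp _) _ _ _ _⟩

/-- The embedding of a monoid of modules into its underlying monoid. -/
noncomputable def Mon.flatEmb (A : D.Mod.Mon) : D.modUnits.Emb A A.flat where
  hom := A.flatMap
  cell := A.self.flatCell
  unit_cell := Subtype.ext ((D.comp_id A.unit.1).trans (D.id_comp A.unit.1).symm)
  mul_cell := Subtype.ext (((D.comp_id A.mul.1).trans (D.id_comp A.mul.1).symm).trans
    (congrArg (fun x => D.comp (.pair (D.idCell A.base.pro) (D.idCell A.base.pro)) x
      (Category.comp_id _).symm (Category.comp_id _).symm)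
      (congrArg Subtype.val (lact_modUnits (Mon.self A.flat))).symm))

theorem Mon.isCartesian_flatEmb (A : D.Mod.Mon) : IsCartesian (D := D.Mod) A.flatEmb.cell :=
  isCartesian_mod (isCartesian_idCell A.base.pro)

theorem Bimod.isCartesian_flatCell {A A' : D.Mod.Mon} (B : Bimod A A') :
    IsCartesian (D := D.Mod) B.flatCell :=
  isCartesian_mod (isCartesian_idCell B.base.pro)

/-- `B` and `B.flat` have the same action cells in D, and all embedding cells are identities there.
-/
theorem Bimod.isBimodEmb_flatCell {A A' : D.Mod.Mon} (B : Bimod A A') :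
    D.modUnits.IsBimodEmb A.flatEmb A'.flatEmb B B.flat B.flatCell :=
  isBimodEmb_modUnits_iff.2 ⟨(D.comp_id B.l.1).trans (D.id_comp B.l.1).symm,
    (D.comp_id B.r.1).trans (D.id_comp B.r.1).symm⟩

/-- The homomorphism from the monoid underlying `A` that is induced by an embedding of `A`. -/
def Mon.flatDesc {A : D.Mod.Mon} {y : D.Mod.Obj} (j : D.modUnits.Emb A y) : A.flat ⟶ y :=
  show Mon.Hom _ _ from
  { hom := Mon.Hom.hom (M := A.obj) (N := y) j.hom
    cell := j.cell.1
    unit_cell := congrArg Subtype.val j.unit_cell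
    -- The trivial monoid on y multiplies by the induced action of the unit on itself, which is the
    -- multiplication of y.
    mul_cell := (congrArg Subtype.val j.mul_cell).trans
      (congrArg (fun x => D.comp (.pair j.cell.1 j.cell.1) x
      (Category.comp_id _).symm (Category.comp_id _).symm)
      (congrArg Subtype.val (lact_modUnits (Mon.self y)))) }

theorem Mon.flatEmb_comp_cell {A : D.Mod.Mon} {y : D.Mod.Obj} (f : A.flat ⟶ y) :
    (A.flatEmb.comp f).cell.1 = D.comp (.single (D.idCell A.base.pro)) (Mon.Hom.cell f) rfl rfl :=
  congrArg (fun x => D.comp (.single (D.idCell A.base.pro)) x rfl rfl)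
    (congrArg Subtype.val (trivCell_modUnits f))

/-- Writing h for the base homomorphism of `j`: j(m·1) = h(m)·j(1) = h(m)·1 = h(m). So the cell of
an embedding determines its base homomorphism. -/
theorem Mon.flatMapCell_comp {A : D.Mod.Mon} {y : D.Mod.Obj} (j : D.modUnits.Emb A y) :
    D.comp (.single A.flatMapCell) j.cell.1 (Category.id_comp _).symm (Category.id_comp _).symm =
      Mon.Hom.cell (M := A.obj) (N := y) j.hom := by
  refine (j.cell.2.map_smul (D.idCell (Mon.pro A.obj)) A.unit.1 rfl (Category.id_comp _).symm
    (Category.id_comp _).symm (Category.id_comp _).symm).trans ?_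
  refine (Bimod.smul_congr _ (D.id_comp _) (congrArg Subtype.val j.unit_cell) rfl).trans ?_
  exact (Mon.self y).rsmul_unitAt _

theorem Mon.comp_flatDesc {A : D.Mod.Mon} {y : D.Mod.Obj} (j : D.modUnits.Emb A y) :
    A.flatEmb.comp (flatDesc j) = j :=
  Mon.Hom.ext' (D := D.Mod)
    (Mon.Hom.ext' (D := D) (Category.id_comp (Mon.Hom.hom (M := A.obj) (N := y) j.hom))
      ((comp_comp_idCell _ _ _ _ _ _).trans (flatMapCell_comp j)))
    (Subtype.ext ((single_congr (flatEmb_comp_cell _) _ _ _).trans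
      ((comp_comp_idCell _ _ _ _ _ _).trans (D.id_comp _))))

/-- An embedding of `A` and a homomorphism out of `A.flat` consist of the same cell with the same
unit and multiplication laws; the remaining datum of an embedding, its base homomorphism, is
recovered from the cell. -/
theorem Mon.isCollapse_flatEmb (A : D.Mod.Mon) : D.modUnits.IsCollapse A.flatEmb := by
  refine fun y j => ⟨flatDesc j, comp_flatDesc j, ?_⟩
  rintro f rfl
  -- Uniqueness: composing with an embedding whose cell is an identity underneath does not change
  -- the cell of f.
  refine Mon.Hom.ext' (Category.id_comp (Mon.Hom.hom f)).symm ?_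
  exact (comp_idCell_eq _ _ _ _ _).trans (flatEmb_comp_cell f).symm

/-- Bimodule homomorphisms with one source, up to an equality of the frames. -/
theorem isBimodHom_comp_idCell {M N M' N' : D.Mon} {f : Mon.Hom M M'} {g : Mon.Hom N N'}
    {A : Bimod M N} {C : Bimod M' N'} {x : M.obj ⟶ M'.obj} {y : N.obj ⟶ N'.obj} (hx : f.hom = x)
    (hy : g.hom = y) (ψ : D.Cell x y (.single A.pro) C.pro) {μ : D.Cell x x (.single M.pro) M'.pro}
    {ν : D.Cell y y (.single N.pro) N'.pro} (ex : f.hom = x ≫ 𝟙 _) (ey : g.hom = y ≫ 𝟙 _)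
    (hμ : D.comp (.single μ) (D.idCell _) ex ex = f.cell)
    (hν : D.comp (.single ν) (D.idCell _) ey ey = g.cell)
    (left : D.comp (.single A.l) ψ (Category.id_comp _).symm (Category.id_comp _).symm = C.smul μ ψ)
    (right : D.comp (.single A.r) ψ (Category.id_comp _).symm (Category.id_comp _).symm =
      C.rsmul ψ ν) :
    IsBimodHom f g (.single A) C (D.comp (.single ψ) (D.idCell _) ex ey) := by
  subst hx hy
  obtain rfl := (D.comp_id μ).symm.trans hμ
  obtain rfl := (D.comp_id ν).symm.trans hν
  exact (congrArg (IsBimodHom f g (.single A) C) (D.comp_id ψ)).mpr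
    (isBimodHom_single_iff.2 ⟨left, right⟩)

theorem Mon.flatEmb_comp_cell_comp_idCell {A : D.Mod.Mon} {y : D.Mod.Obj} (f : A.flat ⟶ y)
    (e : Mon.Hom.hom f = (𝟙 _ ≫ Mon.Hom.hom f) ≫ 𝟙 _) :
    D.comp (.single (A.flatEmb.comp f).cell.1) (D.idCell (Mon.pro y)) e e = Mon.Hom.cell f :=
  (single_congr (flatEmb_comp_cell f) _ _ _).trans
    ((comp_comp_idCell _ _ _ _ _ _).trans (D.id_comp _))

/-- The underlying cell of the embedding is an identity, so the factor through it can only be the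
cell of ψ; and that cell is a homomorphism out of `B.flat` exactly because ψ is an embedding. -/
theorem Bimod.isBimodCollapse_flatCell {A A' : D.Mod.Mon} (B : Bimod A A') :
    D.modUnits.IsBimodCollapse A.flatEmb A'.flatEmb B B.flat B.flatCell where
  left := A.isCollapse_flatEmb
  right := A'.isCollapse_flatEmb
  emb := B.isBimodEmb_flatCell
  universal x' y' f g Q ψ hψ := by
    obtain ⟨h₁, h₂⟩ := isBimodEmb_modUnits_iff.1 hψ
    have ef : Mon.Hom.hom f = (𝟙 _ ≫ Mon.Hom.hom f) ≫ 𝟙 _ := by simp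
    have eg : Mon.Hom.hom g = (𝟙 _ ≫ Mon.Hom.hom g) ≫ 𝟙 _ := by simp
    -- The frames of ψ begin with identities left over from the embeddings, so its cell is first
    -- transported to the frames of f and g.
    have hχ : IsBimodHom f g (.single B.flat) Q (D.comp (.single ψ.1) (D.idCell _) ef eg) :=
      isBimodHom_comp_idCell (A := B.flat) (Category.id_comp (Mon.Hom.hom f)).symm
        (Category.id_comp (Mon.Hom.hom g)).symm ψ.1 ef eg
        (Mon.flatEmb_comp_cell_comp_idCell f ef) (Mon.flatEmb_comp_cell_comp_idCell g eg) h₁ h₂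
    refine ⟨⟨_, hχ⟩, Subtype.ext (idCell_comp_comp_idCell ψ.1 ef eg _ _), ?_⟩
    rintro χ rfl
    exact Subtype.ext ((comp_comp_idCell _ _ _ _ _ _).trans (D.id_comp _)).symm

/-- The bimodule underlying `A.self` is by definition the unit of `A.flat`, so the bimodule collapse
applies directly to the cell of the embedding. -/
theorem Mon.isNormalCollapse_flatEmb (A : D.Mod.Mon) : D.modUnits.IsNormalCollapse A.flatEmb :=
  ⟨A.isCollapse_flatEmb, A.self.isBimodCollapse_flatCell⟩

/-! ### Collapses and isomorphisms -/

theorem IsCartesian.of_idCell_comp {a b c d : D.Obj} {f f' : a ⟶ c} {g g' : b ⟶ d} {A : D.Pro a b}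
    {B : D.Pro c d} {φ : D.Cell f g (.single A) B} {ef : f' = 𝟙 a ≫ f} {eg : g' = 𝟙 b ≫ g}
    (h : IsCartesian (D.comp (.single (D.idCell A)) φ ef eg)) : IsCartesian φ := by
  obtain rfl := ef.trans (Category.id_comp _)
  obtain rfl := eg.trans (Category.id_comp _)
  rwa [show D.comp (.single (D.idCell A)) φ ef eg = φ from D.id_comp φ] at h

theorem Mon.isIso_hom {M N : D.Mod.Obj} (a : M ⟶ N) [IsIso a] : IsIso (Mon.Hom.hom a) :=
  ⟨Mon.Hom.hom (inv a), congrArg Mon.Hom.hom (IsIso.hom_inv_id a),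
    congrArg Mon.Hom.hom (IsIso.inv_hom_id a)⟩

/-- A monoid homomorphism is invertible if its vertical arrow is invertible and its cell is
cartesian. -/
theorem Mon.isIso_of_isCartesian {M N : D.Mod.Obj} (a : M ⟶ N) [IsIso (Mon.Hom.hom a)]
    (ha : IsCartesian (Mon.Hom.cell a)) : IsIso a := by
  have e := (IsIso.hom_inv_id (Mon.Hom.hom a)).symm
  have e' := (IsIso.inv_hom_id (Mon.Hom.hom a)).symm
  obtain ⟨τ, h₁, h₂⟩ := ha.exists_inverse e e e' e'
  -- The inverse cell τ respects unit and multiplication because this can be tested after composing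
  -- with the cartesian cell of a, where τ becomes the identity.
  let b : N ⟶ M := show Mon.Hom _ _ from
    { hom := inv (Mon.Hom.hom a)
      cell := τ
      unit_cell := by
        refine ha.hom_ext e' e' ?_
        refine (comp_single _ _ _ e' e' (Category.comp_id _).symm (Category.comp_id _).symm _ _).symm.trans ?_
        refine Eq.trans ?_ (Mon.Hom.map_unitAt a _ e').symm
        rw [h₂]
        exact (D.comp_id _).trans (D.id_comp _).symm
      mul_cell := by
        refine ha.hom_ext e' e' ?_
        refine (comp_single _ _ _ e' e' (Category.comp_id _).symm (Category.comp_id _).symm _ _).symm.trans ?_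
        refine Eq.trans ?_ (Mon.Hom.map_mul a τ τ rfl e' e' e').symm
        refine Eq.trans ?_ ((Mon.self N).smul_congr h₂ h₂ rfl).symm
        rw [h₂]
        exact (D.comp_id _).trans (D.id_comp _).symm }
  exact ⟨b, Mon.Hom.ext' (IsIso.hom_inv_id (Mon.Hom.hom a)) ((comp_comp_idCell _ _ _ _ _ _).trans h₁),
    Mon.Hom.ext' (IsIso.inv_hom_id (Mon.Hom.hom a)) ((comp_comp_idCell _ _ _ _ _ _).trans h₂)⟩

namespace Units

variable {U : D.Units}

/-- Unit cells are determined by their values on units, and a composite of homomorphisms preserves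
units. -/
theorem trivMap_comp {x y t : D.Obj} (f : x ⟶ y) (g : y ⟶ t) :
    U.trivMap (f ≫ g) = U.trivMap f ≫ U.trivMap g := by
  have h : U.trivCell (f ≫ g) = D.comp (.single (U.trivCell f)) (U.trivCell g) rfl rfl :=
    (U.exists_trivCell (f ≫ g)).unique (U.trivCell_spec _)
      (Mon.Hom.unit_cell (show Mon.Hom _ _ from U.trivMap f ≫ U.trivMap g))
  exact Mon.Hom.ext' rfl ((D.comp_id _).trans h)

theorem trivMap_id (x : D.Obj) : U.trivMap (𝟙 x) = 𝟙 (U.triv x) := by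
  have h : U.trivCell (𝟙 x) = D.idCell (U.pro x) :=
    (U.exists_trivCell (𝟙 x)).unique (U.trivCell_spec _) ((D.comp_id _).trans (D.id_comp _).symm)
  exact Mon.Hom.ext' rfl ((D.comp_id _).trans h)

theorem Emb.comp_comp {M : D.Mon} {x y t : D.Obj} (i : U.Emb M x) (f : x ⟶ y) (g : y ⟶ t) :
    (i.comp f).comp g = i.comp (f ≫ g) := by
  have h : (i ≫ U.trivMap f) ≫ U.trivMap g = i ≫ U.trivMap (f ≫ g) := by
    rw [trivMap_comp, Category.assoc]
  exact h

theorem Emb.comp_id {M : D.Mon} {x : D.Obj} (i : U.Emb M x) : i.comp (𝟙 x) = i := by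
  have h : i ≫ U.trivMap (𝟙 x) = i := by rw [trivMap_id, Category.comp_id]
  exact h

/-- Two universal embeddings of the same monoid: each factors through the other, and both round
trips are identities by uniqueness. -/
theorem IsCollapse.isIso {M : D.Mon} {x y : D.Obj} {i : U.Emb M x} (hi : U.IsCollapse i) (a : x ⟶ y)
    (ha : U.IsCollapse (i.comp a)) : IsIso a := by
  obtain ⟨b, hb, -⟩ := ha i
  refine ⟨b, (hi i).unique ?_ i.comp_id, (ha (i.comp a)).unique ?_ (i.comp a).comp_id⟩
  · exact (i.comp_comp a b).symm.trans hb
  · rw [← Emb.comp_comp, hb]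

theorem IsCollapse.comp {M : D.Mon} {x y : D.Obj} {i : U.Emb M x} (hi : U.IsCollapse i) (a : x ⟶ y)
    [IsIso a] : U.IsCollapse (i.comp a) := by
  intro t j
  obtain ⟨f, hf, hf'⟩ := hi j
  refine ⟨inv a ≫ f, ?_, fun g hg => ?_⟩
  · simpa [Emb.comp_comp] using hf
  · rw [← hf' (a ≫ g) ((i.comp_comp a g).symm.trans hg), IsIso.inv_hom_id_assoc]

theorem IsBimodCollapse.existsUnique {M N : D.Mon} {x y : D.Obj} {i : U.Emb M x} {j : U.Emb N y}
    {B : Bimod M N} {P : D.Pro x y} {φ : D.Cell i.hom j.hom (.single B.pro) P}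
    (h : U.IsBimodCollapse i j B P φ) {x' y' : D.Obj} {f : x ⟶ x'} {g : y ⟶ y'} {i' : U.Emb M x'}
    {j' : U.Emb N y'} (hi : i' = i.comp f) (hj : j' = j.comp g) (ei : i'.hom = i.hom ≫ f)
    (ej : j'.hom = j.hom ≫ g) {Q : D.Pro x' y'} {ψ : D.Cell i'.hom j'.hom (.single B.pro) Q}
    (hψ : U.IsBimodEmb i' j' B Q ψ) :
    ∃! χ : D.Cell f g (.single P) Q, D.comp (.single φ) χ ei ej = ψ := by
  subst hi hj
  exact h.universal f g Q ψ hψ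

/-- Collapses of bimodules are stable under cartesian cells over isomorphisms. -/
theorem IsBimodCollapse.comp {M N : D.Mon} {x y : D.Obj} {i : U.Emb M x} {j : U.Emb N y}
    {B : Bimod M N} {P : D.Pro x y} {φ : D.Cell i.hom j.hom (.single B.pro) P}
    (h : U.IsBimodCollapse i j B P φ) {x' y' : D.Obj} (f : x ⟶ x') (g : y ⟶ y') [IsIso f] [IsIso g]
    {Q : D.Pro x' y'} {χ : D.Cell f g (.single P) Q} (hχ : IsCartesian χ)
    (he : U.IsBimodEmb (i.comp f) (j.comp g) B Q (D.comp (.single φ) χ rfl rfl)) :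
    U.IsBimodCollapse (i.comp f) (j.comp g) B Q (D.comp (.single φ) χ rfl rfl) where
  left := h.left.comp f
  right := h.right.comp g
  emb := he
  universal x'' y'' f' g' R ψ hψ := by
    obtain ⟨ω, hω, hω'⟩ := h.existsUnique (Emb.comp_comp _ _ _) (Emb.comp_comp _ _ _)
      (Category.assoc _ _ _) (Category.assoc _ _ _) hψ
    -- First factor through the collapse φ, then through χ, which is invertible since it is
    -- cartesian over isomorphisms.
    obtain ⟨θ, hθ, hθ'⟩ := hχ.existsUnique_factor rfl rfl ω
    refine ⟨θ, ?_, fun θ' h' => hθ' _ (hω' _ ?_)⟩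
    · subst hω hθ
      exact (comp_single _ _ _ _ _ _ _ rfl rfl).symm
    · subst h'
      exact comp_single _ _ _ _ _ _ _ rfl rfl

end Units

/-! ### Regular covers of monoids -/

/-- The kernel embedding that witnesses regularity and `Mon.flatEmb` are two collapses of one
monoid, so they differ by an isomorphism a. Hence f is the map from the base followed by a, and the
former is an identity on objects of D. -/
theorem isIso_hom_of_isRegularCover {c d : D.Mod.Obj} {f : c ⟶ d}
    (hf : D.modUnits.IsRegularCover f) : IsIso (Mon.Hom.hom f) := by
  obtain ⟨⟨A, rfl, i, hom_eq, hc⟩, hi, -⟩ := hf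
  obtain ⟨a, rfl, -⟩ := A.isCollapse_flatEmb i
  have := A.isCollapse_flatEmb.isIso a hi
  -- The equality of objects in the kernel has been eliminated, so the transport in front of f is an
  -- identity.
  obtain rfl : A.flatMap ≫ a = f := hom_eq.trans (Category.id_comp f)
  have := Mon.isIso_hom a
  exact inferInstanceAs (IsIso (𝟙 _ ≫ Mon.Hom.hom a))

/-- The kernel is arbitrary, not the one that witnesses regularity. Still, the induced homomorphism
has the vertical arrow of f, which is invertible, and the kernel cell as its cell, which is
cartesian in D because D has restrictions. -/
theorem Units.Kernel.isIso_flatDesc (h : D.HasRestrictions) {c d : D.Mod.Obj} {f : c ⟶ d}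
    (hf : D.modUnits.IsRegularCover f) (K : D.modUnits.Kernel f) : IsIso (Mon.flatDesc K.emb) := by
  have := isIso_hom_of_isRegularCover hf
  obtain ⟨A, rfl, i, hom_eq, hc⟩ := K
  have : IsIso (Mon.Hom.hom (Mon.flatDesc i)) := by
    obtain rfl : i.hom = f := hom_eq.trans (Category.id_comp f)
    exact this
  exact Mon.isIso_of_isCartesian _ (hc.val h)

/-- φ factors through the universal embedding by some χ over the isomorphisms a and b. That
embedding is an identity underneath, so χ is cartesian because φ is, and composing a collapse with
such a cell gives a collapse. -/
theorem isBimodCollapse_of_isCartesian (h : D.HasRestrictions) {A A' : D.Mod.Mon} {x y : D.Mod.Obj}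
    {i : D.modUnits.Emb A x} {j : D.modUnits.Emb A' y} {a : A.flat ⟶ x} {b : A'.flat ⟶ y} [IsIso a]
    [IsIso b] (ha : A.flatEmb.comp a = i) (hb : A'.flatEmb.comp b = j) {R : Bimod A A'}
    {B : D.Mod.Pro x y} {φ : D.Mod.Cell i.hom j.hom (.single R.pro) B}
    (he : D.modUnits.IsBimodEmb i j R B φ) (hφ : IsCartesian (D := D.Mod) φ) :
    D.modUnits.IsBimodCollapse i j R B φ := by
  subst ha hb
  obtain ⟨χ, rfl, -⟩ := R.isBimodCollapse_flatCell.universal a b B φ he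
  exact R.isBimodCollapse_flatCell.comp a b (isCartesian_mod (IsCartesian.of_idCell_comp (hφ.val h))) he

theorem isRegular_modUnits (h : D.HasRestrictions) : D.modUnits.IsRegular where
  effective_collapse A _ := ⟨_, _, A.isNormalCollapse_flatEmb⟩
  collapse_restriction c d c' d' f g B hf hg K K' R φ he hφ := by
    have := K.isIso_flatDesc h hf
    have := K'.isIso_flatDesc h hg
    exact isBimodCollapse_of_isCartesian h (Mon.comp_flatDesc _) (Mon.comp_flatDesc _) he hφ

namespace Units

/-! ### Independence of the choice of units -/

section Comparison

variable (U V : D.Units)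

theorem exists_comparison (x : D.Obj) :
    ∃! χ : D.Cell (𝟙 x) (𝟙 x) (.single (U.pro x)) (V.pro x), D.comp (.single (U.cell x)) χ
      (Category.id_comp _).symm (Category.id_comp _).symm = V.cell x :=
  (U.opcart x).existsUnique (.nil x) (.nil x) rfl rfl _ rfl _

/-- The comparison between two units of an object. -/
noncomputable def comparison (x : D.Obj) : D.Cell (𝟙 x) (𝟙 x) (.single (U.pro x)) (V.pro x) :=
  (U.exists_comparison V x).choose

theorem comparison_spec (x : D.Obj) : D.comp (.single (U.cell x)) (U.comparison V x)
    (Category.id_comp _).symm (Category.id_comp _).symm = V.cell x :=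
  (U.exists_comparison V x).choose_spec.1

theorem comparison_comp (x : D.Obj) : D.comp (.single (U.comparison V x)) (V.comparison U x)
    (Category.id_comp _).symm (Category.id_comp _).symm = D.idCell (U.pro x) := by
  refine (U.exists_comparison U x).unique ?_ (D.comp_id _)
  refine (comp_single _ _ _ _ _ _ _ (Category.id_comp _).symm (Category.id_comp _).symm).trans ?_
  exact (single_congr (U.comparison_spec V x) _ _ _).trans (V.comparison_spec U x)

theorem isCartesian_comparison (x : D.Obj) : IsCartesian (U.comparison V x) :=
  isCartesian_of_inverse (U.comparison_comp V x) (V.comparison_comp U x)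

/-- The comparison between two trivial monoids on an object. -/
noncomputable def comparisonHom (x : D.Obj) : Mon.Hom (U.triv x) (V.triv x) where
  hom := 𝟙 x
  cell := U.comparison V x
  unit_cell := (U.comparison_spec V x).trans (D.id_comp _).symm
  mul_cell := by
    refine ((U.opcart x).existsUnique (.nil x) (.single (U.pro x)) rfl rfl
      (.pair (U.cell x) (D.idCell (U.pro x))) rfl (U.comparison V x)).unique ?_ ?_
    · refine (comp_single _ _ _ _ _ _ _ (Category.comp_id _).symm
        (Category.comp_id _).symm).trans ?_
      exact (single_congr (U.lact_spec _) _ _ _).trans (D.id_comp _)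
    · refine (comp_pair _ (.single (U.cell x)) (.single (D.idCell _)) _ _ _ rfl rfl rfl _ _
        _ _ (Category.id_comp _).symm (Category.id_comp _).symm (Category.id_comp _).symm).trans ?_
      exact (pair_congr (U.comparison_spec V x) (D.id_comp _) _ _ _ _).trans
        (V.lact_comp _ _ (D.id_comp _))

/-- Both sides satisfy the unit law for the first choice of units, which determines the action. -/
theorem lact_comparison {x y : D.Obj} (P : D.Pro x y) :
    D.comp (.pair (U.comparison V x) (D.idCell P)) (V.lact P) (Category.comp_id _).symm
      (Category.comp_id _).symm = U.lact P := by
  refine (U.exists_lact P).unique ?_ (U.lact_spec P)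
  refine (comp_pair _ (.single (U.cell x)) (.single (D.idCell _)) _ _ _ rfl rfl rfl _ _
        _ _ (Category.id_comp _).symm (Category.id_comp _).symm (Category.id_comp _).symm).trans ?_
  exact (pair_congr (U.comparison_spec V x) (D.id_comp _) _ _ _ _).trans (V.lact_spec P)

theorem ract_comparison {x y : D.Obj} (P : D.Pro x y) :
    D.comp (.pair (D.idCell P) (U.comparison V y)) (V.ract P) (Category.comp_id _).symm
      (Category.comp_id _).symm = U.ract P := by
  refine (U.exists_ract P).unique ?_ (U.ract_spec P)
  refine (comp_pair (.pair (D.idCell P) (U.cell y)) (.single (D.idCell P)) (.single (U.cell y)) _ _ _ rfl rfl rfl _ _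
        _ _ (Category.id_comp _).symm (Category.id_comp _).symm (Category.id_comp _).symm).trans ?_
  exact (pair_congr (D.id_comp _) (U.comparison_spec V y) _ _ _ _).trans (V.ract_spec P)

/-- Naturality of the comparison in vertical arrows. By opcartesianness it suffices to compare the
two sides on the unit cell, where both give the unit of the other choice at f. -/
theorem trivCell_comparison {x y : D.Obj} (f : x ⟶ y) :
    D.comp (.single (U.trivCell f)) (U.comparison V y) (Category.comp_id _).symm
        (Category.comp_id _).symm =
      D.comp (.single (U.comparison V x)) (V.trivCell f) (Category.id_comp _).symm
        (Category.id_comp _).symm := by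
  refine ((U.opcart x).existsUnique (.nil x) (.nil x) rfl rfl (.single (U.cell x)) rfl
    (D.comp (.nil f) (V.cell y) (Category.comp_id _).symm (Category.comp_id _).symm)).unique ?_ ?_
  · refine (comp_single _ _ _ _ _ _ _ (Category.id_comp _).symm (Category.id_comp _).symm).trans ?_
    refine (single_congr (U.trivCell_spec f) _ _ _).trans ?_
    exact (U.comparisonHom V y).map_unitAt f (Category.comp_id _).symm
  · refine (comp_single _ _ _ _ _ _ _ (Category.id_comp _).symm (Category.id_comp _).symm).trans ?_
    exact (single_congr (U.comparison_spec V x) _ _ _).trans (V.trivCell_spec f)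

end Comparison

/-! ### Transport of embeddings, collapses, kernels and regularity between choices of units. -/

section Change

variable {U : D.Units} (V : D.Units) {M N : D.Mon} {x y : D.Obj}

/-- The embedding with respect to other units. -/
noncomputable def Emb.change (i : U.Emb M x) : V.Emb M x where
  hom := i.hom
  cell := D.comp (.single i.cell) (U.comparison V x) (Category.comp_id _).symm
    (Category.comp_id _).symm
  unit_cell := by
    refine (comp_single _ _ _ _ _ _ _ (Category.id_comp _).symm (Category.id_comp _).symm).trans ?_
    refine (single_congr i.unit_cell _ _ _).trans ?_
    exact (U.comparisonHom V x).map_unitAt i.hom (Category.comp_id _).symm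
  mul_cell := by
    refine (comp_single _ _ _ _ _ _ _ (Category.id_comp _).symm (Category.id_comp _).symm).trans ?_
    refine (single_congr i.mul_cell _ _ _).trans ?_
    exact (U.comparisonHom V x).map_mul i.cell i.cell rfl (Category.comp_id _).symm
      (Category.comp_id _).symm (Category.comp_id _).symm

theorem Emb.change_change_cell (i : U.Emb M x) : ((i.change V).change U).cell = i.cell := by
  refine (comp_single _ _ _ (Category.comp_id _).symm (Category.comp_id _).symm
    (Category.comp_id _).symm (Category.comp_id _).symm _ _).symm.trans
    (Eq.trans ?_ (D.comp_id i.cell))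
  exact congrArg (fun χ => D.comp (.single i.cell) χ (Category.comp_id _).symm
    (Category.comp_id _).symm) (U.comparison_comp V x)

theorem Emb.change_change (i : U.Emb M x) : (i.change V).change U = i :=
  Mon.Hom.ext' rfl ((D.comp_id _).trans (i.change_change_cell V))

theorem Emb.change_comp_cell (i : U.Emb M x) (f : x ⟶ y) :
    ((i.change V).comp f).cell = ((i.comp f).change V).cell := by
  refine (comp_single _ _ _ (Category.id_comp f).symm (Category.id_comp f).symm rfl rfl _ _).symm.trans ?_
  refine Eq.trans ?_ (comp_single _ _ _ (Category.comp_id f).symm (Category.comp_id f).symm rfl rfl _ _)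
  exact congrArg (fun χ => D.comp (.single i.cell) χ rfl rfl) (U.trivCell_comparison V f).symm

theorem Emb.change_comp (i : U.Emb M x) (f : x ⟶ y) :
    (i.change V).comp f = (i.comp f).change V :=
  Mon.Hom.ext' rfl ((D.comp_id _).trans (i.change_comp_cell V f))

/-- Changing units is a bijection between the two kinds of embeddings and commutes with composition
with vertical arrows, so it preserves universality. -/
theorem IsCollapse.change {i : U.Emb M x} (hi : U.IsCollapse i) : V.IsCollapse (i.change V) := by
  intro y j
  obtain ⟨f, hf, hf'⟩ := hi (j.change U)
  refine ⟨f, ?_, fun g hg => hf' g ?_⟩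
  · exact (i.change_comp V f).trans ((congrArg _ hf).trans (j.change_change U))
  · rw [← hg, Emb.change_comp, Emb.change_change]

theorem Emb.isCartesian_change {i : U.Emb M x} (hi : IsCartesian i.cell) :
    IsCartesian (i.change V).cell :=
  hi.comp (U.isCartesian_comparison V x) _ _

theorem trivBimod_smul_change {a b c : D.Obj} (P : D.Pro x y) {f : a ⟶ x} {g : b ⟶ x} {h : c ⟶ y}
    {p : D.Path a b} {q : D.Path b c} {s : D.Path a c} (μ : D.Cell f g p (U.pro x))
    (β : D.Cell g h q P) (e : s = p.append q) :
    (V.trivBimod P).smul (D.comp (.single μ) (U.comparison V x) (Category.comp_id _).symm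
      (Category.comp_id _).symm) β e = (U.trivBimod P).smul μ β e := by
  have := congrArg (fun χ => D.comp (.pair μ β e) χ (Category.comp_id f).symm
    (Category.comp_id h).symm) (U.lact_comparison V P)
  refine Eq.trans (Eq.symm ?_) this
  refine (comp_pair _ (.single μ) (.single β) _ _ _ e rfl rfl _ _ _ _ (Category.comp_id _).symm
    (Category.comp_id _).symm (Category.comp_id _).symm).trans ?_
  exact pair_congr rfl (D.comp_id β) _ _ _ _

theorem trivBimod_rsmul_change {a b c : D.Obj} (P : D.Pro x y) {f : a ⟶ x} {g : b ⟶ y} {h : c ⟶ y}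
    {p : D.Path a b} {q : D.Path b c} {s : D.Path a c} (β : D.Cell f g p P)
    (μ : D.Cell g h q (U.pro y)) (e : s = p.append q) :
    (V.trivBimod P).rsmul β (D.comp (.single μ) (U.comparison V y) (Category.comp_id _).symm
      (Category.comp_id _).symm) e = (U.trivBimod P).rsmul β μ e := by
  have := congrArg (fun χ => D.comp (.pair β μ e) χ (Category.comp_id f).symm
    (Category.comp_id h).symm) (U.ract_comparison V P)
  refine Eq.trans (Eq.symm ?_) this
  refine (comp_pair _ (.single β) (.single μ) _ _ _ e rfl rfl _ _ _ _ (Category.comp_id _).symm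
    (Category.comp_id _).symm (Category.comp_id _).symm).trans ?_
  exact pair_congr (D.comp_id β) rfl _ _ _ _

variable {i : U.Emb M x} {j : U.Emb N y} {B : Bimod M N} {P : D.Pro x y}
  {φ : D.Cell i.hom j.hom (.single B.pro) P}

/-- The comparison of units intertwines their actions on `P`, so the equivariance equations are
literally exchanged; the cell φ is untouched. -/
theorem isBimodEmb_change_iff :
    V.IsBimodEmb (i.change V) (j.change V) B P φ ↔ U.IsBimodEmb i j B P φ :=
  isBimodHom_single_iff.trans ((and_congr
    (Eq.congr_right (trivBimod_smul_change V P i.cell φ rfl))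
    (Eq.congr_right (trivBimod_rsmul_change V P φ j.cell rfl))).trans
    (isBimodHom_single_iff (f := i) (g := j) (A := B) (C := U.trivBimod P)).symm)

theorem IsBimodCollapse.change (h : U.IsBimodCollapse i j B P φ) :
    V.IsBimodCollapse (i.change V) (j.change V) B P φ where
  left := h.left.change V
  right := h.right.change V
  emb := (isBimodEmb_change_iff V).2 h.emb
  universal x' y' f g Q ψ hψ := by
    refine h.universal f g Q ψ ((isBimodEmb_change_iff V).1 ?_)
    -- Changing units before or after composing with f gives embeddings with the same vertical arrow
    -- whose cells are only propositionally equal. Rewriting those cells inside the two equations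
    -- spares a transport of ψ.
    obtain ⟨h₁, h₂⟩ := isBimodHom_single_iff.1 hψ
    exact isBimodHom_single_iff.2
      ⟨h₁.trans (Bimod.smul_congr _ (i.change_comp_cell V f) rfl rfl),
        h₂.trans (Bimod.rsmul_congr _ rfl (j.change_comp_cell V g) rfl)⟩

/-- Changing units back and forth keeps the vertical arrow definitionally, and the cell only up to a
proved equality. With the arrows held fixed, the cells can be replaced while φ keeps its type. -/
theorem IsBimodCollapse.congr_cell {U : D.Units} {h : M.obj ⟶ x} {k : N.obj ⟶ y}
    {α α' : D.Cell h h (.single M.pro) (U.pro x)} {β β' : D.Cell k k (.single N.pro) (U.pro y)}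
    (hα : α = α') (hβ : β = β') {uα mα uα' mα' uβ mβ uβ' mβ'} {φ : D.Cell h k (.single B.pro) P}
    (H : U.IsBimodCollapse ⟨h, α, uα, mα⟩ ⟨k, β, uβ, mβ⟩ B P φ) :
    U.IsBimodCollapse ⟨h, α', uα', mα'⟩ ⟨k, β', uβ', mβ'⟩ B P φ := by
  subst hα hβ
  exact H

theorem IsBimodCollapse.of_change (h : V.IsBimodCollapse (i.change V) (j.change V) B P φ) :
    U.IsBimodCollapse i j B P φ :=
  (h.change U).congr_cell (i.change_change_cell V) (j.change_change_cell V)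

/-- Collapses of bimodules are stable under isomorphisms of proarrows. -/
theorem IsBimodCollapse.comp_isCartesian (h : U.IsBimodCollapse i j B P φ) {Q : D.Pro x y}
    {χ : D.Cell (𝟙 x) (𝟙 y) (.single P) Q} (hχ : IsCartesian χ)
    {φ' : D.Cell i.hom j.hom (.single B.pro) Q} (hφ' : D.comp (.single φ) χ (Category.comp_id _).symm
      (Category.comp_id _).symm = φ') (he : U.IsBimodEmb i j B Q φ') :
    U.IsBimodCollapse i j B Q φ' where
  left := h.left
  right := h.right
  emb := he
  universal x' y' f g R ψ hψ := by
    obtain ⟨ω, hω, hω'⟩ := h.universal f g R ψ hψ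
    obtain ⟨θ, hθ, hθ'⟩ := hχ.existsUnique_factor (Category.id_comp f).symm (Category.id_comp g).symm ω
    subst hφ'
    refine ⟨θ, ?_, fun θ' h' => hθ' _ (hω' _ ?_)⟩
    · subst hω hθ
      exact (comp_single _ _ _ _ _ _ _ _ _).symm
    · subst h'
      exact comp_single _ _ _ _ _ _ _ _ _

/-- The multiplication of the trivial monoid is the left action of the unit; the right condition
holds because the two actions of a unit on itself agree. -/
theorem isBimodEmb_self (i : U.Emb M x) : U.IsBimodEmb i i M.self (U.pro x) i.cell :=
  isBimodHom_single_iff.2 ⟨i.mul_cell, i.mul_cell.trans (congrArg (fun χ =>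
    D.comp (.pair i.cell i.cell) χ (Category.comp_id _).symm (Category.comp_id _).symm)
    (U.ract_eq_lact x).symm)⟩

/-- Here the target of the bimodule collapse is itself a unit, so after the change of units it must
also be composed with the invertible comparison. -/
theorem IsNormalCollapse.change (h : U.IsNormalCollapse i) : V.IsNormalCollapse (i.change V) :=
  ⟨h.1.change V, (h.2.change V).comp_isCartesian (U.isCartesian_comparison V x) rfl
    (isBimodEmb_self _)⟩

/-- The kernel with respect to other units. -/
noncomputable def Kernel.change {c d : D.Obj} {f : c ⟶ d} (K : U.Kernel f) : V.Kernel f where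
  mon := K.mon
  obj_eq := K.obj_eq
  emb := K.emb.change V
  hom_eq := K.hom_eq
  cart := Emb.isCartesian_change V K.cart

theorem IsRegularCover.change {c d : D.Obj} {f : c ⟶ d} (h : U.IsRegularCover f) :
    V.IsRegularCover f := by
  obtain ⟨K, hK⟩ := h
  exact ⟨K.change V, hK.change V⟩

theorem IsEffective.change (h : U.IsEffective M) : V.IsEffective M := by
  obtain ⟨d, i, hi⟩ := h
  exact ⟨d, i.change V, Emb.isCartesian_change V hi⟩

theorem IsRegular.change (h : U.IsRegular) : V.IsRegular where
  effective_collapse M hM := by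
    obtain ⟨x, i, hi⟩ := h.effective_collapse M (hM.change U)
    exact ⟨x, i.change V, hi.change V⟩
  collapse_restriction _ _ _ _ f g B hf hg K K' R φ he hφ :=
    -- Kernels for the new units become kernels for the old ones on the same monoids; the collapse
    -- obtained there is then brought back.
    (h.collapse_restriction f g B (hf.change U) (hg.change U) (K.change U) (K'.change U) R φ
      ((isBimodEmb_change_iff U).2 he) hφ).of_change U

end Change

end Units

end VirtualDoubleCategory

/-! ### The theorem for arbitrary units of Mod(D). -/

theorem mainTheorem3 (D : VirtualDoubleCategory.{u, v, w, z}) (hD : D.IsVirtualEquipment) :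
    D.Mod.IsVirtualEquipment ∧ ∀ U : D.Mod.Units, U.IsExact ∧
      (∀ M : D.Mod.Mon, ∃ (x : D.Mod.Obj) (i : U.Emb M x),
        U.IsCollapse i ∧ VirtualDoubleCategory.IsCartesian i.cell) ∧
      ∀ (M N : D.Mod.Mon) (B : VirtualDoubleCategory.Bimod M N),
        ∃ (x y : D.Mod.Obj) (i : U.Emb M x) (j : U.Emb N y) (P : D.Mod.Pro x y)
          (φ : D.Mod.Cell i.hom j.hom (.single B.pro) P), U.IsBimodCollapse i j B P φ ∧
            VirtualDoubleCategory.IsCartesian i.cell ∧ VirtualDoubleCategory.IsCartesian j.cell ∧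
            VirtualDoubleCategory.IsCartesian φ := by
  refine ⟨VirtualDoubleCategory.isVirtualEquipment_mod hD.hasRestrictions, fun U => ?_⟩
  have hM (M : D.Mod.Mon) : VirtualDoubleCategory.IsCartesian (D := D.Mod) (M.flatEmb.change U).cell :=
    VirtualDoubleCategory.Units.Emb.isCartesian_change U M.isCartesian_flatEmb
  -- One family of witnesses serves effectiveness and the two final claims: the embeddings into
  -- underlying monoids and bimodules, rewritten for the units U.
  have hB (M N : D.Mod.Mon) (B : VirtualDoubleCategory.Bimod M N) := B.isBimodCollapse_flatCell.change U
  exact ⟨⟨(VirtualDoubleCategory.isRegular_modUnits hD.hasRestrictions).change U, fun M => ⟨_, _, hM M⟩,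
    fun M N B => ⟨_, _, _, _, _, _, (hB M N B).emb, hM M, hM N, B.isCartesian_flatCell⟩⟩,
    fun M => ⟨_, _, M.isCollapse_flatEmb.change U, hM M⟩,
    fun M N B => ⟨_, _, _, _, _, _, hB M N B, hM M, hM N, B.isCartesian_flatCell⟩⟩
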